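/- Let $(M,g)$ be a smooth Riemannian 4-manifold with Levi-Civita connection $\nabla$ and a compatible integrable complex structure $J$. Orient $M$ so that the 2-form $g_{ac}J^c{}_b$ is anti-self-dual, and let $o_A,\iota_A$ ($o_A\iota^A=1$) be the principal spinors of $J$, so that $J^a{}_b=\mathrm i(o^A\iota_B+\iota^Ao_B)\delta^{A'}_{B'}$; they are defined up to $o\to zo$, $\iota\to z^{-1}\iota$, $z\in\mathbb C^*$. Spinor indices are lowered by $\xi_B=\xi^A\epsilon_{AB}$, and $g_{ab}=\epsilon_{AB}\epsilon_{A'B'}$. Curvature conventions are $(\nabla_a\nabla_b-\nabla_b\nabla_a)V^d=R_{abc}{}^dV^c$ and $R_{ac}=R_{abc}{}^b$. Suppose that $(M,g)$ is quaternionic-Kähler (self-dual Einstein): the anti-self-dual Weyl spinor vanishes, $\Psi_{ABCD}=0$, and $R_{ab}=\lambda g_{ab}$ with a constant $\lambda\neq0$. Put $$f_a=-\tfrac12J^b{}_c\nabla_bJ^c{}_a,\qquad \omega_a=\iota_B\nabla_ao^B,\qquad P_a=\omega_a-\tfrac{\mathrm i}2J^b{}_af_b .$$ On scalars $\chi$ and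 covectors $v_b$ of conformal weight $w$ and GHP weight $p$ (they are multiplied by $z^p$ under the above rescaling) let $$\mathscr C_a\chi=\nabla_a\chi+(wf_a+pP_a)\chi,\qquad \mathscr C_av_b=\nabla_av_b+(wf_a+pP_a)v_b-(f_av_b+f_bv_a-g_{ab}f^cv_c).$$ The Teukolsky equation for weights $(w,p)$ is $\Box^{\mathscr C}\chi:=g^{ab}\mathscr C_a\mathscr C_b\chi=0$. For $i\in\{0,\dots,4\}$ let $W^i_{abcd}=S^i_{ABCD}\,\epsilon_{A'B'}\epsilon_{C'D'}$, where $S^i_{ABCD}$ is the totally symmetrised product of $4-i$ factors $o$ and $i$ factors $\iota$ (so $S^0_{ABCD}=o_Ao_Bo_Co_D$ and $S^4_{ABCD}=\iota_A\iota_B\iota_C\iota_D$). **Proposition.** Let $i\in\{0,\dots,4\}$ and let $\Phi^i$ be a smooth complex solution of the Teukolsky equation for weights $(1,2i-4)$. Then the (complex) tensor field $$h^i_{ab}=-\nabla^d\big[(\nabla^c+4f^c)W^i_{c(ab)d}\Phi^i\big]$$ (no sum over $i$) is symmetric and trace-free, and it solves the linearised Einstein equations with cosmological constant, $\mathcal E_{ab}[h^i]=0$,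 where $$\mathcal E_{ab}[h]=-\tfrac12\Box h_{ab}-\tfrac12\nabla_a\nabla_b\,\mathrm{tr}\,h+\nabla^c\nabla_{(a}h_{b)c}-\tfrac12g_{ab}\big[\nabla^c\nabla^dh_{cd}-\Box\,\mathrm{tr}\,h\big]+\lambda h_{ab},\qquad \Box=g^{ab}\nabla_a\nabla_b,\quad \mathrm{tr}\,h=g^{ab}h_{ab}.$$ -/

import Mathlib

open scoped Manifold ContDiff

noncomputable section

namespace QK

/-! ## Tensor calculus in coordinates

Everything in this part is written in a coordinate system: `g y` is the matrix `g_{ab}` of the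
metric at the coordinate point `y`. Tensor indices `a, b, …` run over `Fin 4`, and unprimed and
primed spinor indices `A, A', …` run over `Fin 2`. -/

/-- The coordinate space. -/
abbrev E4 := EuclideanSpace ℝ (Fin 4)

/-- The partial derivative `∂_a F`. -/
def pd {V : Type*} [NormedAddCommGroup V] [NormedSpace ℝ V] (a : Fin 4) (F : E4 → V) (y : E4) : V :=
  fderiv ℝ F y (EuclideanSpace.single a 1)

/-- A matrix-valued function on coordinate space: `g_{ab}`, or `J^a{}_b` (row index upper). -/
abbrev MatField := E4 → Matrix (Fin 4) (Fin 4) ℝ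

/-- The contravariant metric `g^{ab}`. -/
def gInv (g : MatField) (y : E4) (a b : Fin 4) : ℝ := (g y)⁻¹ a b

/-- Christoffel symbols `Γ^c_{ab}` of the Levi-Civita connection (upper index first). -/
def christoffel (g : MatField) (c a b : Fin 4) (y : E4) : ℝ :=
  (1 / 2) * ∑ d, gInv g y c d *
    (pd a (fun x => g x b d) y + pd b (fun x => g x a d) y - pd d (fun x => g x a b) y)

/-- The Riemann tensor `R_{abc}{}^d`, with the convention
`(∇_a ∇_b - ∇_b ∇_a) V^d = R_{abc}{}^d V^c`. -/
def riemann (g : MatField) (a b c d : Fin 4) (y : E4) : ℝ :=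
  pd a (christoffel g d b c) y - pd b (christoffel g d a c) y
    + ∑ e, (christoffel g d a e y * christoffel g e b c y
        - christoffel g d b e y * christoffel g e a c y)

/-- The Ricci tensor `R_{ac} = R_{abc}{}^b`. -/
def ricci (g : MatField) (a c : Fin 4) (y : E4) : ℝ := ∑ b, riemann g a b c b y

/-- The scalar curvature `g^{ab} R_{ab}`. -/
def scalarCurv (g : MatField) (y : E4) : ℝ := ∑ a, ∑ b, gInv g y a b * ricci g a b y

/-- The Weyl tensor `C_{abcd}` in dimension four. -/
def weyl (g : MatField) (a b c d : Fin 4) (y : E4) : ℝ :=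
  (∑ e, riemann g a b c e y * g y e d)
    - (1 / 2) * (g y a c * ricci g b d y - g y a d * ricci g b c y
        - g y b c * ricci g a d y + g y b d * ricci g a c y)
    + (scalarCurv g y / 6) * (g y a c * g y b d - g y a d * g y b c)

/-- (Complex) covariant tensor fields of rank `n`, through their components `T_{a₁ … aₙ}`. -/
abbrev Tens (n : ℕ) := (Fin n → Fin 4) → E4 → ℂ

/-- The Levi-Civita covariant derivative, derivative index first:
`(∇T)_{c a₁ … aₙ} = ∇_c T_{a₁ … aₙ}`. -/
def nabla (g : MatField) {n : ℕ} (T : Tens n) : Tens (n + 1) := fun a y =>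
  pd (a 0) (T (Fin.tail a)) y
    - ∑ r : Fin n, ∑ d, (christoffel g d (a 0) (Fin.tail a r) y : ℂ)
        * T (Function.update (Fin.tail a) r d) y

/-- The trace `g^{ab} h_{ab}`. -/
def trace (g : MatField) (h : Tens 2) : Tens 0 := fun _ y =>
  ∑ a, ∑ b, (gInv g y a b : ℂ) * h ![a, b] y

/-- The linearised Einstein operator
`E_{ab}[h] = -½ □h_{ab} - ½ ∇_a∇_b tr h + ∇^c∇_{(a}h_{b)c} - ½ g_{ab}(∇^c∇^d h_{cd} - □ tr h) + λ h_{ab}`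
with cosmological constant `lam`. -/
def linEinstein (g : MatField) (lam : ℝ) (h : Tens 2) (a b : Fin 4) (y : E4) : ℂ :=
  - (1 / 2) * (∑ c, ∑ d, (gInv g y c d : ℂ) * nabla g (nabla g h) ![c, d, a, b] y)
  - (1 / 2) * nabla g (nabla g (trace g h)) ![a, b] y
  + (1 / 2) * (∑ c, ∑ d, (gInv g y c d : ℂ) *
      (nabla g (nabla g h) ![d, a, b, c] y + nabla g (nabla g h) ![d, b, a, c] y))
  - (1 / 2) * (g y a b : ℂ) *
      ((∑ c, ∑ d, ∑ c', ∑ d', (gInv g y c c' : ℂ) * (gInv g y d d' : ℂ) *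
          nabla g (nabla g h) ![c', d', c, d] y)
        - ∑ c, ∑ d, (gInv g y c d : ℂ) * nabla g (nabla g (trace g h)) ![c, d] y)
  + (lam : ℂ) * h ![a, b] y

/-- The Nijenhuis tensor
`N^c{}_{ab} = J^d_a ∂_d J^c_b - J^d_b ∂_d J^c_a - J^c_d (∂_a J^d_b - ∂_b J^d_a)`. -/
def nijenhuis (J : MatField) (c a b : Fin 4) (y : E4) : ℝ :=
  ∑ d, (J y d a * pd d (fun x => J x c b) y - J y d b * pd d (fun x => J x c a) y
    - J y c d * (pd a (fun x => J x d b) y - pd b (fun x => J x d a) y))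

/-- `∇_b J^c{}_a`. -/
def nablaJ (g J : MatField) (b c a : Fin 4) (y : E4) : ℝ :=
  pd b (fun x => J x c a) y
    + ∑ e, (christoffel g c b e y * J y e a - christoffel g e b a y * J y c e)

/-- The Lee form `f_a = -½ J^b{}_c ∇_b J^c{}_a`. -/
def leeForm (g J : MatField) (a : Fin 4) (y : E4) : ℝ :=
  - (1 / 2) * ∑ b, ∑ c, J y b c * nablaJ g J b c a y

/-! ## Two-spinors -/

/-- The alternating spinors `ε_{AB}`, `ε^{AB}`, `ε_{A'B'}`, `ε^{A'B'}` in a normalised spin frame.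
Indices are lowered by `ξ_B = ξ^A ε_{AB}`. -/
def eps : Matrix (Fin 2) (Fin 2) ℂ := !![0, 1; -1, 0]

/-- The components `o^A` of the first principal spinor in the spin frame `(o, ι)`. -/
def oUp : Fin 2 → ℂ := ![1, 0]

/-- The components `ι^A` of the second principal spinor in the spin frame `(o, ι)`. -/
def iotaUp : Fin 2 → ℂ := ![0, 1]

/-- Lowering an index, `ξ_B = ξ^A ε_{AB}`. In particular `o_A ι^A = 1`. -/
def lower (ξ : Fin 2 → ℂ) (B : Fin 2) : ℂ := ∑ A, ξ A * eps A B

/-- Soldering forms: `σ y a A A'` is `σ_a{}^{AA'}` at `y`. -/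
abbrev Solder := E4 → Fin 4 → Matrix (Fin 2) (Fin 2) ℂ

/-- The inverse soldering form `σ^b{}_{BB'} = g^{bc} ε_{AB} ε_{A'B'} σ_c{}^{AA'}`. -/
def solderInv (g : MatField) (σ : Solder) (b : Fin 4) (B B' : Fin 2) (y : E4) : ℂ :=
  ∑ c, ∑ A, ∑ A', (gInv g y b c : ℂ) * eps A B * eps A' B' * σ y c A A'

/-- The coefficients `Γ_a{}^B{}_C` of the spin connection on unprimed spinors, i.e. of the unique
connection with `∇ε = 0` and `∇σ = 0`:
`Γ_a{}^B{}_C = -½ σ^b{}_{CB'} (∂_a σ_b{}^{BB'} - Γ^c_{ab} σ_c{}^{BB'})`. -/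
def spinConn (g : MatField) (σ : Solder) (a : Fin 4) (B C : Fin 2) (y : E4) : ℂ :=
  - (1 / 2) * ∑ b, ∑ B', solderInv g σ b C B' y *
    (pd a (fun x => σ x b B B') y - ∑ c, (christoffel g c a b y : ℂ) * σ y c B B')

/-- The covariant derivative `∇_a ξ^B` of an unprimed spinor field. -/
def nablaSpinor (g : MatField) (σ : Solder) (ξ : E4 → Fin 2 → ℂ) (a : Fin 4) (B : Fin 2) (y : E4) :
    ℂ :=
  pd a (fun x => ξ x B) y + ∑ C, spinConn g σ a B C y * ξ y C

/-- The Weyl spinor `Ψ_{ABCD} = ¼ C_{abcd} ε^{A'B'} ε^{C'D'}`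
(with `a = AA'`, and so on), which is the anti-self-dual part of the Weyl tensor. -/
def weylSpinor (g : MatField) (σ : Solder) (A B C D : Fin 2) (y : E4) : ℂ :=
  (1 / 4) * ∑ a, ∑ b, ∑ c, ∑ d, (weyl g a b c d y : ℂ) *
    (∑ A', ∑ B', eps A' B' * solderInv g σ a A A' y * solderInv g σ b B B' y) *
    (∑ C', ∑ D', eps C' D' * solderInv g σ c C C' y * solderInv g σ d D D' y)

/-- The GHP connection form `ω_a = ι_B ∇_a o^B`. -/
def ghpForm (g : MatField) (σ : Solder) (a : Fin 4) (y : E4) : ℂ :=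
  ∑ B, lower iotaUp B * nablaSpinor g σ (fun _ => oUp) a B y

/-- The form `P_a = ω_a - ½ i J^b{}_a f_b`. -/
def formP (g J : MatField) (σ : Solder) (a : Fin 4) (y : E4) : ℂ :=
  ghpForm g σ a y - (1 / 2) * Complex.I * ∑ b, (J y b a : ℂ) * (leeForm g J b y : ℂ)

/-- `𝒞_a χ = ∇_a χ + (w f_a + p P_a) χ` on scalars of weights `(w, p)`. -/
def confD (g J : MatField) (σ : Solder) (w : ℝ) (p : ℤ) (χ : E4 → ℂ) : Tens 1 := fun a y =>
  pd (a 0) χ y + ((w : ℂ) * (leeForm g J (a 0) y : ℂ) + (p : ℂ) * formP g J σ (a 0) y) * χ y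

/-- `𝒞_a v_b = ∇_a v_b + (w f_a + p P_a) v_b - (f_a v_b + f_b v_a - g_{ab} f^c v_c)` on covector
fields of weights `(w, p)`. -/
def confDCovector (g J : MatField) (σ : Solder) (w : ℝ) (p : ℤ) (v : Tens 1) (a b : Fin 4)
    (y : E4) : ℂ :=
  nabla g v ![a, b] y
    + ((w : ℂ) * (leeForm g J a y : ℂ) + (p : ℂ) * formP g J σ a y) * v ![b] y
    - ((leeForm g J a y : ℂ) * v ![b] y + (leeForm g J b y : ℂ) * v ![a] y
        - (g y a b : ℂ) * ∑ c, ∑ d, (gInv g y c d : ℂ) * (leeForm g J d y : ℂ) * v ![c] y)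

/-- The Teukolsky operator `□^𝒞 χ = g^{ab} 𝒞_a 𝒞_b χ` on scalars of weights `(w, p)`. -/
def teukolskyOp (g J : MatField) (σ : Solder) (w : ℝ) (p : ℤ) (χ : E4 → ℂ) (y : E4) : ℂ :=
  ∑ a, ∑ b, (gInv g y a b : ℂ) * confDCovector g J σ w p (confD g J σ w p χ) a b y

/-- The totally symmetric spinor `S^i_{ABCD}`: the symmetrisation of the product of `4 - i` factors
`o` and `i` factors `ι`. -/
def dyadS (i : Fin 5) (K : Fin 4 → Fin 2) : ℂ :=
  (1 / 24) * ∑ π : Equiv.Perm (Fin 4), ∏ k : Fin 4,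
    if (k : ℕ) < 4 - (i : ℕ) then lower oUp (K (π k)) else lower iotaUp (K (π k))

/-- The tensor `W^i_{abcd} = S^i_{ABCD} ε_{A'B'} ε_{C'D'}`. -/
def tensorW (σ : Solder) (i : Fin 5) : Tens 4 := fun a y =>
  ∑ A, ∑ B, ∑ C, ∑ D, dyadS i ![A, B, C, D] *
    (∑ A', ∑ B', eps A' B' * σ y (a 0) A A' * σ y (a 1) B B') *
    (∑ C', ∑ D', eps C' D' * σ y (a 2) C C' * σ y (a 3) D D')

/-- The rank four tensor `T_{cabd} = W^i_{c(ab)d} Φ`. -/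
def tensorWPhi (σ : Solder) (i : Fin 5) (Φ : E4 → ℂ) : Tens 4 := fun a y =>
  (1 / 2) * (tensorW σ i ![a 0, a 1, a 2, a 3] y + tensorW σ i ![a 0, a 2, a 1, a 3] y) * Φ y

/-- The rank three tensor `(∇^c + 4 f^c)(W^i_{c(ab)d} Φ)`, with indices in the order `a, b, d`. -/
def metricPotential (g J : MatField) (σ : Solder) (i : Fin 5) (Φ : E4 → ℂ) : Tens 3 := fun a y =>
  ∑ c, ∑ e, (gInv g y c e : ℂ) *
    (nabla g (tensorWPhi σ i Φ) ![e, c, a 0, a 1, a 2] y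
      + 4 * (leeForm g J e y : ℂ) * tensorWPhi σ i Φ ![c, a 0, a 1, a 2] y)

/-- The metric perturbation `h^i_{ab} = -∇^d[(∇^c + 4 f^c) W^i_{c(ab)d} Φ]`. -/
def metricPert (g J : MatField) (σ : Solder) (i : Fin 5) (Φ : E4 → ℂ) : Tens 2 := fun a y =>
  - ∑ d, ∑ e, (gInv g y d e : ℂ) * nabla g (metricPotential g J σ i Φ) ![e, a 0, a 1, d] y

/-! ## Manifolds -/

section Manifold

variable {M : Type*} [TopologicalSpace M] [ChartedSpace E4 M]

/-- The coordinate vector field `∂_a` of the chart `e`, at the point with coordinates `y`. -/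
def coordVec (e : OpenPartialHomeomorph M E4) (a : Fin 4) (y : E4) :
    TangentSpace (𝓡 4) (e.symm y) :=
  mfderiv (𝓡 4) (𝓡 4) e.symm y (EuclideanSpace.single a (1 : ℝ) : E4)

variable [IsManifold (𝓡 4) ∞ M]

/-- Smooth Riemannian metrics on `M`. -/
abbrev Metric (M : Type*) [TopologicalSpace M] [ChartedSpace E4 M] [IsManifold (𝓡 4) ∞ M] :=
  Bundle.ContMDiffRiemannianMetric (𝓡 4) ∞ E4 (fun x : M => TangentSpace (𝓡 4) x)

/-- The components `g_{ab}` of a metric in the chart `e`. -/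
def metricC (g : Metric M) (e : OpenPartialHomeomorph M E4) : MatField := fun y =>
  Matrix.of fun a b => g.inner (e.symm y) (coordVec e a y) (coordVec e b y)

/-- The components `J^a{}_b` of a field of endomorphisms of the tangent spaces in the chart `e`. -/
def endoC (J : ∀ x : M, TangentSpace (𝓡 4) x →L[ℝ] TangentSpace (𝓡 4) x)
    (e : OpenPartialHomeomorph M E4) : MatField := fun y =>
  Matrix.of fun a b =>
    let v : E4 := mfderiv (𝓡 4) (𝓡 4) e (e.symm y) (J (e.symm y) (coordVec e b y))
    v a

/-- Compatible integrable complex structures on the Riemannian manifold `(M, g)`. -/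
structure ComplexStructure (g : Metric M) where
  /-- The endomorphism `J` at each point. -/
  J : ∀ x : M, TangentSpace (𝓡 4) x →L[ℝ] TangentSpace (𝓡 4) x
  smooth : ContMDiff (𝓡 4) ((𝓡 4).prod 𝓘(ℝ, E4 →L[ℝ] E4)) ∞
    (fun x => Bundle.TotalSpace.mk' (E4 →L[ℝ] E4)
      (E := fun x : M => TangentSpace (𝓡 4) x →L[ℝ] TangentSpace (𝓡 4) x) x (J x))
  sq : ∀ (x : M) (v : TangentSpace (𝓡 4) x), J x (J x v) = -v
  compatible : ∀ (x : M) (u v : TangentSpace (𝓡 4) x),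
    g.inner x (J x u) (J x v) = g.inner x u v
  integrable : ∀ e ∈ IsManifold.maximalAtlas (𝓡 4) ∞ M, ∀ y ∈ e.target, ∀ a b c,
    nijenhuis (endoC J e) c a b y = 0

/-- Principal spin frames at `x`. A real vector `v` is sent to its components `v^{AA'}` with respect
to the normalised unprimed dyad `(o^A, ι^A)` of principal spinors of `J` and some normalised primed
dyad, so that `g_{ab} = ε_{AB} ε_{A'B'}` and `J^a{}_b = i (o^A ι_B + ι^A o_B) δ^{A'}_{B'}`.
The orientation is the one for which the two-form of `J` is anti-self-dual. -/
structure PrincipalFrame (g : Metric M) (𝒥 : ComplexStructure g) (x : M) where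
  /-- The components `v^{AA'}` of a tangent vector. -/
  s : TangentSpace (𝓡 4) x →ₗ[ℝ] Matrix (Fin 2) (Fin 2) ℂ
  metric : ∀ u v : TangentSpace (𝓡 4) x, (g.inner x u v : ℂ) =
    ∑ A, ∑ B, ∑ A', ∑ B', eps A B * eps A' B' * s u A A' * s v B B'
  complex : ∀ (v : TangentSpace (𝓡 4) x) (A A' : Fin 2), s (𝒥.J x v) A A' =
    ∑ B, Complex.I * (oUp A * lower iotaUp B + iotaUp A * lower oUp B) * s v B A'

variable {g : Metric M} {𝒥 : ComplexStructure g}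

/-- The soldering form `σ_a{}^{AA'}` of a frame field in the chart `e`. -/
def solderC (s : ∀ x, PrincipalFrame g 𝒥 x) (e : OpenPartialHomeomorph M E4) : Solder := fun y a =>
  (s (e.symm y)).s (coordVec e a y)

/-- The frame field `s` is smooth over the part of the manifold that the chart `e` maps to the open
set `U`. Smooth frame fields exist near each point, in general not globally: `s` is arbitrary
elsewhere. -/
structure IsLocalFrame (s : ∀ x, PrincipalFrame g 𝒥 x) (e : OpenPartialHomeomorph M E4)
    (U : Set E4) : Prop where
  chart : e ∈ IsManifold.maximalAtlas (𝓡 4) ∞ M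
  isOpen : IsOpen U
  subset : U ⊆ e.target
  smooth : ∀ a A A', ContDiffOn ℝ ∞ (fun y => solderC s e y a A A') U

/-- Smooth weighted scalar fields of (even) GHP weight `p`: complex functions of the principal frame
with `Φ → z^p Φ` under `o → z o`, `ι → z⁻¹ ι`, `z ∈ ℂ*`, and invariant under changes of the
normalised primed dyad. (The conformal weight refers to changes of the metric in its conformal
class. For a fixed metric it enters only through the operators `𝒞_a`.) -/
structure WeightedScalar (g : Metric M) (𝒥 : ComplexStructure g) (p : ℤ) where
  /-- The value in a frame. -/
  val : ∀ x, PrincipalFrame g 𝒥 x → ℂ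
  equivariant : ∀ (x : M) (s s' : PrincipalFrame g 𝒥 x) (z : ℂ) (k : Matrix (Fin 2) (Fin 2) ℂ),
    z ≠ 0 → k.det = 1 → (∀ v, s'.s v = !![z⁻¹, 0; 0, z] * s.s v * k) → val x s' = z ^ p * val x s
  smooth : ∀ s e U, IsLocalFrame s e U →
    ContDiffOn ℝ ∞ (fun y => val (e.symm y) (s (e.symm y))) U

/-- The function that represents a weighted scalar field in a frame field and a chart. -/
def WeightedScalar.rep {p : ℤ} (Φ : WeightedScalar g 𝒥 p) (s : ∀ x, PrincipalFrame g 𝒥 x)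
    (e : OpenPartialHomeomorph M E4) : E4 → ℂ := fun y =>
  Φ.val (e.symm y) (s (e.symm y))

/-- The Teukolsky equation `□^𝒞 Φ = 0` for weights `(w, p)`. -/
def SolvesTeukolsky (w : ℝ) {p : ℤ} (Φ : WeightedScalar g 𝒥 p) : Prop :=
  ∀ s e U, IsLocalFrame s e U → ∀ y ∈ U,
    teukolskyOp (metricC g e) (endoC 𝒥.J e) (solderC s e) w p (Φ.rep s e) y = 0

/-- The Einstein equation `R_{ab} = λ g_{ab}`. -/
def IsEinstein (g : Metric M) (lam : ℝ) : Prop :=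
  ∀ e ∈ IsManifold.maximalAtlas (𝓡 4) ∞ M, ∀ y ∈ e.target, ∀ a b,
    ricci (metricC g e) a b y = lam * metricC g e y a b

/-- The Weyl tensor is self-dual, `Ψ_{ABCD} = 0`, for the orientation for which the two-form of `𝒥`
is anti-self-dual. -/
def IsConformallySelfDual (g : Metric M) (𝒥 : ComplexStructure g) : Prop :=
  ∀ e ∈ IsManifold.maximalAtlas (𝓡 4) ∞ M, ∀ y ∈ e.target, ∀ s : ∀ x, PrincipalFrame g 𝒥 x,
    ∀ A B C D, weylSpinor (metricC g e) (solderC s e) A B C D y = 0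

/-- Quaternionic-Kähler (self-dual Einstein) with non-zero cosmological constant `lam`. -/
structure IsQuaternionicKahler (g : Metric M) (𝒥 : ComplexStructure g) (lam : ℝ) : Prop where
  ne_zero : lam ≠ 0
  einstein : IsEinstein g lam
  selfDual : IsConformallySelfDual g 𝒥

end Manifold

end QK

end

set_option linter.unusedSimpArgs false
set_option linter.unusedSectionVars false
set_option linter.unusedVariables false

/-! Write S = S^i, n = i - 2 and l = -λ/6. The spinor S has GHP weight -2n, opposite to that of Φ.
Integrability of J makes the principal spinors shear-free, so derivatives of S involve only f and P.
Therefore (∇^c + 4f^c)(W_{c(ab)d} Φ) is built from ε-spinors and X_{A'ABC} = ε^{ED} S_{ABCD}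
𝒞_{EA'}Φ (`metricPot_weylPot`). A second divergence gives h_{ab} = 2 ε^{CD} ∇_{C(B'} X_{A')ABD}
(`metricPert_pot`), up to a factor 1/2 absorbed in S. This spinor is symmetric in AB and in A'B', so
h is symmetric and trace-free.

The field equation then rests on two facts.

First, on a self-dual Einstein background every X symmetric in ABC with ∇_{A'(D} X^{A'}_{ABC)} = 0
yields a solution (`ein_hertz`). Let H be the operator X ↦ h, C the unprimed curl of h, G the
symmetrised gradient, T the symmetrised gradient of a covector, and Y the divergence of X. Commuting
derivatives gives 2 C(HX) + G(Y) = 24 l X (`curl22_hertz`). It also gives 6 E(h) = 2 H(Ch) + T(div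
h) - 24 l h up to a multiple of g times the double divergence of h (`ein_eq`), where E is twice the
linearised Einstein operator. Moreover H(GY) = T(div Y) (`symGrad_eq_div`), div(HX) = div Y
(`div22_hertz`) and div div Y = 0 (`div_div20`). Inserting the first identity into the second
cancels everything. The primed Weyl spinor never survives, being totally symmetric.

Second, for the X above the left side of that twistor-type equation is S times the Teukolsky
operator (`twist_potential`). With Ψ = 0 and Ricci pure trace, the unprimed curvature is pure scalar
curvature, and it drops out of the anti-self-dual parts of df and dP (`asd_lee`, `asd_twoP`). So the
part of 𝒞𝒞Φ symmetric in its unprimed indices and antisymmetric in its primed ones vanishes, and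
only the trace remains.

All of this is algebra over a commutative ℂ-algebra with derivations. The remaining work identifies
coordinate tensor calculus with frame calculus (`nab_ofFrame`), extracts the curvature spinors from
the Ricci and Weyl conditions (`selfDualEinstein_of_ricci`) and the shear-free condition from the
Nijenhuis tensor (`hermitian_of_nijenhuis`), and takes as algebra the smooth complex functions on a
coordinate domain. -/

/-- A spin frame calculus: derivations along the null frame `e_{AA'}` of a commutative algebra of
functions, and the coefficients of the Levi-Civita connection on lower spinor indices,
`∇_a ξ_B = e_a ξ_B + U_{aB}{}^C ξ_C` and `∇_a ξ_{B'} = e_a ξ_{B'} + V_{aB'}{}^{C'} ξ_{C'}`. -/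
structure SpinFrame (R : Type*) [CommRing R] [Algebra ℂ R] where
  D : Fin 2 → Fin 2 → Derivation ℂ R R
  U : Fin 2 → Fin 2 → Fin 2 → Fin 2 → R
  V : Fin 2 → Fin 2 → Fin 2 → Fin 2 → R
  traceU : ∀ A A', U A A' 1 1 = - U A A' 0 0
  traceV : ∀ A A', V A A' 1 1 = - V A A' 0 0
  torsion : ∀ A A' B B' f,
    D A A' (D B B' f) + ∑ k, U A A' B k * D k B' f + ∑ k, V A A' B' k * D B k f =
    D B B' (D A A' f) + ∑ k, U B B' A k * D k A' f + ∑ k, V B B' A' k * D A k f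

/-! ### Covariant derivatives and their commutators in a spin frame. -/

namespace SpinFrame

variable {R : Type*} [CommRing R] [Algebra ℂ R] (F : SpinFrame R)

/-- Curvature on lower unprimed spinors. -/
def curvU (A A' B B' C D : Fin 2) : R :=
  F.D A A' (F.U B B' C D) + ∑ k, F.U A A' B k * F.U k B' C D + ∑ k, F.V A A' B' k * F.U B k C D
  - (F.D B B' (F.U A A' C D) + ∑ k, F.U B B' A k * F.U k A' C D
      + ∑ k, F.V B B' A' k * F.U A k C D)
  + ∑ k, (F.U A A' C k * F.U B B' k D - F.U B B' C k * F.U A A' k D)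

/-- Curvature on lower primed spinors. -/
def curvV (A A' B B' C' D' : Fin 2) : R :=
  F.D A A' (F.V B B' C' D') + ∑ k, F.U A A' B k * F.V k B' C' D'
    + ∑ k, F.V A A' B' k * F.V B k C' D'
  - (F.D B B' (F.V A A' C' D') + ∑ k, F.U B B' A k * F.V k A' C' D'
      + ∑ k, F.V B B' A' k * F.V A k C' D')
  + ∑ k, (F.V A A' C' k * F.V B B' k D' - F.V B B' C' k * F.V A A' k D')

/-- `∇_{EE'} X_{A'ABC}`. -/
def n13 (X : Fin 2 → Fin 2 → Fin 2 → Fin 2 → R) (E E' A' A B C : Fin 2) : R :=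
  F.D E E' (X A' A B C) + ∑ k, F.V E E' A' k * X k A B C + ∑ k, F.U E E' A k * X A' k B C
    + ∑ k, F.U E E' B k * X A' A k C + ∑ k, F.U E E' C k * X A' A B k

def nn13 (X : Fin 2 → Fin 2 → Fin 2 → Fin 2 → R) (E E' D D' A' A B C : Fin 2) : R :=
  F.D E E' (F.n13 X D D' A' A B C)
    + ∑ k, F.U E E' D k * F.n13 X k D' A' A B C + ∑ k, F.V E E' D' k * F.n13 X D k A' A B C
    + ∑ k, F.V E E' A' k * F.n13 X D D' k A B C + ∑ k, F.U E E' A k * F.n13 X D D' A' k B C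
    + ∑ k, F.U E E' B k * F.n13 X D D' A' A k C + ∑ k, F.U E E' C k * F.n13 X D D' A' A B k

/-- The torsion identity removes the only second derivatives of components, and what is left is the
curvature. `ricci22` and `ricci20` hold for the same reason. -/
theorem ricci13 (X : Fin 2 → Fin 2 → Fin 2 → Fin 2 → R) (E E' D D' A' A B C : Fin 2) :
    F.nn13 X E E' D D' A' A B C - F.nn13 X D D' E E' A' A B C =
      ∑ k, F.curvV E E' D D' A' k * X k A B C + ∑ k, F.curvU E E' D D' A k * X A' k B C
      + ∑ k, F.curvU E E' D D' B k * X A' A k C + ∑ k, F.curvU E E' D D' C k * X A' A B k := by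
  have t := F.torsion E E' D D' (X A' A B C)
  simp only [nn13, n13, curvU, curvV, Fin.sum_univ_two, map_add, Derivation.leibniz,
    smul_eq_mul] at t ⊢
  linear_combination t


/-- `∇_{EE'} h_{ABA'B'}`. -/
def n22 (h : Fin 2 → Fin 2 → Fin 2 → Fin 2 → R) (E E' A B A' B' : Fin 2) : R :=
  F.D E E' (h A B A' B') + ∑ k, F.U E E' A k * h k B A' B' + ∑ k, F.U E E' B k * h A k A' B'
    + ∑ k, F.V E E' A' k * h A B k B' + ∑ k, F.V E E' B' k * h A B A' k

def nn22 (h : Fin 2 → Fin 2 → Fin 2 → Fin 2 → R) (E E' D D' A B A' B' : Fin 2) : R :=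
  F.D E E' (F.n22 h D D' A B A' B')
    + ∑ k, F.U E E' D k * F.n22 h k D' A B A' B' + ∑ k, F.V E E' D' k * F.n22 h D k A B A' B'
    + ∑ k, F.U E E' A k * F.n22 h D D' k B A' B' + ∑ k, F.U E E' B k * F.n22 h D D' A k A' B'
    + ∑ k, F.V E E' A' k * F.n22 h D D' A B k B' + ∑ k, F.V E E' B' k * F.n22 h D D' A B A' k

theorem ricci22 (h : Fin 2 → Fin 2 → Fin 2 → Fin 2 → R) (E E' D D' A B A' B' : Fin 2) :
    F.nn22 h E E' D D' A B A' B' - F.nn22 h D D' E E' A B A' B' =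
      ∑ k, F.curvU E E' D D' A k * h k B A' B' + ∑ k, F.curvU E E' D D' B k * h A k A' B'
      + ∑ k, F.curvV E E' D D' A' k * h A B k B' + ∑ k, F.curvV E E' D D' B' k * h A B A' k := by
  have t := F.torsion E E' D D' (h A B A' B')
  simp only [nn22, n22, curvU, curvV, Fin.sum_univ_two, map_add, Derivation.leibniz,
    smul_eq_mul] at t ⊢
  linear_combination t

/-- `∇_{EE'} Y_{AB}`. -/
def n20 (Y : Fin 2 → Fin 2 → R) (E E' A B : Fin 2) : R :=
  F.D E E' (Y A B) + ∑ k, F.U E E' A k * Y k B + ∑ k, F.U E E' B k * Y A k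

def nn20 (Y : Fin 2 → Fin 2 → R) (E E' D D' A B : Fin 2) : R :=
  F.D E E' (F.n20 Y D D' A B)
    + ∑ k, F.U E E' D k * F.n20 Y k D' A B + ∑ k, F.V E E' D' k * F.n20 Y D k A B
    + ∑ k, F.U E E' A k * F.n20 Y D D' k B + ∑ k, F.U E E' B k * F.n20 Y D D' A k

theorem ricci20 (Y : Fin 2 → Fin 2 → R) (E E' D D' A B : Fin 2) :
    F.nn20 Y E E' D D' A B - F.nn20 Y D D' E E' A B =
      ∑ k, F.curvU E E' D D' A k * Y k B + ∑ k, F.curvU E E' D D' B k * Y A k := by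
  have t := F.torsion E E' D D' (Y A B)
  simp only [nn20, n20, curvU, Fin.sum_univ_two, map_add, Derivation.leibniz,
    smul_eq_mul] at t ⊢
  linear_combination t

/-- `∇_{EE'} v_{BB'}`. -/
def n11 (v : Fin 2 → Fin 2 → R) (E E' B B' : Fin 2) : R :=
  F.D E E' (v B B') + ∑ k, F.U E E' B k * v k B' + ∑ k, F.V E E' B' k * v B k

/-! ### Hertz potentials -/

/-- `h_{ABA'B'} = 2 ε^{CD} ∇_{C(B'} X_{A')ABD}`. -/
def hertz (X : Fin 2 → Fin 2 → Fin 2 → Fin 2 → R) (A B A' B' : Fin 2) : R :=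
  F.n13 X 0 B' A' A B 1 - F.n13 X 1 B' A' A B 0 + F.n13 X 0 A' B' A B 1 - F.n13 X 1 A' B' A B 0

/-- The divergence `Y_{BC} = ε^{AD} ε^{A'D'} ∇_{AA'} X_{D'DBC}`. -/
def div13 (X : Fin 2 → Fin 2 → Fin 2 → Fin 2 → R) (B C : Fin 2) : R :=
  F.n13 X 0 0 1 1 B C - F.n13 X 0 1 0 1 B C - F.n13 X 1 0 1 0 B C + F.n13 X 1 1 0 0 B C

/-- Four times the symmetrisation of `ε^{D'A'} ∇_{DD'} X_{A'ABC}`. -/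
def twist (X : Fin 2 → Fin 2 → Fin 2 → Fin 2 → R) (D A B C : Fin 2) : R :=
  (F.n13 X D 0 1 A B C - F.n13 X D 1 0 A B C) + (F.n13 X A 0 1 D B C - F.n13 X A 1 0 D B C)
  + (F.n13 X B 0 1 A D C - F.n13 X B 1 0 A D C) + (F.n13 X C 0 1 A B D - F.n13 X C 1 0 A B D)

/-- Three times the symmetrisation over `ABC` of `ε^{E'C'} ∇_{AE'} h_{BCA'C'}`. -/
def curl22 (h : Fin 2 → Fin 2 → Fin 2 → Fin 2 → R) (A' A B C : Fin 2) : R :=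
  (F.n22 h A 0 B C A' 1 - F.n22 h A 1 B C A' 0) + (F.n22 h B 0 A C A' 1 - F.n22 h B 1 A C A' 0)
  + (F.n22 h C 0 A B A' 1 - F.n22 h C 1 A B A' 0)

/-- The divergence `ε^{EA} ε^{E'A'} ∇_{EE'} h_{ABA'B'}`. -/
def div22 (h : Fin 2 → Fin 2 → Fin 2 → Fin 2 → R) (B B' : Fin 2) : R :=
  F.n22 h 0 0 1 B 1 B' - F.n22 h 0 1 1 B 0 B' - F.n22 h 1 0 0 B 1 B' + F.n22 h 1 1 0 B 0 B'

/-- Three times the symmetrisation of `∇_{AA'} Y_{BC}`. -/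
def symGrad (Y : Fin 2 → Fin 2 → R) (A' A B C : Fin 2) : R :=
  F.n20 Y A A' B C + F.n20 Y B A' A C + F.n20 Y C A' A B

/-- The divergence `ε^{ED} ∇_{EB'} Y_{DB}`. -/
def div20 (Y : Fin 2 → Fin 2 → R) (B B' : Fin 2) : R := F.n20 Y 0 B' 1 B - F.n20 Y 1 B' 0 B

/-- The contraction with ε^{CD} is parallel because `U` is trace-free, so the outer derivative
passes through it. The rules below use the same mechanism, with `traceV` for primed contractions. -/
theorem n22_hertz (X : Fin 2 → Fin 2 → Fin 2 → Fin 2 → R) (E E' A B A' B' : Fin 2) :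
    F.n22 (F.hertz X) E E' A B A' B' =
      F.nn13 X E E' 0 B' A' A B 1 - F.nn13 X E E' 1 B' A' A B 0 + F.nn13 X E E' 0 A' B' A B 1
        - F.nn13 X E E' 1 A' B' A B 0 := by
  simp only [n22, hertz, nn13, Fin.sum_univ_two, map_add, map_sub, F.traceU]
  ring

theorem n20_div13 (X : Fin 2 → Fin 2 → Fin 2 → Fin 2 → R) (E E' B C : Fin 2) :
    F.n20 (F.div13 X) E E' B C =
      F.nn13 X E E' 0 0 1 1 B C - F.nn13 X E E' 0 1 0 1 B C - F.nn13 X E E' 1 0 1 0 B C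
        + F.nn13 X E E' 1 1 0 0 B C := by
  simp only [n20, div13, nn13, Fin.sum_univ_two, map_add, map_sub, F.traceU, F.traceV]
  ring

/-- `∇_{EE'}` of `twist`, in terms of second derivatives. -/
theorem nn13_twist (X : Fin 2 → Fin 2 → Fin 2 → Fin 2 → R) (hX : ∀ D A B C, F.twist X D A B C = 0)
    (E E' D A B C : Fin 2) :
    (F.nn13 X E E' D 0 1 A B C - F.nn13 X E E' D 1 0 A B C)
    + (F.nn13 X E E' A 0 1 D B C - F.nn13 X E E' A 1 0 D B C)
    + (F.nn13 X E E' B 0 1 A D C - F.nn13 X E E' B 1 0 A D C)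
    + (F.nn13 X E E' C 0 1 A B D - F.nn13 X E E' C 1 0 A B D) = 0 := by
  -- The covariant derivative of the vanishing spinor `twist`, written with its four unprimed
  -- connection terms.
  have key : F.D E E' (F.twist X D A B C) + ∑ k, F.U E E' D k * F.twist X k A B C
      + ∑ k, F.U E E' A k * F.twist X D k B C + ∑ k, F.U E E' B k * F.twist X D A k C
      + ∑ k, F.U E E' C k * F.twist X D A B k = 0 := by simp [hX]
  rw [← key]
  simp only [twist, nn13, Fin.sum_univ_two, map_add, map_sub, F.traceV]
  ring

theorem n13_curl22 (h : Fin 2 → Fin 2 → Fin 2 → Fin 2 → R) (E E' A' A B C : Fin 2) :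
    F.n13 (F.curl22 h) E E' A' A B C =
      (F.nn22 h E E' A 0 B C A' 1 - F.nn22 h E E' A 1 B C A' 0)
      + (F.nn22 h E E' B 0 A C A' 1 - F.nn22 h E E' B 1 A C A' 0)
      + (F.nn22 h E E' C 0 A B A' 1 - F.nn22 h E E' C 1 A B A' 0) := by
  simp only [n13, curl22, nn22, Fin.sum_univ_two, map_add, map_sub, F.traceV]
  ring

theorem n11_div22 (h : Fin 2 → Fin 2 → Fin 2 → Fin 2 → R) (E E' B B' : Fin 2) :
    F.n11 (F.div22 h) E E' B B' =
      F.nn22 h E E' 0 0 1 B 1 B' - F.nn22 h E E' 0 1 1 B 0 B' - F.nn22 h E E' 1 0 0 B 1 B'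
        + F.nn22 h E E' 1 1 0 B 0 B' := by
  simp only [n11, div22, nn22, Fin.sum_univ_two, map_add, map_sub, F.traceU, F.traceV]
  ring

theorem n13_symGrad (Y : Fin 2 → Fin 2 → R) (E E' A' A B C : Fin 2) :
    F.n13 (F.symGrad Y) E E' A' A B C =
      F.nn20 Y E E' A A' B C + F.nn20 Y E E' B A' A C + F.nn20 Y E E' C A' A B := by
  simp only [n13, symGrad, nn20, Fin.sum_univ_two, map_add]
  ring

theorem n11_div20 (Y : Fin 2 → Fin 2 → R) (E E' B B' : Fin 2) :
    F.n11 (F.div20 Y) E E' B B' = F.nn20 Y E E' 0 B' 1 B - F.nn20 Y E E' 1 B' 0 B := by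
  simp only [n11, div20, nn20, Fin.sum_univ_two, map_sub, F.traceU]
  ring

end SpinFrame

/-! ### Self-dual Einstein curvature and Hertz potentials. -/

/-- The components of `ε_{AB}` in a normalised spin frame. -/
def ee {R : Type*} [CommRing R] : Fin 2 → Fin 2 → R := ![![0, 1], ![-1, 0]]

/-- The components of the identity. -/
def dd {R : Type*} [CommRing R] : Fin 2 → Fin 2 → R := ![![1, 0], ![0, 1]]

namespace SpinFrame

variable {R : Type*} [CommRing R] [Algebra ℂ R] (F : SpinFrame R)

/-- The curvature of a self-dual Einstein metric: `l = -λ/6`, and `ψ k` is the component of the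
primed Weyl spinor with `k` indices equal to one. -/
structure SelfDualEinstein (l : R) (ψ : ℕ → R) : Prop where
  const : ∀ A A', F.D A A' l = 0
  curvU : ∀ A A' B B' C D,
    F.curvU A A' B B' C D = l * (ee A' B' * (ee A C * dd B D + ee B C * dd A D))
  curvV : ∀ A A' B B' C' D',
    F.curvV A A' B B' C' D' = ee A B * (l * (ee A' C' * dd B' D' + ee B' C' * dd A' D')
      + (ψ (A' + B' + C') * ee 0 D' + ψ (A' + B' + C' + 1) * ee 1 D'))

/-- Symmetry of `X_{A'ABC}` in the unprimed indices. -/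
structure Symm13 (X : Fin 2 → Fin 2 → Fin 2 → Fin 2 → R) : Prop where
  left : ∀ A' A B C, X A' A B C = X A' B A C
  right : ∀ A' A B C, X A' A B C = X A' A C B

/-- Symmetry of `h_{ABA'B'}`. -/
structure Symm22 (h : Fin 2 → Fin 2 → Fin 2 → Fin 2 → R) : Prop where
  left : ∀ A B A' B', h A B A' B' = h B A A' B'
  right : ∀ A B A' B', h A B A' B' = h A B B' A'

variable {F}

theorem Symm13.n13 {X : Fin 2 → Fin 2 → Fin 2 → Fin 2 → R} (hX : Symm13 X) (E E' : Fin 2) :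
    Symm13 (F.n13 X E E') := by
  constructor
  · intro A' A B C
    -- Replacing `X` itself by its transpose reduces the symmetry of the derivative to reordering
    -- the connection terms.
    have e : X = fun A' A B C => X A' B A C := by funext A' A B C; exact hX.left ..
    conv_lhs => rw [e]
    simp only [SpinFrame.n13]; ring
  · intro A' A B C
    have e : X = fun A' A B C => X A' A C B := by funext A' A B C; exact hX.right ..
    conv_lhs => rw [e]
    simp only [SpinFrame.n13]; ring

theorem Symm13.nn13 {X : Fin 2 → Fin 2 → Fin 2 → Fin 2 → R} (hX : Symm13 X) (E E' D D' : Fin 2) :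
    Symm13 (F.nn13 X E E' D D') := by
  constructor
  · intro A' A B C
    have e : F.n13 X = fun D D' A' A B C => F.n13 X D D' A' B A C := by
      funext D D' A' A B C; exact (hX.n13 D D').left ..
    conv_lhs => rw [SpinFrame.nn13, e]
    simp only [SpinFrame.nn13]; ring
  · intro A' A B C
    have e : F.n13 X = fun D D' A' A B C => F.n13 X D D' A' A C B := by
      funext D D' A' A B C; exact (hX.n13 D D').right ..
    conv_lhs => rw [SpinFrame.nn13, e]
    simp only [SpinFrame.nn13]; ring

theorem Symm22.n22 {h : Fin 2 → Fin 2 → Fin 2 → Fin 2 → R} (hh : Symm22 h) (E E' : Fin 2) :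
    Symm22 (F.n22 h E E') := by
  constructor
  · intro A B A' B'
    have e : h = fun A B A' B' => h B A A' B' := by funext A B A' B'; exact hh.left ..
    conv_lhs => rw [e]
    simp only [SpinFrame.n22]; ring
  · intro A B A' B'
    have e : h = fun A B A' B' => h A B B' A' := by funext A B A' B'; exact hh.right ..
    conv_lhs => rw [e]
    simp only [SpinFrame.n22]; ring

theorem Symm22.nn22 {h : Fin 2 → Fin 2 → Fin 2 → Fin 2 → R} (hh : Symm22 h) (E E' D D' : Fin 2) :
    Symm22 (F.nn22 h E E' D D') := by
  constructor
  · intro A B A' B'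
    have e : F.n22 h = fun D D' A B A' B' => F.n22 h D D' B A A' B' := by
      funext D D' A B A' B'; exact (hh.n22 D D').left ..
    conv_lhs => rw [SpinFrame.nn22, e]
    simp only [SpinFrame.nn22]; ring
  · intro A B A' B'
    have e : F.n22 h = fun D D' A B A' B' => F.n22 h D D' A B B' A' := by
      funext D D' A B A' B'; exact (hh.n22 D D').right ..
    conv_lhs => rw [SpinFrame.nn22, e]
    simp only [SpinFrame.nn22]; ring

/-- A symmetric array is determined by its components with ordered indices. -/
theorem Symm13.sorted {X : Fin 2 → Fin 2 → Fin 2 → Fin 2 → R} (hX : Symm13 X) (A' : Fin 2) :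
    X A' 0 1 0 = X A' 0 0 1 ∧ X A' 1 0 0 = X A' 0 0 1 ∧ X A' 1 0 1 = X A' 0 1 1
      ∧ X A' 1 1 0 = X A' 0 1 1 :=
  ⟨hX.right .., by rw [hX.left, hX.right], hX.left .., by rw [hX.right, hX.left]⟩

theorem Symm22.sorted {h : Fin 2 → Fin 2 → Fin 2 → Fin 2 → R} (hh : Symm22 h) :
    (∀ A' B', h 1 0 A' B' = h 0 1 A' B') ∧ ∀ A B, h A B 1 0 = h A B 0 1 :=
  ⟨fun _ _ => hh.left .., fun _ _ => hh.right ..⟩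

theorem Symm13.hertz {X : Fin 2 → Fin 2 → Fin 2 → Fin 2 → R} (hX : Symm13 X) :
    Symm22 (F.hertz X) := by
  constructor
  · intro A B A' B'
    simp only [SpinFrame.hertz]
    rw [(hX.n13 0 B').left, (hX.n13 1 B').left, (hX.n13 0 A').left, (hX.n13 1 A').left]
  · intro A B A' B'
    simp only [SpinFrame.hertz]; ring

theorem Symm13.div13 {X : Fin 2 → Fin 2 → Fin 2 → Fin 2 → R} (hX : Symm13 X) (B C : Fin 2) :
    F.div13 X B C = F.div13 X C B := by
  simp only [SpinFrame.div13]
  rw [(hX.n13 0 0).right, (hX.n13 0 1).right, (hX.n13 1 0).right, (hX.n13 1 1).right]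

/-- Evaluation of curvature terms on explicit components. -/
theorem SelfDualEinstein.ricci13 {l : R} {ψ : ℕ → R} (hF : F.SelfDualEinstein l ψ)
    (X : Fin 2 → Fin 2 → Fin 2 → Fin 2 → R) (E E' D D' A' A B C : Fin 2) :
    F.nn13 X E E' D D' A' A B C - F.nn13 X D D' E E' A' A B C =
      ee E D * (l * (ee E' A' * X D' A B C + ee D' A' * X E' A B C)
        + ψ (E' + D' + A') * X 1 A B C - ψ (E' + D' + A' + 1) * X 0 A B C)
      + ee E' D' * l * (ee E A * X A' D B C + ee D A * X A' E B C + ee E B * X A' A D C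
        + ee D B * X A' A E C + ee E C * X A' A B D + ee D C * X A' A B E) := by
  rw [F.ricci13]
  simp only [hF.curvU, hF.curvV, Fin.sum_univ_two]
  fin_cases E <;> fin_cases D <;> fin_cases E' <;> fin_cases D' <;>
    simp [ee, dd] <;> ring

theorem SelfDualEinstein.ricci22 {l : R} {ψ : ℕ → R} (hF : F.SelfDualEinstein l ψ)
    (h : Fin 2 → Fin 2 → Fin 2 → Fin 2 → R) (E E' D D' A B A' B' : Fin 2) :
    F.nn22 h E E' D D' A B A' B' - F.nn22 h D D' E E' A B A' B' =
      ee E' D' * l * (ee E A * h D B A' B' + ee D A * h E B A' B' + ee E B * h A D A' B'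
        + ee D B * h A E A' B')
      + ee E D * (l * (ee E' A' * h A B D' B' + ee D' A' * h A B E' B' + ee E' B' * h A B A' D'
          + ee D' B' * h A B A' E')
        + ψ (E' + D' + A') * h A B 1 B' - ψ (E' + D' + A' + 1) * h A B 0 B'
        + ψ (E' + D' + B') * h A B A' 1 - ψ (E' + D' + B' + 1) * h A B A' 0) := by
  rw [F.ricci22]
  simp only [hF.curvU, hF.curvV, Fin.sum_univ_two]
  fin_cases E <;> fin_cases D <;> fin_cases E' <;> fin_cases D' <;>
    simp [ee, dd] <;> ring

theorem SelfDualEinstein.ricci20 {l : R} {ψ : ℕ → R} (hF : F.SelfDualEinstein l ψ)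
    (Y : Fin 2 → Fin 2 → R) (E E' D D' A B : Fin 2) :
    F.nn20 Y E E' D D' A B - F.nn20 Y D D' E E' A B =
      ee E' D' * l * (ee E A * Y D B + ee D A * Y E B + ee E B * Y A D + ee D B * Y A E) := by
  rw [F.ricci20]
  simp only [hF.curvU, Fin.sum_univ_two]
  fin_cases E <;> fin_cases D <;> simp [ee, dd] <;> ring

/-- The anti-self-dual curl of a Hertz potential. -/
theorem SelfDualEinstein.curl22_hertz {l : R} {ψ : ℕ → R} (hF : F.SelfDualEinstein l ψ)
    {X : Fin 2 → Fin 2 → Fin 2 → Fin 2 → R} (hX : Symm13 X)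
    (hθ : ∀ D A B C, F.twist X D A B C = 0) (A' A B C : Fin 2) :
    2 * F.curl22 (F.hertz X) A' A B C + F.symGrad (F.div13 X) A' A B C = 24 * l * X A' A B C := by
  have r := hF.ricci13 X
  have t := F.nn13_twist X hθ
  have s := fun E E' D D' A' => (hX.nn13 (F := F) E E' D D').sorted A'
  obtain ⟨s1, s2, s3, s4⟩ : (∀ E E' D D' A', _) ∧ (∀ E E' D D' A', _) ∧ (∀ E E' D D' A', _) ∧
      (∀ E E' D D' A', _) := ⟨fun E E' D D' A' => (s E E' D D' A').1,
    fun E E' D D' A' => (s E E' D D' A').2.1, fun E E' D D' A' => (s E E' D D' A').2.2.1,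
    fun E E' D D' A' => (s E E' D D' A').2.2.2⟩
  have x := hX.sorted
  obtain ⟨x1, x2, x3, x4⟩ : (∀ A', _) ∧ (∀ A', _) ∧ (∀ A', _) ∧ (∀ A', _) :=
    ⟨fun A' => (x A').1, fun A' => (x A').2.1, fun A' => (x A').2.2.1, fun A' => (x A').2.2.2⟩
  simp only [curl22, symGrad, n22_hertz, n20_div13]
  -- In each component, three times the divergence ε^{ED} ∇_{EA'} of the twistor-type equation
  -- supplies the `t` terms, and the commutators `r` bring second derivatives to a common order. The
  -- terms in ψ cancel because ψ depends only on the sum of its indices.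
  fin_cases A' <;> fin_cases A <;> fin_cases B <;> fin_cases C <;>
    simp only [Fin.zero_eta, Fin.mk_one, s1, s2, s3, s4, x1, x2, x3, x4]
  · linear_combination (norm := skip) 12 * r 0 0 0 1 0 0 0 1 + 3 * t 0 0 0 0 0 1 - 12 * r 0 0 1 0 1 0 0 0 - 3 * t 1 0 0 0 0 0 +
      12 * r 0 1 1 0 0 0 0 0
    simp [ee, s1, s2, s3, s4, x1, x2, x3, x4]; ring
  · linear_combination (norm := skip) 8 * r 0 0 0 1 0 0 1 1 + 3 * t 0 0 0 0 1 1 - 12 * r 0 0 1 0 1 0 0 1 + 4 * r 0 0 1 1 0 0 0 1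
      - 3 * t 1 0 0 0 0 1 - 4 * r 1 0 1 1 0 0 0 0 + 8 * r 0 1 1 0 0 0 0 1
    simp [ee, s1, s2, s3, s4, x1, x2, x3, x4]; ring
  · linear_combination (norm := skip) 8 * r 0 0 0 1 0 0 1 1 + 3 * t 0 0 0 0 1 1 - 12 * r 0 0 1 0 1 0 0 1 + 4 * r 0 0 1 1 0 0 0 1
      - 3 * t 1 0 0 0 0 1 - 4 * r 1 0 1 1 0 0 0 0 + 8 * r 0 1 1 0 0 0 0 1
    simp [ee, s1, s2, s3, s4, x1, x2, x3, x4]; ring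
  · linear_combination (norm := skip) 4 * r 0 0 0 1 0 1 1 1 + 3 * t 0 0 0 1 1 1 - 12 * r 0 0 1 0 1 0 1 1 + 8 * r 0 0 1 1 0 0 1 1
      - 3 * t 1 0 0 0 1 1 - 8 * r 1 0 1 1 0 0 0 1 + 4 * r 0 1 1 0 0 0 1 1
    simp [ee, s1, s2, s3, s4, x1, x2, x3, x4]; ring
  · linear_combination (norm := skip) 8 * r 0 0 0 1 0 0 1 1 + 3 * t 0 0 0 0 1 1 - 12 * r 0 0 1 0 1 0 0 1 + 4 * r 0 0 1 1 0 0 0 1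
      - 3 * t 1 0 0 0 0 1 - 4 * r 1 0 1 1 0 0 0 0 + 8 * r 0 1 1 0 0 0 0 1
    simp [ee, s1, s2, s3, s4, x1, x2, x3, x4]; ring
  · linear_combination (norm := skip) 4 * r 0 0 0 1 0 1 1 1 + 3 * t 0 0 0 1 1 1 - 12 * r 0 0 1 0 1 0 1 1 + 8 * r 0 0 1 1 0 0 1 1
      - 3 * t 1 0 0 0 1 1 - 8 * r 1 0 1 1 0 0 0 1 + 4 * r 0 1 1 0 0 0 1 1
    simp [ee, s1, s2, s3, s4, x1, x2, x3, x4]; ring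
  · linear_combination (norm := skip) 4 * r 0 0 0 1 0 1 1 1 + 3 * t 0 0 0 1 1 1 - 12 * r 0 0 1 0 1 0 1 1 + 8 * r 0 0 1 1 0 0 1 1
      - 3 * t 1 0 0 0 1 1 - 8 * r 1 0 1 1 0 0 0 1 + 4 * r 0 1 1 0 0 0 1 1
    simp [ee, s1, s2, s3, s4, x1, x2, x3, x4]; ring
  · linear_combination (norm := skip) 3 * t 0 0 1 1 1 1 - 12 * r 0 0 1 0 1 1 1 1 + 12 * r 0 0 1 1 0 1 1 1 - 12 * r 1 0 1 1 0 0 1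
      1 - 3 * t 1 0 0 1 1 1
    simp [ee, s1, s2, s3, s4, x1, x2, x3, x4]; ring
  · linear_combination (norm := skip) 12 * r 0 0 0 1 1 0 0 1 + 3 * t 0 1 0 0 0 1 + 12 * r 0 1 1 1 0 0 0 0 - 12 * r 0 0 1 1 1 0 0
      0 - 3 * t 1 1 0 0 0 0
    simp [ee, s1, s2, s3, s4, x1, x2, x3, x4]; ring
  · linear_combination (norm := skip) 8 * r 0 0 0 1 1 0 1 1 + 3 * t 0 1 0 0 1 1 - 4 * r 0 1 1 0 1 0 0 1 + 12 * r 0 1 1 1 0 0 0 1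
      - 8 * r 0 0 1 1 1 0 0 1 - 3 * t 1 1 0 0 0 1 - 4 * r 1 0 1 1 1 0 0 0
    simp [ee, s1, s2, s3, s4, x1, x2, x3, x4]; ring
  · linear_combination (norm := skip) 8 * r 0 0 0 1 1 0 1 1 + 3 * t 0 1 0 0 1 1 - 4 * r 0 1 1 0 1 0 0 1 + 12 * r 0 1 1 1 0 0 0 1
      - 8 * r 0 0 1 1 1 0 0 1 - 3 * t 1 1 0 0 0 1 - 4 * r 1 0 1 1 1 0 0 0
    simp [ee, s1, s2, s3, s4, x1, x2, x3, x4]; ring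
  · linear_combination (norm := skip) 4 * r 0 0 0 1 1 1 1 1 + 3 * t 0 1 0 1 1 1 - 8 * r 0 1 1 0 1 0 1 1 + 12 * r 0 1 1 1 0 0 1 1
      - 4 * r 0 0 1 1 1 0 1 1 - 3 * t 1 1 0 0 1 1 - 8 * r 1 0 1 1 1 0 0 1
    simp [ee, s1, s2, s3, s4, x1, x2, x3, x4]; ring
  · linear_combination (norm := skip) 8 * r 0 0 0 1 1 0 1 1 + 3 * t 0 1 0 0 1 1 - 4 * r 0 1 1 0 1 0 0 1 + 12 * r 0 1 1 1 0 0 0 1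
      - 8 * r 0 0 1 1 1 0 0 1 - 3 * t 1 1 0 0 0 1 - 4 * r 1 0 1 1 1 0 0 0
    simp [ee, s1, s2, s3, s4, x1, x2, x3, x4]; ring
  · linear_combination (norm := skip) 4 * r 0 0 0 1 1 1 1 1 + 3 * t 0 1 0 1 1 1 - 8 * r 0 1 1 0 1 0 1 1 + 12 * r 0 1 1 1 0 0 1 1
      - 4 * r 0 0 1 1 1 0 1 1 - 3 * t 1 1 0 0 1 1 - 8 * r 1 0 1 1 1 0 0 1
    simp [ee, s1, s2, s3, s4, x1, x2, x3, x4]; ring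
  · linear_combination (norm := skip) 4 * r 0 0 0 1 1 1 1 1 + 3 * t 0 1 0 1 1 1 - 8 * r 0 1 1 0 1 0 1 1 + 12 * r 0 1 1 1 0 0 1 1
      - 4 * r 0 0 1 1 1 0 1 1 - 3 * t 1 1 0 0 1 1 - 8 * r 1 0 1 1 1 0 0 1
    simp [ee, s1, s2, s3, s4, x1, x2, x3, x4]; ring
  · linear_combination (norm := skip) 3 * t 0 1 1 1 1 1 - 12 * r 0 1 1 0 1 1 1 1 + 12 * r 0 1 1 1 0 1 1 1 - 12 * r 1 0 1 1 1 0 1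
      1 - 3 * t 1 1 0 1 1 1
    simp [ee, s1, s2, s3, s4, x1, x2, x3, x4]; ring

end SpinFrame

/-! ### The linearised Einstein operator in spinor form. -/

/-- The trace `ε^{CD} ε^{C'D'} G_{CC'DD'}`. -/
def etaTr {R : Type*} [CommRing R] (G : Fin 2 → Fin 2 → Fin 2 → Fin 2 → R) : R :=
  G 0 0 1 1 - G 0 1 1 0 - G 1 0 0 1 + G 1 1 0 0

namespace SpinFrame

variable {R : Type*} [CommRing R] [Algebra ℂ R] (F : SpinFrame R)

/-- Twice the linearised Einstein operator on trace-free tensors, with `λ = -6 l`. -/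
def ein (l : R) (h : Fin 2 → Fin 2 → Fin 2 → Fin 2 → R) (A A' B B' : Fin 2) : R :=
  - etaTr (fun C C' D D' => F.nn22 h C C' D D' A B A' B')
  + etaTr (fun C C' D D' => F.nn22 h D D' A A' B C B' C')
  + etaTr (fun C C' D D' => F.nn22 h D D' B B' A C A' C')
  - ee A B * ee A' B' * etaTr (fun C C' E E' => etaTr (fun D D' G G' =>
      F.nn22 h E E' G G' C D C' D'))
  - 12 * l * h A B A' B'

variable {F}

/-- A Weitzenböck formula: up to commutators, the Laplacian of h is the Hertz operator applied to
the unprimed curl of h, corrected by derivatives of the divergence of h. The commutators leave only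
a multiple of l h; the primed Weyl spinor cancels. -/
theorem SelfDualEinstein.ein_eq {l : R} {ψ : ℕ → R} (hF : F.SelfDualEinstein l ψ)
    {h : Fin 2 → Fin 2 → Fin 2 → Fin 2 → R} (hh : Symm22 h) (A A' B B' : Fin 2) :
    6 * F.ein l h A A' B B' =
      2 * (F.n13 (F.curl22 h) 0 B' A' A B 1 - F.n13 (F.curl22 h) 1 B' A' A B 0
        + F.n13 (F.curl22 h) 0 A' B' A B 1 - F.n13 (F.curl22 h) 1 A' B' A B 0)
      + (F.n11 (F.div22 h) A A' B B' + F.n11 (F.div22 h) A B' B A'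
        + F.n11 (F.div22 h) B A' A B' + F.n11 (F.div22 h) B B' A A')
      - 3 * (ee A B * ee A' B' * etaTr (F.n11 (F.div22 h)))
      - 24 * l * h A B A' B' := by
  have r := hF.ricci22 h
  have s := fun E E' D D' => (hh.nn22 (F := F) E E' D D').sorted
  obtain ⟨s1, s2⟩ : (∀ E E' D D', _) ∧ (∀ E E' D D', _) :=
    ⟨fun E E' D D' => (s E E' D D').1, fun E E' D D' => (s E E' D D').2⟩
  obtain ⟨x1, x2⟩ := hh.sorted
  simp only [ein, etaTr, n13_curl22, n11_div22]
  fin_cases A <;> fin_cases B <;> fin_cases A' <;> fin_cases B' <;>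
    simp only [Fin.zero_eta, Fin.mk_one, s1, s2, x1, x2]
  · linear_combination (norm := skip) -6 * r 0 0 1 1 0 0 0 0 + 6 * r 0 1 1 0 0 0 0 0 + 12 * r 0 0 0 1 0 1 0 0
    simp [ee, s1, s2, x1, x2]; ring
  · linear_combination (norm := skip) -6 * r 0 0 1 1 0 0 0 1 + 6 * r 0 1 1 0 0 0 0 1 + 12 * r 0 0 0 1 0 1 0 1
    simp [ee, s1, s2, x1, x2]; ring
  · linear_combination (norm := skip) -6 * r 0 0 1 1 0 0 0 1 + 6 * r 0 1 1 0 0 0 0 1 + 12 * r 0 0 0 1 0 1 0 1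
    simp [ee, s1, s2, x1, x2]; ring
  · linear_combination (norm := skip) -6 * r 0 0 1 1 0 0 1 1 + 6 * r 0 1 1 0 0 0 1 1 + 12 * r 0 0 0 1 0 1 1 1
    simp [ee, s1, s2, x1, x2]; ring
  · linear_combination (norm := skip) 6 * r 0 0 0 1 1 1 0 0 - 6 * r 1 0 1 1 0 0 0 0
    simp [ee, s1, s2, x1, x2]; ring
  · linear_combination (norm := skip) -6 * r 1 0 1 1 0 0 0 1 + 6 * r 0 0 0 1 1 1 0 1
    simp [ee, s1, s2, x1, x2]; ring
  · linear_combination (norm := skip) -6 * r 1 0 1 1 0 0 0 1 + 6 * r 0 0 0 1 1 1 0 1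
    simp [ee, s1, s2, x1, x2]; ring
  · linear_combination (norm := skip) -6 * r 1 0 1 1 0 0 1 1 + 6 * r 0 0 0 1 1 1 1 1
    simp [ee, s1, s2, x1, x2]; ring
  · linear_combination (norm := skip) 6 * r 0 0 0 1 1 1 0 0 - 6 * r 1 0 1 1 0 0 0 0
    simp [ee, s1, s2, x1, x2]; ring
  · linear_combination (norm := skip) -6 * r 1 0 1 1 0 0 0 1 + 6 * r 0 0 0 1 1 1 0 1
    simp [ee, s1, s2, x1, x2]; ring
  · linear_combination (norm := skip) -6 * r 1 0 1 1 0 0 0 1 + 6 * r 0 0 0 1 1 1 0 1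
    simp [ee, s1, s2, x1, x2]; ring
  · linear_combination (norm := skip) -6 * r 1 0 1 1 0 0 1 1 + 6 * r 0 0 0 1 1 1 1 1
    simp [ee, s1, s2, x1, x2]; ring
  · linear_combination (norm := skip) 6 * r 0 0 1 1 1 1 0 0 - 6 * r 0 1 1 0 1 1 0 0 - 12 * r 1 0 1 1 0 1 0 0
    simp [ee, s1, s2, x1, x2]; ring
  · linear_combination (norm := skip) 6 * r 0 0 1 1 1 1 0 1 - 6 * r 0 1 1 0 1 1 0 1 - 12 * r 1 0 1 1 0 1 0 1
    simp [ee, s1, s2, x1, x2]; ring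
  · linear_combination (norm := skip) 6 * r 0 0 1 1 1 1 0 1 - 6 * r 0 1 1 0 1 1 0 1 - 12 * r 1 0 1 1 0 1 0 1
    simp [ee, s1, s2, x1, x2]; ring
  · linear_combination (norm := skip) 6 * r 0 0 1 1 1 1 1 1 - 6 * r 0 1 1 0 1 1 1 1 - 12 * r 1 0 1 1 0 1 1 1
    simp [ee, s1, s2, x1, x2]; ring

/-- The commutators enter symmetrised over A'B', whereas the curvature acting on Y is proportional
to ε_{E'D'}. So no curvature term survives. -/
theorem SelfDualEinstein.symGrad_eq_div {l : R} {ψ : ℕ → R} (hF : F.SelfDualEinstein l ψ)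
    {Y : Fin 2 → Fin 2 → R} (hY : ∀ A B, Y A B = Y B A) (A A' B B' : Fin 2) :
    F.n13 (F.symGrad Y) 0 B' A' A B 1 - F.n13 (F.symGrad Y) 1 B' A' A B 0
        + F.n13 (F.symGrad Y) 0 A' B' A B 1 - F.n13 (F.symGrad Y) 1 A' B' A B 0 =
      F.n11 (F.div20 Y) A A' B B' + F.n11 (F.div20 Y) A B' B A'
        + F.n11 (F.div20 Y) B A' A B' + F.n11 (F.div20 Y) B B' A A' := by
  have r := hF.ricci20 Y
  have s0 : ∀ D D' A B, F.n20 Y D D' A B = F.n20 Y D D' B A := by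
    intro D D' A B
    have e : Y = fun A B => Y B A := by funext A B; exact hY ..
    conv_lhs => rw [e]
    simp only [n20]; ring
  have s : ∀ E E' D D', F.nn20 Y E E' D D' 1 0 = F.nn20 Y E E' D D' 0 1 := by
    intro E E' D D'
    simp only [nn20, s0 _ _ 1 0, Fin.sum_univ_two, s0 _ _ 1 0]; ring
  have x := hY 1 0
  simp only [n13_symGrad, n11_div20]
  fin_cases A <;> fin_cases B <;> fin_cases A' <;> fin_cases B' <;>
    simp only [Fin.zero_eta, Fin.mk_one, s, x]
  · linear_combination (norm := skip) 6 * r 0 0 1 0 0 0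
    simp [ee, s, x]; ring
  · linear_combination (norm := skip) 3 * r 0 1 1 0 0 0 + 3 * r 0 0 1 1 0 0
    simp [ee, s, x]; ring
  · linear_combination (norm := skip) 3 * r 0 1 1 0 0 0 + 3 * r 0 0 1 1 0 0
    simp [ee, s, x]; ring
  · linear_combination (norm := skip) 6 * r 0 1 1 1 0 0
    simp [ee, s, x]; ring
  · linear_combination (norm := skip) 6 * r 0 0 1 0 0 1
    simp [ee, s, x]; ring
  · linear_combination (norm := skip) 3 * r 0 1 1 0 0 1 + 3 * r 0 0 1 1 0 1
    simp [ee, s, x]; ring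
  · linear_combination (norm := skip) 3 * r 0 1 1 0 0 1 + 3 * r 0 0 1 1 0 1
    simp [ee, s, x]; ring
  · linear_combination (norm := skip) 6 * r 0 1 1 1 0 1
    simp [ee, s, x]; ring
  · linear_combination (norm := skip) 6 * r 0 0 1 0 0 1
    simp [ee, s, x]; ring
  · linear_combination (norm := skip) 3 * r 0 1 1 0 0 1 + 3 * r 0 0 1 1 0 1
    simp [ee, s, x]; ring
  · linear_combination (norm := skip) 3 * r 0 1 1 0 0 1 + 3 * r 0 0 1 1 0 1
    simp [ee, s, x]; ring
  · linear_combination (norm := skip) 6 * r 0 1 1 1 0 1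
    simp [ee, s, x]; ring
  · linear_combination (norm := skip) 6 * r 0 0 1 0 1 1
    simp [ee, s, x]; ring
  · linear_combination (norm := skip) 3 * r 0 1 1 0 1 1 + 3 * r 0 0 1 1 1 1
    simp [ee, s, x]; ring
  · linear_combination (norm := skip) 3 * r 0 1 1 0 1 1 + 3 * r 0 0 1 1 1 1
    simp [ee, s, x]; ring
  · linear_combination (norm := skip) 6 * r 0 1 1 1 1 1
    simp [ee, s, x]; ring

/-- The double divergence of the two-form Y_{AB} ε_{A'B'} vanishes, as for any two-form. -/
theorem SelfDualEinstein.div_div20 {l : R} {ψ : ℕ → R} (hF : F.SelfDualEinstein l ψ)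
    {Y : Fin 2 → Fin 2 → R} (hY : ∀ A B, Y A B = Y B A) : etaTr (F.n11 (F.div20 Y)) = 0 := by
  have r := hF.ricci20 Y
  have s0 : ∀ D D' A B, F.n20 Y D D' A B = F.n20 Y D D' B A := by
    intro D D' A B
    have e : Y = fun A B => Y B A := by funext A B; exact hY ..
    conv_lhs => rw [e]
    simp only [n20]; ring
  have s : ∀ E E' D D', F.nn20 Y E E' D D' 1 0 = F.nn20 Y E E' D D' 0 1 := by
    intro E E' D D'
    simp only [nn20, s0 _ _ 1 0, Fin.sum_univ_two, s0 _ _ 1 0]; ring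
  have x := hY 1 0
  simp only [etaTr, n11_div20]
  linear_combination (norm := skip) r 0 1 1 0 0 1 + r 0 0 0 1 1 1 + r 1 0 1 1 0 0 - r 0 0 1 1 0 1
  simp [ee, s, x]; ring

/-- Both sides contain the same second derivatives in different orders, and the curvature terms of
the commutators cancel among themselves. -/
theorem SelfDualEinstein.div22_hertz {l : R} {ψ : ℕ → R} (hF : F.SelfDualEinstein l ψ)
    {X : Fin 2 → Fin 2 → Fin 2 → Fin 2 → R} (hX : Symm13 X) :
    F.div22 (F.hertz X) = F.div20 (F.div13 X) := by
  funext B B'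
  have r := hF.ricci13 X
  have s := fun E E' D D' A' => (hX.nn13 (F := F) E E' D D').sorted A'
  obtain ⟨s1, s2, s3, s4⟩ : (∀ E E' D D' A', _) ∧ (∀ E E' D D' A', _) ∧ (∀ E E' D D' A', _) ∧
      (∀ E E' D D' A', _) := ⟨fun E E' D D' A' => (s E E' D D' A').1,
    fun E E' D D' A' => (s E E' D D' A').2.1, fun E E' D D' A' => (s E E' D D' A').2.2.1,
    fun E E' D D' A' => (s E E' D D' A').2.2.2⟩
  have x := hX.sorted
  obtain ⟨x1, x2, x3, x4⟩ : (∀ A', _) ∧ (∀ A', _) ∧ (∀ A', _) ∧ (∀ A', _) :=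
    ⟨fun A' => (x A').1, fun A' => (x A').2.1, fun A' => (x A').2.2.1, fun A' => (x A').2.2.2⟩
  simp only [div22, div20, n22_hertz, n20_div13]
  linear_combination (norm := skip) 2 * r 1 0 1 1 B' 0 0 B + 2 * r 0 1 1 0 B' 0 B 1
    + 2 * r 0 0 0 1 B' B 1 1 - 2 * r 0 0 1 1 B' 0 B 1
  fin_cases B <;> fin_cases B' <;> simp [ee, s1, s2, s3, s4, x1, x2, x3, x4] <;> ring

theorem const_mul_n13 {c : R} (hc : ∀ A A', F.D A A' c = 0)
    (X : Fin 2 → Fin 2 → Fin 2 → Fin 2 → R) (E E' A' A B C : Fin 2) :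
    F.n13 (fun A' A B C => c * X A' A B C) E E' A' A B C = c * F.n13 X E E' A' A B C := by
  simp only [n13, Derivation.leibniz, hc, smul_eq_mul, Fin.sum_univ_two]; ring

theorem n13_add (X X' : Fin 2 → Fin 2 → Fin 2 → Fin 2 → R) (E E' A' A B C : Fin 2) :
    F.n13 (fun A' A B C => X A' A B C + X' A' A B C) E E' A' A B C =
      F.n13 X E E' A' A B C + F.n13 X' E E' A' A B C := by
  simp only [n13, map_add, Fin.sum_univ_two]; ring

/-- On a self-dual Einstein background, `∇_{(B'}{}^D X_{A')ABD}` solves the linearised Einstein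
equations if `∇_{A'(D} X^{A'}{}_{ABC)} = 0`. -/
theorem SelfDualEinstein.ein_hertz {l : R} {ψ : ℕ → R} (hF : F.SelfDualEinstein l ψ)
    {X : Fin 2 → Fin 2 → Fin 2 → Fin 2 → R} (hX : Symm13 X)
    (hθ : ∀ D A B C, F.twist X D A B C = 0) (A A' B B' : Fin 2) :
    6 * F.ein l (F.hertz X) A A' B B' = 0 := by
  rw [hF.ein_eq hX.hertz, hF.div22_hertz hX, hF.div_div20 hX.div13]
  -- One more derivative of `curl22_hertz`; the coefficient 24 l is constant.
  have key : ∀ E E' A' A B C, 2 * F.n13 (F.curl22 (F.hertz X)) E E' A' A B C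
      + F.n13 (F.symGrad (F.div13 X)) E E' A' A B C = 24 * l * F.n13 X E E' A' A B C := by
    intro E E' A' A B C
    have hc : ∀ A A', F.D A A' (24 * l) = 0 := by
      intro A A'
      have : (24 : R) = algebraMap ℂ R 24 := (map_ofNat (algebraMap ℂ R) 24).symm
      rw [Derivation.leibniz, hF.const, this, Derivation.map_algebraMap]; simp
    have h2 : ∀ A A', F.D A A' (2 : R) = 0 := by
      intro A A'
      have : (2 : R) = algebraMap ℂ R 2 := (map_ofNat (algebraMap ℂ R) 2).symm
      rw [this, Derivation.map_algebraMap]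
    rw [← const_mul_n13 hc, ← const_mul_n13 h2, ← n13_add]
    congr 1
    funext A' A B C
    exact hF.curl22_hertz hX hθ A' A B C
  have e := hF.symGrad_eq_div (Y := F.div13 X) hX.div13 A A' B B'
  have k1 := key 0 B' A' A B 1
  have k2 := key 1 B' A' A B 0
  have k3 := key 0 A' B' A B 1
  have k4 := key 1 A' B' A B 0
  have u : F.hertz X A B A' B' = F.n13 X 0 B' A' A B 1 - F.n13 X 1 B' A' A B 0
      + F.n13 X 0 A' B' A B 1 - F.n13 X 1 A' B' A B 0 := rfl
  rw [u]
  linear_combination k1 - k2 + k3 - k4 - e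

end SpinFrame

/-! ### Shear-free frames, weighted derivatives and the Teukolsky operator. -/

namespace SpinFrame

variable {R : Type*} [CommRing R] [Algebra ℂ R] (F : SpinFrame R)

/-- Integrability of the complex structure whose principal spinors make up the unprimed frame, with
Lee form `f` and GHP form `w`. -/
structure Hermitian (w f : Fin 2 → Fin 2 → R) : Prop where
  diag : ∀ A A', F.U A A' 0 0 = w A A'
  zero_one : ∀ A A', F.U A A' 0 1 = ee 0 A * f 0 A'
  one_zero : ∀ A A', F.U A A' 1 0 = - ee 1 A * f 1 A'

/-- The form `2 P_a`. -/
def twoP (w f : Fin 2 → Fin 2 → R) (A A' : Fin 2) : R := 2 * w A A' + ![-1, 1] A * f A A'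

variable {F}

/-- For shear-free principal spinors the off-diagonal connection coefficients are the Lee form, so
off-diagonal curvature components compute the unprimed part of df. In the third equation the two
components contribute 2l and -2l. -/
theorem Hermitian.asd_lee {w f : Fin 2 → Fin 2 → R} (hf : F.Hermitian w f) {l : R} {ψ : ℕ → R}
    (hF : F.SelfDualEinstein l ψ) :
    F.n11 f 0 0 0 1 - F.n11 f 0 1 0 0 = 0 ∧ F.n11 f 1 0 1 1 - F.n11 f 1 1 1 0 = 0 ∧
    F.n11 f 0 0 1 1 - F.n11 f 0 1 1 0 + (F.n11 f 1 0 0 1 - F.n11 f 1 1 0 0) = 0 := by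
  have h := hF.curvU
  have t := F.traceU
  obtain ⟨h0, h1, h2⟩ := hf
  refine ⟨?_, ?_, ?_⟩
  · linear_combination (norm := skip) h 0 0 1 1 0 1 - h 0 1 1 0 0 1
    simp [curvU, n11, Fin.sum_univ_two, ee, dd, h0, h1, h2, t, F.traceV]
    ring
  · linear_combination (norm := skip) h 0 0 1 1 1 0 - h 0 1 1 0 1 0
    simp [curvU, n11, Fin.sum_univ_two, ee, dd, h0, h1, h2, t, F.traceV]
    ring
  · linear_combination (norm := skip) h 0 0 0 1 1 0 + h 1 0 1 1 0 1
    simp [curvU, n11, Fin.sum_univ_two, ee, dd, h0, h1, h2, t, F.traceV]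
    ring

/-- The diagonal curvature contains dω, with scalar part -4l in the third equation; the derivatives
of the rotated Lee form supply the compensating 4l. It is P, not ω, whose unprimed curvature
vanishes. -/
theorem Hermitian.asd_twoP {w f : Fin 2 → Fin 2 → R} (hf : F.Hermitian w f) {l : R} {ψ : ℕ → R}
    (hF : F.SelfDualEinstein l ψ) :
    F.n11 (twoP w f) 0 0 0 1 - F.n11 (twoP w f) 0 1 0 0 = 0 ∧
    F.n11 (twoP w f) 1 0 1 1 - F.n11 (twoP w f) 1 1 1 0 = 0 ∧
    F.n11 (twoP w f) 0 0 1 1 - F.n11 (twoP w f) 0 1 1 0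
      + (F.n11 (twoP w f) 1 0 0 1 - F.n11 (twoP w f) 1 1 0 0) = 0 := by
  have h := hF.curvU
  have t := F.traceU
  have d2 : ∀ A A', F.D A A' (2 : R) = 0 := by
    intro A A'
    rw [← map_ofNat (algebraMap ℂ R) 2, Derivation.map_algebraMap]
  obtain ⟨a0, a1, -⟩ := hf.asd_lee hF
  obtain ⟨h0, h1, h2⟩ := hf
  refine ⟨?_, ?_, ?_⟩
  -- The sign of the `asd_lee` term is the eigenvalue sign in `twoP`: minus for A = 0, plus for A =
  -- 1.
  · linear_combination (norm := skip) 2 * h 0 0 0 1 0 0 - a0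
    simp [curvU, n11, twoP, Fin.sum_univ_two, ee, dd, h0, h1, h2, t, F.traceV, d2]
    ring
  · linear_combination (norm := skip) 2 * h 1 0 1 1 0 0 + a1
    simp [curvU, n11, twoP, Fin.sum_univ_two, ee, dd, h0, h1, h2, t, F.traceV, d2]
    ring
  · linear_combination (norm := skip) 2 * (h 0 0 1 1 0 0 - h 0 1 1 0 0 0)
      + h 0 0 0 1 1 0 - h 1 0 1 1 0 1
    simp [curvU, n11, twoP, Fin.sum_univ_two, ee, dd, h0, h1, h2, t, F.traceV, d2]
    ring

/-- The form `w f_a + p P_a` for conformal weight `w = 1` and GHP weight `p = 2 n`. -/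
def weightForm (n : R) (w f : Fin 2 → Fin 2 → R) (A A' : Fin 2) : R := f A A' + n * twoP w f A A'

/-- The derivative of a scalar for conformal weight `1` and GHP weight `2 n`. -/
def confGrad (F : SpinFrame R) (n : R) (w f : Fin 2 → Fin 2 → R) (Φ : R) (A A' : Fin 2) : R :=
  F.D A A' Φ + weightForm n w f A A' * Φ

/-- The Teukolsky operator for conformal weight `1` and GHP weight `2 n`. -/
def teuk (F : SpinFrame R) (n : R) (w f : Fin 2 → Fin 2 → R) (Φ : R) : R :=
  etaTr (fun A A' B B' => F.n11 (F.confGrad n w f Φ) A A' B B'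
    + (2 * f A A' + weightForm n w f A A') * F.confGrad n w f Φ B B')

/-- The potential `X_{A'ABC} = ε^{ED} S_{ABCD} v_{EA'}`, where `s k` is the component of `S` with `k`
indices equal to one. -/
def potential (s : ℕ → R) (v : Fin 2 → Fin 2 → R) (A' A B C : Fin 2) : R :=
  s (A + B + C + 1) * v 0 A' - s (A + B + C) * v 1 A'

theorem symm13_potential (s : ℕ → R) (v : Fin 2 → Fin 2 → R) : Symm13 (potential s v) := by
  constructor
  · intro A' A B C
    simp only [potential, Nat.add_comm (A : ℕ) B]
  · intro A' A B C
    simp only [potential, Nat.add_assoc, Nat.add_comm (B : ℕ) C]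

/-- The components of a symmetric spinor of GHP weight `2 n` with constant components. -/
structure WeightedSpinor (F : SpinFrame R) (n : R) (s : ℕ → R) : Prop where
  constN : ∀ A A', F.D A A' n = 0
  const : ∀ A A' k, F.D A A' (s k) = 0
  weight : ∀ k ≤ 4, n * s k = (2 - k) * s k

/-- The commutator of weighted derivatives is the curvature of f + n (2P), whose unprimed part
vanishes. The Lee form terms of 𝒞 on covectors are symmetric in the two indices and do not
contribute. -/
theorem Hermitian.asd_confGrad {w f : Fin 2 → Fin 2 → R} (hf : F.Hermitian w f) {l : R} {ψ : ℕ → R}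
    (hF : F.SelfDualEinstein l ψ) {n : R} (hn : ∀ A A', F.D A A' n = 0) (Φ : R) (A B : Fin 2) :
    (F.n11 (F.confGrad n w f Φ) A 0 B 1 + weightForm n w f A 0 * F.confGrad n w f Φ B 1)
    - (F.n11 (F.confGrad n w f Φ) A 1 B 0 + weightForm n w f A 1 * F.confGrad n w f Φ B 0)
    + (F.n11 (F.confGrad n w f Φ) B 0 A 1 + weightForm n w f B 0 * F.confGrad n w f Φ A 1)
    - (F.n11 (F.confGrad n w f Φ) B 1 A 0 + weightForm n w f B 1 * F.confGrad n w f Φ A 0) = 0 := by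
  have ha : F.n11 f A 0 B 1 - F.n11 f A 1 B 0 + (F.n11 f B 0 A 1 - F.n11 f B 1 A 0) = 0 := by
    obtain ⟨a, b, c⟩ := hf.asd_lee hF
    fin_cases A <;> fin_cases B <;> simp only [Fin.zero_eta, Fin.mk_one]
    · linear_combination 2 * a
    · linear_combination c
    · linear_combination c
    · linear_combination 2 * b
  have hb : F.n11 (twoP w f) A 0 B 1 - F.n11 (twoP w f) A 1 B 0
      + (F.n11 (twoP w f) B 0 A 1 - F.n11 (twoP w f) B 1 A 0) = 0 := by
    obtain ⟨a, b, c⟩ := hf.asd_twoP hF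
    fin_cases A <;> fin_cases B <;> simp only [Fin.zero_eta, Fin.mk_one]
    · linear_combination 2 * a
    · linear_combination c
    · linear_combination c
    · linear_combination 2 * b
  have t1 := F.torsion A 0 B 1 Φ
  have t2 := F.torsion A 1 B 0 Φ
  simp only [confGrad, weightForm, n11, Fin.sum_univ_two, map_add, Derivation.leibniz, hn,
    smul_eq_mul] at ha hb t1 t2 ⊢
  linear_combination t1 - t2 + Φ * ha + n * Φ * hb

/-- The dyad components are constant, so differentiating S yields connection coefficients only: the
off-diagonal ones are Lee forms, and the diagonal ones combine into P by means of the weight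
identity. -/
theorem Hermitian.n13_potential {w f : Fin 2 → Fin 2 → R} (hf : F.Hermitian w f) {n : R}
    {s : ℕ → R} (hs : F.WeightedSpinor n s) (v : Fin 2 → Fin 2 → R) (G G' E' A B C : Fin 2) :
    F.n13 (potential s v) G G' E' A B C =
      s (A + B + C + 1) * (F.n11 v G G' 0 E' + (n * twoP w f G G' - 2 * f G G') * v 0 E')
      - s (A + B + C) * (F.n11 v G G' 1 E' + (n * twoP w f G G' - 2 * f G G') * v 1 E')
      + f A G' * (s (G + B + C + 1) * v 0 E' - s (G + B + C) * v 1 E')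
      + f B G' * (s (G + A + C + 1) * v 0 E' - s (G + A + C) * v 1 E')
      + f C G' * (s (G + A + B + 1) * v 0 E' - s (G + A + B) * v 1 E')
      + s (A + B + C + G) * (f 1 G' * v 0 E' - f 0 G' * v 1 E') := by
  have h1 := hs.weight (A + B + C + 1) (by omega)
  have h0 := hs.weight (A + B + C) (by omega)
  obtain ⟨f0, f1, f2⟩ := hf
  have t := F.traceU
  simp only [n13, n11, potential, Fin.sum_univ_two, map_sub, Derivation.leibniz, hs.const,
    smul_eq_mul]
  -- A diagonal coefficient acts on a component with k ones through 2 - k; `h1` and `h0` trade this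
  -- number for n.
  linear_combination (norm := skip) - twoP w f G G' * v 0 E' * h1 + twoP w f G G' * v 1 E' * h0
  clear h1 h0
  fin_cases G <;> fin_cases A <;> fin_cases B <;> fin_cases C <;>
    simp [twoP, f0, f1, f2, t, ee] <;> ring

/-- Numerals at least two are invertible in a ℂ-algebra, so they cancel although `R` may have zero
divisors. -/
theorem ofNat_mul_cancel (k : ℕ) [k.AtLeastTwo] {x : R} (h : (OfNat.ofNat k : R) * x = 0) :
    x = 0 := by
  have h' : (OfNat.ofNat k : ℂ) • x = 0 := by rw [Algebra.smul_def, map_ofNat, h]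
  exact (smul_eq_zero.1 h').resolve_left (OfNat.ofNat_ne_zero k)

/-- The twistor-type equation for the potential reduces to the Teukolsky equation. -/
theorem Hermitian.twist_potential {w f : Fin 2 → Fin 2 → R} (hf : F.Hermitian w f) {l : R}
    {ψ : ℕ → R} (hF : F.SelfDualEinstein l ψ) {n : R} {s : ℕ → R} (hs : F.WeightedSpinor n s)
    (Φ : R) (D A B C : Fin 2) :
    F.twist (potential s (F.confGrad n w f Φ)) D A B C =
      - 2 * s (D + A + B + C) * F.teuk n w f Φ := by
  have ha := hf.asd_confGrad hF hs.constN Φ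
  -- At equal indices the symmetrised identity counts each term twice.
  have a00 : (F.n11 (F.confGrad n w f Φ) 0 0 0 1
      + weightForm n w f 0 0 * F.confGrad n w f Φ 0 1)
      - (F.n11 (F.confGrad n w f Φ) 0 1 0 0
        + weightForm n w f 0 1 * F.confGrad n w f Φ 0 0) = 0 :=
    ofNat_mul_cancel 2 (by linear_combination ha 0 0)
  have a11 : (F.n11 (F.confGrad n w f Φ) 1 0 1 1
      + weightForm n w f 1 0 * F.confGrad n w f Φ 1 1)
      - (F.n11 (F.confGrad n w f Φ) 1 1 1 0
        + weightForm n w f 1 1 * F.confGrad n w f Φ 1 0) = 0 :=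
    ofNat_mul_cancel 2 (by linear_combination ha 1 1)
  have a01 := ha 0 1
  clear ha
  simp only [twist, hf.n13_potential hs, teuk, etaTr, weightForm] at *
  generalize F.confGrad n w f Φ = v at *
  clear hs
  fin_cases D <;> fin_cases A <;> fin_cases B <;> fin_cases C <;>
    simp only [Fin.zero_eta, Fin.mk_one, Fin.val_zero, Fin.val_one, Nat.reduceAdd]
  -- After the Teukolsky trace is split off, the remainder involves only the three unprimed
  -- components `a00`, `a11`, `a01`, with coefficients from S.
  · linear_combination 4 * s 1 * a00 - 2 * s 0 * a01
  · linear_combination 3 * s 2 * a00 - 1 * s 0 * a11 - 1 * s 1 * a01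
  · linear_combination 3 * s 2 * a00 - 1 * s 0 * a11 - 1 * s 1 * a01
  · linear_combination 2 * s 3 * a00 - 2 * s 1 * a11
  · linear_combination 3 * s 2 * a00 - 1 * s 0 * a11 - 1 * s 1 * a01
  · linear_combination 2 * s 3 * a00 - 2 * s 1 * a11
  · linear_combination 2 * s 3 * a00 - 2 * s 1 * a11
  · linear_combination 1 * s 4 * a00 - 3 * s 2 * a11 + 1 * s 3 * a01
  · linear_combination 3 * s 2 * a00 - 1 * s 0 * a11 - 1 * s 1 * a01
  · linear_combination 2 * s 3 * a00 - 2 * s 1 * a11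
  · linear_combination 2 * s 3 * a00 - 2 * s 1 * a11
  · linear_combination 1 * s 4 * a00 - 3 * s 2 * a11 + 1 * s 3 * a01
  · linear_combination 2 * s 3 * a00 - 2 * s 1 * a11
  · linear_combination 1 * s 4 * a00 - 3 * s 2 * a11 + 1 * s 3 * a01
  · linear_combination 1 * s 4 * a00 - 3 * s 2 * a11 + 1 * s 3 * a01
  · linear_combination - 4 * s 3 * a11 + 2 * s 4 * a01

end SpinFrame

/-! ### Spin frames from coordinate charts. -/

open scoped Kronecker in
/-- A coordinate chart over a commutative algebra of functions: coordinate derivations, a soldering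
form `S_a{}^{AA'}` with inverse `E`, a torsion-free affine connection `Γ a b c = Γ^c_{ab}`, and spin
connections `u`, `v` on lower spinor indices for which the soldering form is parallel. -/
structure SpinChart (R : Type*) [CommRing R] [Algebra ℂ R] where
  d : Fin 4 → Derivation ℂ R R
  comm : ∀ a b f, d a (d b f) = d b (d a f)
  Γ : Fin 4 → Matrix (Fin 4) (Fin 4) R
  Γ_symm : ∀ a b c, Γ a b c = Γ b a c
  S : Matrix (Fin 4) (Fin 2 × Fin 2) R
  E : Matrix (Fin 2 × Fin 2) (Fin 4) R
  SE : S * E = 1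
  ES : E * S = 1
  u : Fin 4 → Matrix (Fin 2) (Fin 2) R
  v : Fin 4 → Matrix (Fin 2) (Fin 2) R
  trace_u : ∀ a, u a 1 1 = - u a 0 0
  trace_v : ∀ a, v a 1 1 = - v a 0 0
  dS : ∀ a, S.map (d a) = Γ a * S + S * (u a ⊗ₖ 1 + 1 ⊗ₖ v a)

namespace SpinChart

variable {R : Type*} [CommRing R] [Algebra ℂ R] (K : SpinChart R)

open scoped Kronecker

/-- The connection on lower pairs of spinor indices. -/
def W (a : Fin 4) : Matrix (Fin 2 × Fin 2) (Fin 2 × Fin 2) R := K.u a ⊗ₖ 1 + 1 ⊗ₖ K.v a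

theorem map_mul {m n p : Type*} [Fintype n] (D : Derivation ℂ R R) (M : Matrix m n R)
    (N : Matrix n p R) : (M * N).map D = M.map D * N + M * N.map D := by
  ext i j
  simp only [Matrix.map_apply, Matrix.mul_apply, Matrix.add_apply, map_sum, Derivation.leibniz,
    smul_eq_mul, ← Finset.sum_add_distrib]
  exact Finset.sum_congr rfl fun k _ => by ring

theorem map_add {m n : Type*} (D : Derivation ℂ R R) (M N : Matrix m n R) :
    (M + N).map D = M.map D + N.map D := by
  ext i j; simp

theorem map_one {n : Type*} [DecidableEq n] (D : Derivation ℂ R R) :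
    (1 : Matrix n n R).map D = 0 := by
  ext i j
  by_cases h : i = j <;> simp [Matrix.one_apply, h]

/-- Obtained by differentiating E S = 1. -/
theorem dE (a : Fin 4) : K.E.map (K.d a) = - (K.E * K.Γ a) - K.W a * K.E := by
  have h := map_mul (K.d a) K.E K.S
  rw [K.ES, map_one, K.dS] at h
  have h2 : (K.E.map (K.d a) * K.S + K.E * (K.Γ a * K.S + K.S * K.W a)) * K.E = 0 := by
    rw [W, ← h, Matrix.zero_mul]
  rw [Matrix.add_mul, Matrix.mul_assoc, K.SE, Matrix.mul_one, Matrix.mul_assoc, Matrix.add_mul,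
    Matrix.mul_assoc (K.Γ a), K.SE, Matrix.mul_one, Matrix.mul_add, Matrix.mul_assoc,
    ← Matrix.mul_assoc K.E K.S, K.ES, Matrix.one_mul] at h2
  rw [eq_neg_of_add_eq_zero_left h2]; abel

/-- Frame derivations. -/
def D (α : Fin 2 × Fin 2) : Derivation ℂ R R := ∑ a, K.E α a • K.d a

theorem D_apply (α : Fin 2 × Fin 2) (f : R) : K.D α f = ∑ a, K.E α a * K.d a f := by
  simp only [D, ← Derivation.coeFnAddMonoidHom_apply, map_sum, Finset.sum_apply]
  rfl

/-- Frame components of the connection. -/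
def ω' (α : Fin 2 × Fin 2) : Matrix (Fin 2 × Fin 2) (Fin 2 × Fin 2) R := ∑ a, K.E α a • K.W a

/-- In the Leibniz expansion, the spin connection part of dE cancels the explicit connection term,
and its Christoffel part completes the coordinate covariant derivative. -/
theorem frame_d (x : Fin 4 → R) (α β : Fin 2 × Fin 2) :
    K.D α (∑ b, K.E β b * x b) + ∑ γ, K.ω' α β γ * ∑ b, K.E γ b * x b =
      ∑ a, ∑ b, K.E α a * K.E β b * (K.d a (x b) - ∑ c, K.Γ a b c * x c) := by
  have h : ∀ a b, K.d a (K.E β b) = - ∑ c, K.E β c * K.Γ a c b - ∑ γ, K.W a β γ * K.E γ b := by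
    intro a b
    have := congrFun (congrFun (K.dE a) β) b
    simpa [Matrix.mul_apply] using this
  have e1 : ∑ γ, K.ω' α β γ * ∑ b, K.E γ b * x b =
      ∑ a, ∑ b, K.E α a * (x b * ∑ γ, K.W a β γ * K.E γ b) := by
    simp only [ω', Matrix.sum_apply, Matrix.smul_apply, smul_eq_mul]
    simp_rw [Finset.sum_mul_sum]
    simp only [Finset.mul_sum]
    rw [Finset.sum_comm]
    refine Finset.sum_congr rfl fun a _ => ?_
    rw [Finset.sum_comm]
    exact Finset.sum_congr rfl fun b _ => Finset.sum_congr rfl fun γ _ => by ring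
  have e2 : ∀ a, ∑ b, K.E α a * (x b * ∑ c, K.E β c * K.Γ a c b) =
      ∑ b, K.E α a * (K.E β b * ∑ c, K.Γ a b c * x c) := by
    intro a
    simp only [Finset.mul_sum]
    rw [Finset.sum_comm]
    exact Finset.sum_congr rfl fun b _ => Finset.sum_congr rfl fun c _ => by ring
  have e3 : K.D α (∑ b, K.E β b * x b) = ∑ a, (∑ b, K.E α a * (K.E β b * K.d a (x b))
      - ∑ b, K.E α a * (x b * ∑ c, K.E β c * K.Γ a c b)
      - ∑ b, K.E α a * (x b * ∑ γ, K.W a β γ * K.E γ b)) := by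
    rw [D_apply]
    refine Finset.sum_congr rfl fun a _ => ?_
    simp only [map_sum, Derivation.leibniz, smul_eq_mul, h, ← Finset.sum_sub_distrib]
    rw [Finset.mul_sum]
    exact Finset.sum_congr rfl fun b _ => by ring
  rw [e1, e3, ← Finset.sum_add_distrib]
  refine Finset.sum_congr rfl fun a _ => ?_
  rw [e2, sub_add_cancel, ← Finset.sum_sub_distrib]
  exact Finset.sum_congr rfl fun b _ => by ring

/-- The exterior derivative of a one-form in the frame. -/
theorem frame_curl (x : Fin 4 → R) (α β : Fin 2 × Fin 2) :
    (K.D α (∑ b, K.E β b * x b) + ∑ γ, K.ω' α β γ * ∑ b, K.E γ b * x b)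
      - (K.D β (∑ b, K.E α b * x b) + ∑ γ, K.ω' β α γ * ∑ b, K.E γ b * x b) =
      ∑ a, ∑ b, K.E α a * K.E β b * (K.d a (x b) - K.d b (x a)) := by
  rw [frame_d, frame_d, Finset.sum_comm (f := fun a b => K.E β a * K.E α b * _),
    ← Finset.sum_sub_distrib]
  refine Finset.sum_congr rfl fun a _ => ?_
  rw [← Finset.sum_sub_distrib]
  refine Finset.sum_congr rfl fun b _ => ?_
  have : ∑ c, K.Γ a b c * x c = ∑ c, K.Γ b a c * x c :=
    Finset.sum_congr rfl fun c _ => by rw [K.Γ_symm]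
  rw [this]; ring

theorem ω'_apply (α β : Fin 2 × Fin 2) (y : Fin 2 × Fin 2 → R) : ∑ γ, K.ω' α β γ * y γ =
    ∑ k, (∑ a, K.E α a * K.u a β.1 k) * y (k, β.2) + ∑ k, (∑ a, K.E α a * K.v a β.2 k) * y (β.1, k) := by
  simp only [ω', W, Matrix.sum_apply, Matrix.smul_apply, Matrix.add_apply, Matrix.kroneckerMap_apply,
    Matrix.one_apply, smul_eq_mul, Fintype.sum_prod_type, mul_add, add_mul, Finset.sum_add_distrib,
    mul_ite, ite_mul, mul_one, mul_zero, zero_mul, one_mul]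
  congr 1
  · refine Finset.sum_congr rfl fun k _ => ?_
    rw [Finset.sum_eq_single β.2 (by intro b _ hb; simp [hb.symm]) (by simp)]
    simp
  · rw [Finset.sum_comm]
    refine Finset.sum_congr rfl fun k _ => ?_
    rw [Finset.sum_eq_single β.1 (by intro b _ hb; simp [hb.symm]) (by simp)]
    simp

/-- The spin frame of a chart. -/
def frame : SpinFrame R where
  D A A' := K.D (A, A')
  U A A' B C := ∑ a, K.E (A, A') a * K.u a B C
  V A A' B C := ∑ a, K.E (A, A') a * K.v a B C
  traceU A A' := by simp [K.trace_u]
  traceV A A' := by simp [K.trace_v]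
  torsion A A' B B' f := by
    -- The torsion identity is the closedness of df, read in the frame.
    have h := K.frame_curl (fun b => K.d b f) (A, A') (B, B')
    simp only [K.comm, sub_self, mul_zero, Finset.sum_const_zero, ← D_apply, ω'_apply] at h
    linear_combination h

/-- Curvature of the connection `u` in coordinates. -/
def curv (u : Fin 4 → Matrix (Fin 2) (Fin 2) R) (a b : Fin 4) : Matrix (Fin 2) (Fin 2) R :=
  (u b).map (K.d a) - (u a).map (K.d b) + u a * u b - u b * u a

theorem sum_mul_sum_mul (α β : Fin 2 × Fin 2) (x y : Fin 4 → Fin 2 → R) :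
    ∑ k, (∑ a, K.E α a * x a k) * (∑ b, K.E β b * y b k) =
      ∑ a, ∑ b, K.E α a * K.E β b * ∑ k, x a k * y b k := by
  simp_rw [Finset.sum_mul_sum]
  simp only [Finset.mul_sum]
  rw [Finset.sum_comm]
  refine Finset.sum_congr rfl fun a _ => ?_
  rw [Finset.sum_comm]
  exact Finset.sum_congr rfl fun b _ => Finset.sum_congr rfl fun k _ => by ring

/-- Each matrix entry of `u` is a one-form, so `frame_curl` absorbs the derivatives of the frame;
the quadratic terms are bilinear. -/
theorem frame_curvU (A A' B B' C D : Fin 2) : K.frame.curvU A A' B B' C D =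
    ∑ a, ∑ b, K.E (A, A') a * K.E (B, B') b * K.curv K.u a b C D := by
  have h := K.frame_curl (fun b => K.u b C D) (A, A') (B, B')
  have h1 := K.sum_mul_sum_mul (A, A') (B, B') (fun a k => K.u a C k) (fun b k => K.u b k D)
  have h2 := K.sum_mul_sum_mul (B, B') (A, A') (fun a k => K.u a C k) (fun b k => K.u b k D)
  rw [Finset.sum_comm] at h2
  simp only [ω'_apply] at h
  simp only [SpinFrame.curvU, frame, Finset.sum_sub_distrib, curv, Matrix.sub_apply,
    Matrix.add_apply, Matrix.mul_apply, Matrix.map_apply, mul_add, mul_sub,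
    Finset.sum_add_distrib] at h ⊢
  rw [h1, h2]
  have e : ∀ f : Fin 4 → Fin 4 → R, ∑ x, ∑ y, K.E (B, B') y * K.E (A, A') x * f x y
      = ∑ x, ∑ y, K.E (A, A') x * K.E (B, B') y * f x y := fun f =>
    Finset.sum_congr rfl fun a _ => Finset.sum_congr rfl fun b _ => by ring
  rw [e]
  linear_combination h

theorem frame_curvV (A A' B B' C D : Fin 2) : K.frame.curvV A A' B B' C D =
    ∑ a, ∑ b, K.E (A, A') a * K.E (B, B') b * K.curv K.v a b C D := by
  have h := K.frame_curl (fun b => K.v b C D) (A, A') (B, B')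
  have h1 := K.sum_mul_sum_mul (A, A') (B, B') (fun a k => K.v a C k) (fun b k => K.v b k D)
  have h2 := K.sum_mul_sum_mul (B, B') (A, A') (fun a k => K.v a C k) (fun b k => K.v b k D)
  rw [Finset.sum_comm] at h2
  simp only [ω'_apply] at h
  simp only [SpinFrame.curvV, frame, Finset.sum_sub_distrib, curv, Matrix.sub_apply,
    Matrix.add_apply, Matrix.mul_apply, Matrix.map_apply, mul_add, mul_sub,
    Finset.sum_add_distrib] at h ⊢
  rw [h1, h2]
  have e : ∀ f : Fin 4 → Fin 4 → R, ∑ x, ∑ y, K.E (B, B') y * K.E (A, A') x * f x y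
      = ∑ x, ∑ y, K.E (A, A') x * K.E (B, B') y * f x y := fun f =>
    Finset.sum_congr rfl fun a _ => Finset.sum_congr rfl fun b _ => by ring
  rw [e]
  linear_combination h

/-- The Riemann tensor `R_{abc}{}^e`, as a matrix in `c`, `e`. -/
def riem (a b : Fin 4) : Matrix (Fin 4) (Fin 4) R :=
  (K.Γ b).map (K.d a) - (K.Γ a).map (K.d b) + K.Γ b * K.Γ a - K.Γ a * K.Γ b

/-- The integrability condition of `dS`: mixed second derivatives of the soldering form agree, so
the Riemann tensor acts as minus the sum of the two spinor curvatures. -/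
theorem riem_mul_S (a b : Fin 4) :
    K.riem a b * K.S = - (K.S * (K.curv K.u a b ⊗ₖ 1 + 1 ⊗ₖ K.curv K.v a b)) := by
  have hd : ∀ a b, (K.Γ b).map (K.d a) * K.S + K.Γ b * (K.Γ a * K.S + K.S * K.W a)
      + ((K.Γ a * K.S + K.S * K.W a) * K.W b + K.S * (K.W b).map (K.d a)) =
      (K.S.map (K.d b)).map (K.d a) := by
    intro a b
    rw [K.dS, map_add, map_mul, map_mul, K.dS]
    rfl
  have hc : (K.S.map (K.d b)).map (K.d a) = (K.S.map (K.d a)).map (K.d b) := by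
    ext i j; simp [K.comm a b]
  rw [← hd, ← hd] at hc
  have hW : K.curv K.u a b ⊗ₖ (1 : Matrix (Fin 2) (Fin 2) R) + 1 ⊗ₖ K.curv K.v a b =
      (K.W b).map (K.d a) - (K.W a).map (K.d b) + K.W a * K.W b - K.W b * K.W a := by
    have hm : ∀ a b, (K.W b).map (K.d a) =
        (K.u b).map (K.d a) ⊗ₖ 1 + 1 ⊗ₖ (K.v b).map (K.d a) := by
      intro a b
      ext i j
      simp only [W, Matrix.map_apply, Matrix.add_apply, Matrix.kroneckerMap_apply, _root_.map_add,
        Derivation.leibniz, smul_eq_mul]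
      by_cases h1 : i.1 = j.1 <;> by_cases h2 : i.2 = j.2 <;> simp [Matrix.one_apply, h1, h2]
    -- The mixed terms u ⊗ v are symmetric in a, b and disappear from the commutator.
    have hp : ∀ a b, K.W a * K.W b = (K.u a * K.u b) ⊗ₖ 1 + K.u a ⊗ₖ K.v b + K.u b ⊗ₖ K.v a
        + 1 ⊗ₖ (K.v a * K.v b) := by
      intro a b
      simp only [W, Matrix.add_mul, Matrix.mul_add, ← Matrix.mul_kronecker_mul, Matrix.one_mul,
        Matrix.mul_one]
      abel
    rw [hm, hm, hp, hp, curv, curv]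
    ext i j
    simp only [Matrix.add_apply, Matrix.sub_apply, Matrix.kroneckerMap_apply]
    ring
  rw [hW, riem]
  simp only [Matrix.mul_add, Matrix.add_mul, Matrix.mul_sub, Matrix.sub_mul, Matrix.mul_assoc]
    at hc ⊢
  linear_combination (norm := abel) hc

end SpinChart

/-! ### Curvature spinors from the Bianchi, Ricci and Weyl conditions. -/

namespace SpinFrame

variable {R : Type*} [CommRing R] [Algebra ℂ R] (F : SpinFrame R)

/-- The Riemann tensor `R_{abc}{}^d` in the frame. -/
def rm (A A' B B' C C' D D' : Fin 2) : R :=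
  - (F.curvU A A' B B' C D * dd C' D' + dd C D * F.curvV A A' B B' C' D')

theorem curvU_antisymm (A A' B B' C D : Fin 2) :
    F.curvU A A' B B' C D = - F.curvU B B' A A' C D := by
  simp only [curvU, Fin.sum_univ_two]; ring

theorem curvV_antisymm (A A' B B' C D : Fin 2) :
    F.curvV A A' B B' C D = - F.curvV B B' A A' C D := by
  simp only [curvV, Fin.sum_univ_two]; ring

theorem curvU_trace (A A' B B' : Fin 2) : F.curvU A A' B B' 1 1 = - F.curvU A A' B B' 0 0 := by
  simp only [curvU, Fin.sum_univ_two, F.traceU, map_neg]; ring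

theorem curvV_trace (A A' B B' : Fin 2) : F.curvV A A' B B' 1 1 = - F.curvV A A' B B' 0 0 := by
  simp only [curvV, Fin.sum_univ_two, F.traceV, map_neg]; ring

theorem curvU_self (A A' C D : Fin 2) : F.curvU A A' A A' C D = 0 := by
  simp only [curvU, Fin.sum_univ_two]; ring

theorem curvV_self (A A' C D : Fin 2) : F.curvV A A' A A' C D = 0 := by
  simp only [curvV, Fin.sum_univ_two]; ring

variable {F}

/-- The primed Weyl spinor. -/
def primedWeyl (F : SpinFrame R) (l : R) : ℕ → R
  | 0 => F.curvV 0 0 1 0 0 1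
  | 1 => F.curvV 0 0 1 0 1 1
  | 2 => F.curvV 0 0 1 1 1 1 - l
  | 3 => F.curvV 0 1 1 1 1 1
  | _ => - F.curvV 0 1 1 1 1 0

set_option maxHeartbeats 4000000 in
/-- The curvature spinors of an Einstein metric with vanishing unprimed Weyl spinor. -/
theorem selfDualEinstein_of_ricci {l lam : R} (hl : 6 * l = - lam) (hc : ∀ A A', F.D A A' l = 0)
    (hb : ∀ A A' B B' C C' D D', F.rm A A' B B' C C' D D' + F.rm B B' C C' A A' D D'
      + F.rm C C' A A' B B' D D' = 0)
    (hr : ∀ A A' C C', ∑ B, ∑ B', F.rm A A' B B' C C' B B' = lam * (ee A C * ee A' C'))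
    (hw : ∀ A B C D, ∑ a, ∑ b, ∑ c, ∑ d, ee a b * ee c d *
      (3 * ∑ K, ∑ k, F.rm A a B b C c K k * (ee K D * ee k d)
        - lam * (ee A C * ee a c * (ee B D * ee b d) - ee A D * ee a d * (ee B C * ee b c))) = 0) :
    F.SelfDualEinstein l (F.primedWeyl l) := by
  have u0 := F.curvU_self
  have v0 := F.curvV_self
  have ut := F.curvU_trace
  have vt := F.curvV_trace
  have us1000 := F.curvU_antisymm 1 0 0 0
  have vs1000 := F.curvV_antisymm 1 0 0 0
  have us1001 := F.curvU_antisymm 1 0 0 1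
  have vs1001 := F.curvV_antisymm 1 0 0 1
  have us1100 := F.curvU_antisymm 1 1 0 0
  have vs1100 := F.curvV_antisymm 1 1 0 0
  have us1101 := F.curvU_antisymm 1 1 0 1
  have vs1101 := F.curvV_antisymm 1 1 0 1
  have us0100 := F.curvU_antisymm 0 1 0 0
  have vs0100 := F.curvV_antisymm 0 1 0 0
  have us1110 := F.curvU_antisymm 1 1 1 0
  have vs1110 := F.curvV_antisymm 1 1 1 0
  simp only [Fin.sum_univ_two, rm] at hb hr hw
  -- The linear system determines all 18 independent components of `curvU` (six index pairs,
  -- trace-free in CD). Each coefficient list solves the system for one component; the factor 12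
  -- clears denominators.
  have e0 : F.curvU 0 0 0 1 0 0 = 0 := sub_eq_zero.1 (ofNat_mul_cancel 12 (by
    linear_combination (norm := skip) -1 * hw 0 0 0 1
    simp [Fin.sum_univ_two, ee, dd, rm, u0, v0, ut, vt, us1000, vs1000, us1001, vs1001, us1100, vs1100, us1101, vs1101,
      us0100, vs0100, us1110, vs1110]; ring))
  have e1 : F.curvU 0 0 0 1 0 1 = 0 := sub_eq_zero.1 (ofNat_mul_cancel 12 (by
    linear_combination (norm := skip) 1 * hw 0 0 0 0
    simp [Fin.sum_univ_two, ee, dd, rm, u0, v0, ut, vt, us1000, vs1000, us1001, vs1001, us1100, vs1100, us1101, vs1101,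
      us0100, vs0100, us1110, vs1110]; ring))
  have e2 : F.curvU 0 0 0 1 1 0 = 2 * l := sub_eq_zero.1 (ofNat_mul_cancel 12 (by
    linear_combination (norm := skip) -1 * hw 0 0 1 1 - 4 * hl
    simp [Fin.sum_univ_two, ee, dd, rm, u0, v0, ut, vt, us1000, vs1000, us1001, vs1001, us1100, vs1100, us1101, vs1101,
      us0100, vs0100, us1110, vs1110]; ring))
  have e3 : F.curvU 0 0 1 0 0 0 = 0 := sub_eq_zero.1 (ofNat_mul_cancel 12 (by
    linear_combination (norm := skip) 6 * hb 0 0 1 0 1 1 1 1 + 6 * hr 0 0 1 0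
    simp [Fin.sum_univ_two, ee, dd, rm, u0, v0, ut, vt, us1000, vs1000, us1001, vs1001, us1100, vs1100, us1101, vs1101,
      us0100, vs0100, us1110, vs1110]; ring))
  have e4 : F.curvU 0 0 1 0 0 1 = 0 := sub_eq_zero.1 (ofNat_mul_cancel 12 (by
    linear_combination (norm := skip) -6 * hr 0 0 0 0 + 6 * hb 0 0 0 1 1 0 1 1
    simp [Fin.sum_univ_two, ee, dd, rm, u0, v0, ut, vt, us1000, vs1000, us1001, vs1001, us1100, vs1100, us1101, vs1101,
      us0100, vs0100, us1110, vs1110]; ring))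
  have e5 : F.curvU 0 0 1 0 1 0 = 0 := sub_eq_zero.1 (ofNat_mul_cancel 12 (by
    linear_combination (norm := skip) -6 * hb 0 0 1 0 1 1 0 1 + 6 * hr 1 0 1 0
    simp [Fin.sum_univ_two, ee, dd, rm, u0, v0, ut, vt, us1000, vs1000, us1001, vs1001, us1100, vs1100, us1101, vs1101,
      us0100, vs0100, us1110, vs1110]; ring))
  have e6 : F.curvU 0 0 1 1 0 0 = -1 * l := sub_eq_zero.1 (ofNat_mul_cancel 12 (by
    linear_combination (norm := skip) 6 * hr 0 0 1 1 + 3 * hb 0 0 0 1 1 0 0 0 + 3 * hb 0 1 1 0 1 1 1 1 + 3 * hb 0 0 0 1 1 1 0 1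
      - 1 * hw 0 0 1 1 - 3 * hb 0 0 1 0 1 1 1 0 + 2 * hl
    simp [Fin.sum_univ_two, ee, dd, rm, u0, v0, ut, vt, us1000, vs1000, us1001, vs1001, us1100, vs1100, us1101, vs1101,
      us0100, vs0100, us1110, vs1110]; ring))
  have e7 : F.curvU 0 0 1 1 0 1 = 0 := sub_eq_zero.1 (ofNat_mul_cancel 12 (by
    linear_combination (norm := skip) -6 * hr 0 0 0 1 + 1 * hw 0 0 0 1 + 6 * hb 0 0 0 1 1 1 1 1
    simp [Fin.sum_univ_two, ee, dd, rm, u0, v0, ut, vt, us1000, vs1000, us1001, vs1001, us1100, vs1100, us1101, vs1101,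
      us0100, vs0100, us1110, vs1110]; ring))
  have e8 : F.curvU 0 0 1 1 1 0 = 0 := sub_eq_zero.1 (ofNat_mul_cancel 12 (by
    linear_combination (norm := skip) -1 * hw 0 1 1 1 + 6 * hb 0 0 1 0 1 1 0 0 + 6 * hr 1 0 1 1
    simp [Fin.sum_univ_two, ee, dd, rm, u0, v0, ut, vt, us1000, vs1000, us1001, vs1001, us1100, vs1100, us1101, vs1101,
      us0100, vs0100, us1110, vs1110]; ring))
  have e9 : F.curvU 0 1 1 0 0 0 = 1 * l := sub_eq_zero.1 (ofNat_mul_cancel 12 (by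
    linear_combination (norm := skip) -3 * hb 0 0 0 1 1 1 0 1 - 3 * hb 0 0 0 1 1 0 0 0 - 3 * hb 0 0 1 0 1 1 1 0 + 6 * hr 0 1 1 0
      + 1 * hw 0 0 1 1 + 3 * hb 0 1 1 0 1 1 1 1 - 2 * hl
    simp [Fin.sum_univ_two, ee, dd, rm, u0, v0, ut, vt, us1000, vs1000, us1001, vs1001, us1100, vs1100, us1101, vs1101,
      us0100, vs0100, us1110, vs1110]; ring))
  have e10 : F.curvU 0 1 1 0 0 1 = 0 := sub_eq_zero.1 (ofNat_mul_cancel 12 (by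
    linear_combination (norm := skip) -1 * hw 0 0 0 1 - 12 * hb 0 0 0 1 1 0 1 0 - 6 * hb 0 0 0 1 1 1 1 1 - 6 * hr 0 0 0 1
    simp [Fin.sum_univ_two, ee, dd, rm, u0, v0, ut, vt, us1000, vs1000, us1001, vs1001, us1100, vs1100, us1101, vs1101,
      us0100, vs0100, us1110, vs1110]; ring))
  have e11 : F.curvU 0 1 1 0 1 0 = 0 := sub_eq_zero.1 (ofNat_mul_cancel 12 (by
    linear_combination (norm := skip) 6 * hb 0 0 1 0 1 1 0 0 + 6 * hr 1 0 1 1 + 1 * hw 0 1 1 1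
    simp [Fin.sum_univ_two, ee, dd, rm, u0, v0, ut, vt, us1000, vs1000, us1001, vs1001, us1100, vs1100, us1101, vs1101,
      us0100, vs0100, us1110, vs1110]; ring))
  have e12 : F.curvU 0 1 1 1 0 0 = 0 := sub_eq_zero.1 (ofNat_mul_cancel 12 (by
    linear_combination (norm := skip) 6 * hr 0 1 1 1 - 6 * hb 0 1 1 0 1 1 1 0
    simp [Fin.sum_univ_two, ee, dd, rm, u0, v0, ut, vt, us1000, vs1000, us1001, vs1001, us1100, vs1100, us1101, vs1101,
      us0100, vs0100, us1110, vs1110]; ring))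
  have e13 : F.curvU 0 1 1 1 0 1 = 0 := sub_eq_zero.1 (ofNat_mul_cancel 12 (by
    linear_combination (norm := skip) -6 * hr 0 1 0 1 - 6 * hb 0 0 0 1 1 1 1 0
    simp [Fin.sum_univ_two, ee, dd, rm, u0, v0, ut, vt, us1000, vs1000, us1001, vs1001, us1100, vs1100, us1101, vs1101,
      us0100, vs0100, us1110, vs1110]; ring))
  have e14 : F.curvU 0 1 1 1 1 0 = 0 := sub_eq_zero.1 (ofNat_mul_cancel 12 (by
    linear_combination (norm := skip) 6 * hr 1 1 1 1 + 6 * hb 0 1 1 0 1 1 0 0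
    simp [Fin.sum_univ_two, ee, dd, rm, u0, v0, ut, vt, us1000, vs1000, us1001, vs1001, us1100, vs1100, us1101, vs1101,
      us0100, vs0100, us1110, vs1110]; ring))
  have e15 : F.curvU 1 0 1 1 0 0 = 0 := sub_eq_zero.1 (ofNat_mul_cancel 12 (by
    linear_combination (norm := skip) -6 * hb 0 0 1 0 1 1 0 0 - 6 * hb 0 1 1 0 1 1 0 1 - 1 * hw 0 1 1 1
    simp [Fin.sum_univ_two, ee, dd, rm, u0, v0, ut, vt, us1000, vs1000, us1001, vs1001, us1100, vs1100, us1101, vs1101,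
      us0100, vs0100, us1110, vs1110]; ring))
  have e16 : F.curvU 1 0 1 1 0 1 = -2 * l := sub_eq_zero.1 (ofNat_mul_cancel 12 (by
    linear_combination (norm := skip) 1 * hw 0 0 1 1 - 6 * hb 0 0 0 1 1 0 0 0 - 6 * hb 0 0 1 0 1 1 1 0 - 6 * hb 0 1 1 0 1 1 1 1
      - 6 * hb 0 0 0 1 1 1 0 1 + 4 * hl
    simp [Fin.sum_univ_two, ee, dd, rm, u0, v0, ut, vt, us1000, vs1000, us1001, vs1001, us1100, vs1100, us1101, vs1101,
      us0100, vs0100, us1110, vs1110]; ring))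
  have e17 : F.curvU 1 0 1 1 1 0 = 0 := sub_eq_zero.1 (ofNat_mul_cancel 12 (by
    linear_combination (norm := skip) -1 * hw 1 1 1 1
    simp [Fin.sum_univ_two, ee, dd, rm, u0, v0, ut, vt, us1000, vs1000, us1001, vs1001, us1100, vs1100, us1101, vs1101,
      us0100, vs0100, us1110, vs1110]; ring))
  -- Thirteen relations among the 18 components of `curvV`; the five that remain free form the
  -- primed Weyl spinor.
  have e18 : F.curvV 0 0 0 1 0 0 = 0 := sub_eq_zero.1 (ofNat_mul_cancel 2 (by
    linear_combination (norm := skip) 1 * hb 0 0 0 1 1 1 1 1 + 1 * hr 0 0 0 1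
    simp [Fin.sum_univ_two, ee, dd, rm, u0, v0, ut, vt, us1000, vs1000, us1001, vs1001, us1100, vs1100, us1101, vs1101,
      us0100, vs0100, us1110, vs1110]; ring))
  have e19 : F.curvV 1 0 1 1 0 0 = 0 := sub_eq_zero.1 (ofNat_mul_cancel 2 (by
    linear_combination (norm := skip) 1 * hr 1 0 1 1 + 1 * hb 0 1 1 0 1 1 0 1
    simp [Fin.sum_univ_two, ee, dd, rm, u0, v0, ut, vt, us1000, vs1000, us1001, vs1001, us1100, vs1100, us1101, vs1101,
      us0100, vs0100, us1110, vs1110]; ring))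
  have e20 : F.curvV 0 1 1 0 0 0 = F.curvV 0 0 1 1 0 0 := sub_eq_zero.1 (ofNat_mul_cancel 2 (by
    linear_combination (norm := skip) -1 * hr 0 1 1 0 - 1 * hb 0 0 0 1 1 0 0 0 + 1 * hb 0 0 0 1 1 1 0 1 - 1 * hr 0 0 1 1
    simp [Fin.sum_univ_two, ee, dd, rm, u0, v0, ut, vt, us1000, vs1000, us1001, vs1001, us1100, vs1100, us1101, vs1101,
      us0100, vs0100, us1110, vs1110]; ring))
  have e21 : F.curvV 0 0 0 1 0 1 = 0 := sub_eq_zero.1 (ofNat_mul_cancel 2 (by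
    linear_combination (norm := skip) -1 * hb 0 0 0 1 1 0 1 1 - 1 * hr 0 0 0 0
    simp [Fin.sum_univ_two, ee, dd, rm, u0, v0, ut, vt, us1000, vs1000, us1001, vs1001, us1100, vs1100, us1101, vs1101,
      us0100, vs0100, us1110, vs1110]; ring))
  have e22 : F.curvV 1 0 1 1 0 1 = 0 := sub_eq_zero.1 (ofNat_mul_cancel 2 (by
    linear_combination (norm := skip) -1 * hr 1 0 1 0 - 1 * hb 0 0 1 0 1 1 0 1
    simp [Fin.sum_univ_two, ee, dd, rm, u0, v0, ut, vt, us1000, vs1000, us1001, vs1001, us1100, vs1100, us1101, vs1101,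
      us0100, vs0100, us1110, vs1110]; ring))
  have e23 : F.curvV 0 1 1 0 0 1 = F.curvV 0 0 1 1 0 1 := sub_eq_zero.1 (ofNat_mul_cancel 2 (by
    linear_combination (norm := skip) -2 * hb 0 0 0 1 1 0 0 1 + 2 * hr 0 0 1 0
    simp [Fin.sum_univ_two, ee, dd, rm, u0, v0, ut, vt, us1000, vs1000, us1001, vs1001, us1100, vs1100, us1101, vs1101,
      us0100, vs0100, us1110, vs1110]; ring))
  have e24 : F.curvV 0 0 0 1 1 0 = 0 := sub_eq_zero.1 (ofNat_mul_cancel 2 (by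
    linear_combination (norm := skip) -1 * hb 0 0 0 1 1 1 1 0 + 1 * hr 0 1 0 1
    simp [Fin.sum_univ_two, ee, dd, rm, u0, v0, ut, vt, us1000, vs1000, us1001, vs1001, us1100, vs1100, us1101, vs1101,
      us0100, vs0100, us1110, vs1110]; ring))
  have e25 : F.curvV 1 0 1 1 1 0 = 0 := sub_eq_zero.1 (ofNat_mul_cancel 2 (by
    linear_combination (norm := skip) -1 * hb 0 1 1 0 1 1 0 0 + 1 * hr 1 1 1 1
    simp [Fin.sum_univ_two, ee, dd, rm, u0, v0, ut, vt, us1000, vs1000, us1001, vs1001, us1100, vs1100, us1101, vs1101,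
      us0100, vs0100, us1110, vs1110]; ring))
  have e26 : F.curvV 0 1 1 0 1 0 = F.curvV 0 0 1 1 1 0 := sub_eq_zero.1 (ofNat_mul_cancel 2 (by
    linear_combination (norm := skip) -2 * hb 0 0 0 1 1 1 0 0 - 2 * hr 0 1 1 1
    simp [Fin.sum_univ_two, ee, dd, rm, u0, v0, ut, vt, us1000, vs1000, us1001, vs1001, us1100, vs1100, us1101, vs1101,
      us0100, vs0100, us1110, vs1110]; ring))
  have e27 : F.curvV 0 0 1 1 0 1 = - F.curvV 0 0 1 0 0 0 := sub_eq_zero.1 (ofNat_mul_cancel 2 (by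
    linear_combination (norm := skip) -1 * hr 0 0 1 0 + 1 * hb 0 0 1 0 1 1 1 1
    simp [Fin.sum_univ_two, ee, dd, rm, u0, v0, ut, vt, us1000, vs1000, us1001, vs1001, us1100, vs1100, us1101, vs1101,
      us0100, vs0100, us1110, vs1110]; ring))
  have e28 : F.curvV 0 0 1 1 1 0 = F.curvV 0 1 1 1 0 0 := sub_eq_zero.1 (ofNat_mul_cancel 2 (by
    linear_combination (norm := skip) 1 * hr 0 1 1 1 - 1 * hb 0 1 1 0 1 1 1 0 + 2 * hb 0 0 0 1 1 1 0 0
    simp [Fin.sum_univ_two, ee, dd, rm, u0, v0, ut, vt, us1000, vs1000, us1001, vs1001, us1100, vs1100, us1101, vs1101,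
      us0100, vs0100, us1110, vs1110]; ring))
  have e29 : F.curvV 0 1 1 1 0 1 = - F.curvV 0 0 1 0 1 0 := sub_eq_zero.1 (ofNat_mul_cancel 2 (by
    linear_combination (norm := skip) -1 * hb 0 0 1 0 1 1 1 0 + 1 * hb 0 0 0 1 1 0 0 0 + 1 * hb 0 1 1 0 1 1 1 1 - 1 * hb 0 0 0 1
      1 1 0 1
    simp [Fin.sum_univ_two, ee, dd, rm, u0, v0, ut, vt, us1000, vs1000, us1001, vs1001, us1100, vs1100, us1101, vs1101,
      us0100, vs0100, us1110, vs1110]; ring))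
  have e30 : F.curvV 0 0 1 1 0 0 = F.curvV 0 0 1 0 1 0 - 3 * l := sub_eq_zero.1 (ofNat_mul_cancel 4 (by
    linear_combination (norm := skip) 1 * hb 0 0 1 0 1 1 1 0 + 2 * hr 0 0 1 1 - 1 * hb 0 0 0 1 1 0 0 0 - 1 * hb 0 1 1 0 1 1 1 1
      - 1 * hb 0 0 0 1 1 1 0 1 + 2 * hl
    simp [Fin.sum_univ_two, ee, dd, rm, u0, v0, ut, vt, us1000, vs1000, us1001, vs1001, us1100, vs1100, us1101, vs1101,
      us0100, vs0100, us1110, vs1110]; ring))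
  refine ⟨hc, ?_, ?_⟩
  · intro A A' B B' C D
    fin_cases A <;> fin_cases A' <;> fin_cases B <;> fin_cases B' <;> fin_cases C <;> fin_cases D <;>
      simp [ee, dd, u0, ut, us1000, us1001, us1100, us1101, us0100, us1110, e0, e1, e2, e3, e4, e5, e6, e7, e8, e9, e10, e11, e12, e13, e14, e15, e16, e17] <;> ring
  · intro A A' B B' C D
    fin_cases A <;> fin_cases A' <;> fin_cases B <;> fin_cases B' <;> fin_cases C <;> fin_cases D <;>
      simp [ee, dd, v0, vt, primedWeyl, vs1000, vs1001, vs1100, vs1101, vs0100, vs1110, e18, e19, e20, e21, e22, e23, e24, e25, e26, e27, e28, e29, e30] <;> ring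

end SpinFrame

/-! ### Coordinate tensors and their frame components. -/

namespace SpinChart

variable {R : Type*} [CommRing R] [Algebra ℂ R] (K : SpinChart R)

/-- The covariant derivative of a covariant tensor in coordinates. -/
def nab {n : ℕ} (T : (Fin n → Fin 4) → R) (a : Fin (n + 1) → Fin 4) : R :=
  K.d (a 0) (T (Fin.tail a))
    - ∑ r : Fin n, ∑ e, K.Γ (a 0) (Fin.tail a r) e * T (Function.update (Fin.tail a) r e)

/-- The tensor with given frame components. -/
def ofFrame {n : ℕ} (T : (Fin n → Fin 2 × Fin 2) → R) (a : Fin n → Fin 4) : R :=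
  ∑ α : Fin n → Fin 2 × Fin 2, (∏ r, K.S (a r) (α r)) * T α

/-- The covariant derivative of a covariant tensor in the frame. -/
def nabF {n : ℕ} (T : (Fin n → Fin 2 × Fin 2) → R) (α : Fin (n + 1) → Fin 2 × Fin 2) : R :=
  K.D (α 0) (T (Fin.tail α))
    + ∑ r : Fin n, ∑ γ, K.ω' (α 0) (Fin.tail α r) γ * T (Function.update (Fin.tail α) r γ)

theorem derivation_prod {ι : Type*} [DecidableEq ι] (D : Derivation ℂ R R) (s : Finset ι)
    (f : ι → R) : D (∏ i ∈ s, f i) = ∑ i ∈ s, (∏ j ∈ s.erase i, f j) * D (f i) := by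
  induction s using Finset.induction_on with
  | empty => simp
  | insert i s hi ih =>
    rw [Finset.prod_insert hi, Derivation.leibniz, Finset.sum_insert hi, Finset.erase_insert hi, ih,
      add_comm, smul_eq_mul, smul_eq_mul, Finset.mul_sum]
    congr 1
    refine Finset.sum_congr rfl fun j hj => ?_
    have hij : i ≠ j := fun h => hi (h ▸ hj)
    rw [Finset.erase_insert_of_ne hij, Finset.prod_insert (by simp [hi])]
    ring

theorem sum_S_D (c : Fin 4) (f : R) : ∑ α, K.S c α * K.D α f = K.d c f := by
  have h : ∀ a, ∑ α, K.S c α * K.E α a = (1 : Matrix (Fin 4) (Fin 4) R) c a := by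
    intro a; rw [← K.SE]; rfl
  simp only [D_apply, Finset.mul_sum]
  rw [Finset.sum_comm]
  simp only [← mul_assoc, ← Finset.sum_mul, h]
  simp [Matrix.one_apply]

theorem sum_S_ω' (c : Fin 4) (β γ : Fin 2 × Fin 2) : ∑ α, K.S c α * K.ω' α β γ = K.W c β γ := by
  have h : ∀ a, ∑ α, K.S c α * K.E α a = (1 : Matrix (Fin 4) (Fin 4) R) c a := by
    intro a; rw [← K.SE]; rfl
  simp only [ω', Matrix.sum_apply, Matrix.smul_apply, smul_eq_mul, Finset.mul_sum]
  rw [Finset.sum_comm]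
  simp only [← mul_assoc, ← Finset.sum_mul, h]
  simp [Matrix.one_apply]

theorem ofFrame_cons {n : ℕ} (T : (Fin (n + 1) → Fin 2 × Fin 2) → R) (a : Fin (n + 1) → Fin 4) :
    K.ofFrame T a = ∑ γ, K.S (a 0) γ * K.ofFrame (fun α => T (Fin.cons γ α)) (Fin.tail a) := by
  rw [ofFrame, ← (Fin.consEquiv fun _ => Fin 2 × Fin 2).sum_comp, Fintype.sum_prod_type]
  refine Finset.sum_congr rfl fun γ _ => ?_
  rw [ofFrame, Finset.mul_sum]
  refine Finset.sum_congr rfl fun α _ => ?_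
  simp only [Fin.consEquiv_apply, Fin.prod_univ_succ, Fin.cons_zero, Fin.cons_succ, Fin.tail]
  exact mul_assoc _ _ _

/-- The soldering form is parallel: differentiating its factors trades Christoffel terms for spin
connection terms. All later coordinate expressions reduce to frame expressions in this way. -/
theorem nab_ofFrame {n : ℕ} (T : (Fin n → Fin 2 × Fin 2) → R) :
    K.nab (K.ofFrame T) = K.ofFrame (K.nabF T) := by
  funext a
  rw [ofFrame_cons]
  set c := a 0
  set b := Fin.tail a
  have hR : ∑ γ, K.S c γ * K.ofFrame (fun α => K.nabF T (Fin.cons γ α)) b =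
      ∑ α : Fin n → Fin 2 × Fin 2, (∏ r, K.S (b r) (α r)) * K.d c (T α)
      + ∑ r, ∑ α : Fin n → Fin 2 × Fin 2, (∏ s, K.S (b s) (α s)) *
          ∑ γ, K.W c (α r) γ * T (Function.update α r γ) := by
    simp only [ofFrame, Finset.mul_sum (s := (Finset.univ : Finset (Fin n → Fin 2 × Fin 2)))]
    rw [Finset.sum_comm, Finset.sum_comm (s := (Finset.univ : Finset (Fin n))),
      ← Finset.sum_add_distrib]
    refine Finset.sum_congr rfl fun α _ => ?_
    simp only [nabF, Fin.cons_zero, Fin.tail_cons]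
    rw [← sum_S_D, ← Finset.mul_sum, ← mul_add]
    simp only [mul_left_comm (K.S c _), ← Finset.mul_sum, mul_add, Finset.sum_add_distrib]
    congr 2
    simp only [Finset.mul_sum]
    rw [Finset.sum_comm]
    refine Finset.sum_congr rfl fun r _ => ?_
    rw [Finset.sum_comm]
    refine Finset.sum_congr rfl fun γ _ => ?_
    rw [← sum_S_ω', Finset.sum_mul]
    exact Finset.sum_congr rfl fun _ _ => by ring
  have hup : ∀ r e (α : Fin n → Fin 2 × Fin 2), ∏ s, K.S (Function.update b r e s) (α s) =
      K.S e (α r) * ∏ s ∈ Finset.univ.erase r, K.S (b s) (α s) := by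
    intro r e α
    rw [← Finset.mul_prod_erase _ _ (Finset.mem_univ r), Function.update_self]
    congr 1
    exact Finset.prod_congr rfl fun s hs => by
      rw [Function.update_of_ne (Finset.ne_of_mem_erase hs)]
  have hdS : ∀ x β, K.d c (K.S x β) - ∑ e, K.Γ c x e * K.S e β = ∑ γ, K.S x γ * K.W c γ β := by
    intro x β
    have := congrFun (congrFun (K.dS c) x) β
    simp only [Matrix.map_apply, Matrix.add_apply, Matrix.mul_apply] at this
    rw [this]
    simp [W]
  have hL : K.nab (K.ofFrame T) a =
      ∑ α : Fin n → Fin 2 × Fin 2, (∏ r, K.S (b r) (α r)) * K.d c (T α)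
      + ∑ r, ∑ α : Fin n → Fin 2 × Fin 2, (∏ s ∈ Finset.univ.erase r, K.S (b s) (α s)) *
          (∑ γ, K.S (b r) γ * K.W c γ (α r)) * T α := by
    have h1 : K.d c (K.ofFrame T b) =
        ∑ α : Fin n → Fin 2 × Fin 2, (∏ r, K.S (b r) (α r)) * K.d c (T α)
        + ∑ r, ∑ α : Fin n → Fin 2 × Fin 2, (∏ s ∈ Finset.univ.erase r, K.S (b s) (α s)) *
          K.d c (K.S (b r) (α r)) * T α := by
      rw [ofFrame, map_sum, Finset.sum_comm (s := (Finset.univ : Finset (Fin n))),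
        ← Finset.sum_add_distrib]
      refine Finset.sum_congr rfl fun α _ => ?_
      rw [Derivation.leibniz, derivation_prod, smul_eq_mul, smul_eq_mul, Finset.mul_sum]
      congr 1
      exact Finset.sum_congr rfl fun r _ => by ring
    have h2 : ∀ r, ∑ e, K.Γ c (b r) e * K.ofFrame T (Function.update b r e) =
        ∑ α : Fin n → Fin 2 × Fin 2, (∏ s ∈ Finset.univ.erase r, K.S (b s) (α s)) *
          (∑ e, K.Γ c (b r) e * K.S e (α r)) * T α := by
      intro r
      simp only [ofFrame, Finset.mul_sum, hup]
      rw [Finset.sum_comm]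
      refine Finset.sum_congr rfl fun α _ => ?_
      rw [Finset.sum_mul]
      exact Finset.sum_congr rfl fun e _ => by ring
    change K.d c (K.ofFrame T b)
      - ∑ r, ∑ e, K.Γ c (b r) e * K.ofFrame T (Function.update b r e) = _
    rw [h1, Finset.sum_congr rfl fun r _ => h2 r]
    rw [add_sub_assoc, ← Finset.sum_sub_distrib]
    congr 1
    refine Finset.sum_congr rfl fun r _ => ?_
    rw [← Finset.sum_sub_distrib]
    refine Finset.sum_congr rfl fun α _ => ?_
    rw [← hdS]; ring
  rw [hL, hR]
  congr 1
  refine Finset.sum_congr rfl fun r _ => ?_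
  simp only [Finset.mul_sum, Finset.sum_mul]
  rw [← Finset.sum_product', ← Finset.sum_product']
  -- The involution exchanging the r-th frame index with the summed index matches the two sums.
  refine Finset.sum_nbij' (fun p => (Function.update p.1 r p.2, p.1 r))
    (fun p => (Function.update p.1 r p.2, p.1 r)) (by simp) (by simp) (by simp) (by simp) ?_
  rintro ⟨α, γ⟩ -
  simp only [Function.update_self, Function.update_idem, Function.update_eq_self]
  rw [← Finset.mul_prod_erase _ _ (Finset.mem_univ r), Function.update_self]
  have : ∏ s ∈ Finset.univ.erase r, K.S (b s) (Function.update α r γ s) =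
      ∏ s ∈ Finset.univ.erase r, K.S (b s) (α s) :=
    Finset.prod_congr rfl fun s hs => by rw [Function.update_of_ne (Finset.ne_of_mem_erase hs)]
  rw [this]; ring

end SpinChart

namespace SpinChart

variable {R : Type*} [CommRing R] [Algebra ℂ R] (K : SpinChart R)

/-- Contraction of a frame index with the soldering form. -/
def low (a : Fin 4) (y : Fin 2 × Fin 2 → R) : R := ∑ α, K.S a α * y α

/-- The metric in the frame. -/
def eta (α β : Fin 2 × Fin 2) : R := ee α.1 β.1 * ee α.2 β.2

/-- The metric in coordinates. -/
def g (a b : Fin 4) : R := ∑ α, ∑ β, eta α β * K.S a α * K.S b β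

/-- The inverse metric in coordinates. -/
def gi (a b : Fin 4) : R := ∑ α, ∑ β, eta α β * K.E α a * K.E β b

/-- The trace of a covariant tensor in coordinates. -/
def tr (z : Fin 4 → Fin 4 → R) : R := ∑ c, ∑ d, K.gi c d * z c d

theorem low_comm (a b : Fin 4) (G : Fin 2 × Fin 2 → Fin 2 × Fin 2 → R) :
    K.low a (fun α => K.low b (fun β => G α β)) = K.low b (fun β => K.low a (fun α => G α β)) := by
  simp only [low, Finset.mul_sum]
  rw [Finset.sum_comm]
  exact Finset.sum_congr rfl fun _ _ => Finset.sum_congr rfl fun _ _ => by ring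

theorem sum_E_low (α : Fin 2 × Fin 2) (y : Fin 2 × Fin 2 → R) : ∑ a, K.E α a * K.low a y = y α := by
  have h : ∀ β, ∑ a, K.E α a * K.S a β = (1 : Matrix (Fin 2 × Fin 2) (Fin 2 × Fin 2) R) α β := by
    intro β; rw [← K.ES]; rfl
  simp only [low, Finset.mul_sum]
  rw [Finset.sum_comm]
  simp only [← mul_assoc, ← Finset.sum_mul, h]
  simp [Matrix.one_apply]

theorem low_sum_E (a : Fin 4) (x : Fin 4 → R) : K.low a (fun α => ∑ b, K.E α b * x b) = x a := by
  have h : ∀ b, ∑ α, K.S a α * K.E α b = (1 : Matrix (Fin 4) (Fin 4) R) a b := by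
    intro b; rw [← K.SE]; rfl
  simp only [low, Finset.mul_sum]
  rw [Finset.sum_comm]
  simp only [← mul_assoc, ← Finset.sum_mul, h]
  simp [Matrix.one_apply]

theorem sum_eta (G : Fin 2 × Fin 2 → Fin 2 × Fin 2 → R) :
    ∑ α, ∑ β, eta α β * G α β = etaTr (fun A A' B B' => G (A, A') (B, B')) := by
  simp [Fintype.sum_prod_type, eta, etaTr, ee]
  ring

/-- The inverse metric is η contracted with two factors E, and each E undoes one soldering form. -/
theorem tr_low_low (G : Fin 2 × Fin 2 → Fin 2 × Fin 2 → R) :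
    K.tr (fun c d => K.low c (fun γ => K.low d (fun δ => G γ δ))) =
      etaTr (fun A A' B B' => G (A, A') (B, B')) := by
  rw [← sum_eta]
  have : ∀ z : Fin 4 → Fin 4 → R, K.tr z =
      ∑ α, ∑ β, eta α β * ∑ a, K.E α a * ∑ b, K.E β b * z a b := by
    intro z
    simp only [tr, gi, Finset.sum_mul, Finset.mul_sum]
    rw [Finset.sum_congr rfl fun c _ => Finset.sum_comm, Finset.sum_comm]
    refine Finset.sum_congr rfl fun α _ => ?_
    rw [Finset.sum_congr rfl fun c _ => Finset.sum_comm, Finset.sum_comm]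
    exact Finset.sum_congr rfl fun _ _ => Finset.sum_congr rfl fun _ _ =>
      Finset.sum_congr rfl fun _ _ => by ring
  rw [this]
  refine Finset.sum_congr rfl fun α _ => Finset.sum_congr rfl fun β _ => ?_
  congr 1
  rw [Finset.sum_congr rfl fun a _ => by
    rw [Finset.sum_congr rfl fun b _ => by rw [low_comm], sum_E_low]]
  rw [sum_E_low]

theorem low_add (a : Fin 4) (y z : Fin 2 × Fin 2 → R) :
    K.low a (fun α => y α + z α) = K.low a y + K.low a z := by
  simp [low, mul_add, Finset.sum_add_distrib]

theorem low_mul (a : Fin 4) (c : R) (y : Fin 2 × Fin 2 → R) :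
    K.low a (fun α => c * y α) = c * K.low a y := by
  simp only [low, Finset.mul_sum]
  exact Finset.sum_congr rfl fun _ _ => by ring

theorem tr_add (y z : Fin 4 → Fin 4 → R) :
    K.tr (fun a b => y a b + z a b) = K.tr y + K.tr z := by
  simp [tr, mul_add, Finset.sum_add_distrib]

theorem g_eq_low (a b : Fin 4) : K.g a b = K.low a (fun α => K.low b (fun β => eta α β)) := by
  simp only [g, low, Finset.mul_sum]
  exact Finset.sum_congr rfl fun _ _ => Finset.sum_congr rfl fun _ _ => by ring

theorem ofFrame1 (f : Fin 2 × Fin 2 → R) (a : Fin 1 → Fin 4) :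
    K.ofFrame (fun α => f (α 0)) a = K.low (a 0) f := by
  rw [ofFrame, ← (Equiv.funUnique (Fin 1) (Fin 2 × Fin 2)).symm.sum_comp]
  simp [low]

theorem ofFrame2 (f : Fin 2 × Fin 2 → Fin 2 × Fin 2 → R) (a : Fin 2 → Fin 4) :
    K.ofFrame (fun α => f (α 0) (α 1)) a =
      K.low (a 0) fun α => K.low (a 1) fun β => f α β := by
  rw [ofFrame_cons]
  refine Finset.sum_congr rfl fun α _ => ?_
  congr 1
  exact K.ofFrame1 (f α) (Fin.tail a)

theorem ofFrame3 (f : Fin 2 × Fin 2 → Fin 2 × Fin 2 → Fin 2 × Fin 2 → R) (a : Fin 3 → Fin 4) :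
    K.ofFrame (fun α => f (α 0) (α 1) (α 2)) a =
      K.low (a 0) fun α => K.low (a 1) fun β => K.low (a 2) fun γ => f α β γ := by
  rw [ofFrame_cons]
  refine Finset.sum_congr rfl fun α _ => ?_
  congr 1
  exact K.ofFrame2 (f α) (Fin.tail a)

theorem ofFrame4 (f : Fin 2 × Fin 2 → Fin 2 × Fin 2 → Fin 2 × Fin 2 → Fin 2 × Fin 2 → R)
    (a : Fin 4 → Fin 4) :
    K.ofFrame (fun α => f (α 0) (α 1) (α 2) (α 3)) a =
      K.low (a 0) fun α => K.low (a 1) fun β => K.low (a 2) fun γ => K.low (a 3) fun δ =>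
        f α β γ δ := by
  rw [ofFrame_cons]
  refine Finset.sum_congr rfl fun α _ => ?_
  congr 1
  exact K.ofFrame3 (f α) (Fin.tail a)

theorem ofFrame5 (f : Fin 2 × Fin 2 → Fin 2 × Fin 2 → Fin 2 × Fin 2 → Fin 2 × Fin 2 →
    Fin 2 × Fin 2 → R) (a : Fin 5 → Fin 4) :
    K.ofFrame (fun α => f (α 0) (α 1) (α 2) (α 3) (α 4)) a =
      K.low (a 0) fun α => K.low (a 1) fun β => K.low (a 2) fun γ => K.low (a 3) fun δ =>
        K.low (a 4) fun ε => f α β γ δ ε := by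
  rw [ofFrame_cons]
  refine Finset.sum_congr rfl fun α _ => ?_
  congr 1
  exact K.ofFrame4 (f α) (Fin.tail a)

theorem ω'_frame (α β : Fin 2 × Fin 2) (y : Fin 2 × Fin 2 → R) : ∑ γ, K.ω' α β γ * y γ =
    ∑ k, K.frame.U α.1 α.2 β.1 k * y (k, β.2) + ∑ k, K.frame.V α.1 α.2 β.2 k * y (β.1, k) :=
  K.ω'_apply α β y

theorem nabF1 (f : Fin 2 × Fin 2 → R) : K.nabF (fun α : Fin 1 → _ => f (α 0)) =
    fun α => K.frame.n11 (fun B B' => f (B, B')) (α 0).1 (α 0).2 (α 1).1 (α 1).2 := by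
  funext α
  simp only [nabF, Fin.sum_univ_one, Fin.tail, Function.update_self, ω'_frame, SpinFrame.n11]
  simp only [Fin.succ_zero_eq_one, frame]
  ring

theorem nabF2 (h : Fin 2 → Fin 2 → Fin 2 → Fin 2 → R) :
    K.nabF (fun α : Fin 2 → _ => h (α 0).1 (α 1).1 (α 0).2 (α 1).2) =
    fun α => K.frame.n22 h (α 0).1 (α 0).2 (α 1).1 (α 2).1 (α 1).2 (α 2).2 := by
  funext α
  simp only [nabF, Fin.sum_univ_two, Fin.tail, Function.update_apply, ω'_frame, SpinFrame.n22]
  simp [frame, Fin.sum_univ_two]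
  ring

theorem nabF3 (h : Fin 2 → Fin 2 → Fin 2 → Fin 2 → R) :
    K.nabF (fun α : Fin 3 → _ =>
      K.frame.n22 h (α 0).1 (α 0).2 (α 1).1 (α 2).1 (α 1).2 (α 2).2) =
    fun α => K.frame.nn22 h (α 0).1 (α 0).2 (α 1).1 (α 1).2 (α 2).1 (α 3).1 (α 2).2 (α 3).2 := by
  funext α
  simp only [nabF, Fin.sum_univ_three, Fin.tail, Function.update_apply, ω'_frame, SpinFrame.nn22]
  simp [frame, Fin.sum_univ_two]
  ring

end SpinChart

/-! ### Divergences of the Weyl-type potential. -/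

namespace SpinFrame

variable {R : Type*} [CommRing R] [Algebra ℂ R] (F : SpinFrame R)

/-- `∇_{EE'} φ_{ABCD}`. -/
def n40 (φ : Fin 2 → Fin 2 → Fin 2 → Fin 2 → R) (E E' A B C D : Fin 2) : R :=
  F.D E E' (φ A B C D) + ∑ k, F.U E E' A k * φ k B C D + ∑ k, F.U E E' B k * φ A k C D
    + ∑ k, F.U E E' C k * φ A B k D + ∑ k, F.U E E' D k * φ A B C k

variable {F}

/-- The bare divergence of SΦ carries the Lee form with coefficient -3. The added 4f makes it +1,
which is conformal weight one for Φ. -/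
theorem Hermitian.contract_n40 {w f : Fin 2 → Fin 2 → R} (hf : F.Hermitian w f) {n : R}
    {s : ℕ → R} (hs : F.WeightedSpinor n s) (Φ : R) (E' B C D : Fin 2) :
    (F.n40 (fun A B C D => s (A + B + C + D) * Φ) 0 E' 1 B C D
        + 4 * f 0 E' * (s (1 + B + C + D) * Φ))
      - (F.n40 (fun A B C D => s (A + B + C + D) * Φ) 1 E' 0 B C D
        + 4 * f 1 E' * (s (0 + B + C + D) * Φ))
      = potential s (F.confGrad n w f Φ) E' B C D := by
  have h1 := hs.weight (B + C + D + 1) (by omega)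
  have h0 := hs.weight (B + C + D) (by omega)
  obtain ⟨f0, f1, f2⟩ := hf
  have t := F.traceU
  simp only [n40, potential, confGrad, weightForm, Fin.sum_univ_two, Derivation.leibniz, hs.const,
    smul_eq_mul]
  linear_combination (norm := skip) - twoP w f 0 E' * Φ * h1 + twoP w f 1 E' * Φ * h0
  clear h1 h0
  fin_cases B <;> fin_cases C <;> fin_cases D <;>
    simp [twoP, f0, f1, f2, t, ee] <;> ring

end SpinFrame

namespace SpinChart

variable {R : Type*} [CommRing R] [Algebra ℂ R] (K : SpinChart R)

/-- The tensor `S_{ABCD} (ε_{A'B'} ε_{C'D'} + ε_{A'C'} ε_{B'D'})` in the frame. -/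
def weylPot (φ : Fin 2 → Fin 2 → Fin 2 → Fin 2 → R) (α β γ δ : Fin 2 × Fin 2) : R :=
  φ α.1 β.1 γ.1 δ.1 * (ee α.2 β.2 * ee γ.2 δ.2 + ee α.2 γ.2 * ee β.2 δ.2)

/-- The primed ε-spinors are parallel because `V` is trace-free, so the derivative falls on φ alone.
-/
theorem nabF_weylPot (φ : Fin 2 → Fin 2 → Fin 2 → Fin 2 → R) :
    K.nabF (fun α : Fin 4 → _ => weylPot φ (α 0) (α 1) (α 2) (α 3)) =
    fun α => weylPot (K.frame.n40 φ (α 0).1 (α 0).2) (α 1) (α 2) (α 3) (α 4) := by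
  funext α
  simp only [nabF, Fin.sum_univ_four, Fin.tail, Function.update_apply, ω'_frame, SpinFrame.n40,
    weylPot, Fin.isValue, Fin.succ_zero_eq_one, Fin.succ_one_eq_two]
  have e3 : (2 : Fin 4).succ = 3 := rfl
  have e4 : (3 : Fin 4).succ = 4 := rfl
  have hee : ∀ A B : Fin 2, ∀ β, K.D β (ee A B : R) = 0 := by
    intro A B β
    fin_cases A <;> fin_cases B <;> simp [ee]
  have t := K.frame.traceV
  have hD : K.D (α 0) = K.frame.D (α 0).1 (α 0).2 := rfl
  simp only [e3, e4, hD, Derivation.leibniz, _root_.map_add]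
  simp only [← hD, hee]
  generalize K.frame.V = V at *
  generalize K.frame.U = U at *
  generalize α 1 = β1, α 2 = β2, α 3 = β3, α 4 = β4
  obtain ⟨b1, c1⟩ := β1
  obtain ⟨b2, c2⟩ := β2
  obtain ⟨b3, c3⟩ := β3
  obtain ⟨b4, c4⟩ := β4
  fin_cases c1 <;> fin_cases c2 <;> fin_cases c3 <;> fin_cases c4 <;>
    simp [ee, Fin.sum_univ_two, t] <;> ring

theorem nabF_pot (X : Fin 2 → Fin 2 → Fin 2 → Fin 2 → R) :
    K.nabF (fun α : Fin 3 → _ => - (ee (α 1).2 (α 2).2 * X (α 0).2 (α 0).1 (α 1).1 (α 2).1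
      + ee (α 0).2 (α 2).2 * X (α 1).2 (α 0).1 (α 1).1 (α 2).1)) =
    fun α => - (ee (α 2).2 (α 3).2 * K.frame.n13 X (α 0).1 (α 0).2 (α 1).2 (α 1).1 (α 2).1 (α 3).1
      + ee (α 1).2 (α 3).2 * K.frame.n13 X (α 0).1 (α 0).2 (α 2).2 (α 1).1 (α 2).1 (α 3).1) := by
  funext α
  simp only [nabF, Fin.sum_univ_three, Fin.tail, Function.update_apply, ω'_frame, SpinFrame.n13,
    Fin.isValue, Fin.succ_zero_eq_one, Fin.succ_one_eq_two]
  have e3 : (2 : Fin 3).succ = 3 := rfl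
  have hee : ∀ A B : Fin 2, ∀ β, K.D β (ee A B : R) = 0 := by
    intro A B β
    fin_cases A <;> fin_cases B <;> simp [ee]
  have t := K.frame.traceV
  have hD : K.D (α 0) = K.frame.D (α 0).1 (α 0).2 := rfl
  simp only [e3, hD, Derivation.leibniz, _root_.map_add, _root_.map_neg]
  simp only [← hD, hee]
  generalize K.frame.V = V at *
  generalize K.frame.U = U at *
  generalize α 1 = β1, α 2 = β2, α 3 = β3
  obtain ⟨b1, c1⟩ := β1
  obtain ⟨b2, c2⟩ := β2
  obtain ⟨b3, c3⟩ := β3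
  fin_cases c1 <;> fin_cases c2 <;> fin_cases c3 <;>
    simp [ee, Fin.sum_univ_two, t] <;> ring

theorem tr_low_low' (G : Fin 2 × Fin 2 → Fin 2 × Fin 2 → R) :
    K.tr (fun c d => K.low d (fun δ => K.low c (fun γ => G γ δ))) =
      etaTr (fun A A' B B' => G (A, A') (B, B')) := by
  rw [← tr_low_low]
  congr 1; funext c d; rw [low_comm]

theorem etaTr_low (a : Fin 4) (G : Fin 2 → Fin 2 → Fin 2 → Fin 2 → Fin 2 × Fin 2 → R) :
    etaTr (fun A A' B B' => K.low a (G A A' B B')) =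
      K.low a (fun β => etaTr fun A A' B B' => G A A' B B' β) := by
  simp only [etaTr, low, ← Finset.sum_add_distrib, ← Finset.sum_sub_distrib, mul_add, mul_sub]

theorem low_mul_low (a : Fin 4) (f : Fin 2 × Fin 2 → R) (y : R) :
    K.low a f * y = K.low a (fun α => f α * y) := by
  simp only [low, Finset.sum_mul, mul_assoc]

theorem low_neg (a : Fin 4) (y : Fin 2 × Fin 2 → R) : - K.low a y = K.low a (fun α => - y α) := by
  simp [low]

/-- `(∇^c + 4 f^c) T_{cabd}`. -/
def metricPot (f : Fin 4 → R) (T : (Fin 4 → Fin 4) → R) (a : Fin 3 → Fin 4) : R :=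
  K.tr fun c e => K.nab T ![e, c, a 0, a 1, a 2] + 4 * f e * T ![c, a 0, a 1, a 2]

/-- `-∇^d P_{abd}`. -/
def metricPert (P : (Fin 3 → Fin 4) → R) (a : Fin 2 → Fin 4) : R :=
  - K.tr fun d e => K.nab P ![e, a 0, a 1, d]

variable {K}

/-- The unprimed contraction is `contract_n40`; the primed one only relabels ε-spinors. The minus
sign cancels the one in the definition of h. -/
theorem metricPot_weylPot {w f : Fin 2 → Fin 2 → R} (hf : K.frame.Hermitian w f) {n : R}
    {s : ℕ → R} (hs : K.frame.WeightedSpinor n s) (Φ : R) :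
    K.metricPot (fun a => K.low a fun α => f α.1 α.2)
      (K.ofFrame fun α => weylPot (fun A B C D => s (A + B + C + D) * Φ) (α 0) (α 1) (α 2) (α 3)) =
    K.ofFrame (fun α : Fin 3 → _ =>
      - (ee (α 1).2 (α 2).2 * SpinFrame.potential s (K.frame.confGrad n w f Φ)
          (α 0).2 (α 0).1 (α 1).1 (α 2).1
        + ee (α 0).2 (α 2).2 * SpinFrame.potential s (K.frame.confGrad n w f Φ)
          (α 1).2 (α 0).1 (α 1).1 (α 2).1)) := by
  funext a
  rw [metricPot, nab_ofFrame, nabF_weylPot]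
  rw [K.ofFrame3 (fun α β γ => - (ee β.2 γ.2 * SpinFrame.potential s (K.frame.confGrad n w f Φ)
          α.2 α.1 β.1 γ.1
        + ee α.2 γ.2 * SpinFrame.potential s (K.frame.confGrad n w f Φ)
          β.2 α.1 β.1 γ.1))]
  simp only [K.ofFrame4 (fun α β γ δ => weylPot (fun A B C D => s (A + B + C + D) * Φ) α β γ δ),
    K.ofFrame5 (fun ε α β γ δ => weylPot (K.frame.n40 (fun A B C D => s (A + B + C + D) * Φ)
      ε.1 ε.2) α β γ δ)]
  simp only [Matrix.cons_val_zero, Matrix.cons_val_one, Matrix.cons_val]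
  have h4 : ∀ e y, 4 * K.low e (fun α => f α.1 α.2) * y =
      K.low e fun α => 4 * f α.1 α.2 * y := fun e y => by rw [← low_mul, low_mul_low]
  simp only [h4]
  simp only [← low_mul, ← low_add, tr_low_low', etaTr_low]
  congr 1; funext β
  congr 1; funext γ
  congr 1; funext δ
  obtain ⟨b, b'⟩ := β
  obtain ⟨c, c'⟩ := γ
  obtain ⟨d, d'⟩ := δ
  have k := fun E' => hf.contract_n40 hs Φ E' b c d
  simp only [etaTr, weylPot]
  simp only [← k]
  clear k hs hf
  fin_cases b' <;> fin_cases c' <;> fin_cases d' <;> simp [ee] <;> ring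

/-- Contracting with the remaining ε-spinors swaps primed indices, and the two terms produce the
symmetrisation over A'B' in `hertz`. -/
theorem metricPert_pot (X : Fin 2 → Fin 2 → Fin 2 → Fin 2 → R) :
    K.metricPert (K.ofFrame (fun α : Fin 3 → _ =>
      - (ee (α 1).2 (α 2).2 * X (α 0).2 (α 0).1 (α 1).1 (α 2).1
        + ee (α 0).2 (α 2).2 * X (α 1).2 (α 0).1 (α 1).1 (α 2).1))) =
    K.ofFrame (fun α : Fin 2 → _ => K.frame.hertz X (α 0).1 (α 1).1 (α 0).2 (α 1).2) := by
  funext a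
  rw [metricPert, nab_ofFrame, nabF_pot,
    K.ofFrame2 (fun α β => K.frame.hertz X α.1 β.1 α.2 β.2)]
  simp only [K.ofFrame4 (fun ε α β γ =>
    - (ee β.2 γ.2 * K.frame.n13 X ε.1 ε.2 α.2 α.1 β.1 γ.1
      + ee α.2 γ.2 * K.frame.n13 X ε.1 ε.2 β.2 α.1 β.1 γ.1))]
  simp only [Matrix.cons_val_zero, Matrix.cons_val_one, Matrix.cons_val]
  have e : ∀ d ε, (K.low ε fun α => K.low (a 0) fun β => K.low (a 1) fun γ => K.low d fun δ =>
      - (ee γ.2 δ.2 * K.frame.n13 X α.1 α.2 β.2 β.1 γ.1 δ.1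
        + ee β.2 δ.2 * K.frame.n13 X α.1 α.2 γ.2 β.1 γ.1 δ.1)) = K.low ε fun α => K.low d fun δ =>
      K.low (a 0) fun β => K.low (a 1) fun γ =>
      - (ee γ.2 δ.2 * K.frame.n13 X α.1 α.2 β.2 β.1 γ.1 δ.1
        + ee β.2 δ.2 * K.frame.n13 X α.1 α.2 γ.2 β.1 γ.1 δ.1) := by
    intro d ε
    congr 1; funext α
    rw [K.low_comm d]
    congr 1; funext β
    rw [K.low_comm d]
  simp only [e, tr_low_low', etaTr_low, low_neg]
  congr 1; funext β
  congr 1; funext γ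
  obtain ⟨b, b'⟩ := β
  obtain ⟨c, c'⟩ := γ
  simp only [etaTr, SpinFrame.hertz]
  fin_cases b' <;> fin_cases c' <;> simp [ee] <;> ring

end SpinChart

/-! ### The linearised Einstein and Teukolsky operators in the frame. -/

namespace SpinChart

variable {R : Type*} [CommRing R] [Algebra ℂ R] (K : SpinChart R)

/-- The trace of a covariant two-tensor. -/
def trT (h : (Fin 2 → Fin 4) → R) (_ : Fin 0 → Fin 4) : R := K.tr fun a b => h ![a, b]

/-- Twice the linearised Einstein operator. -/
def linEin (lam : R) (h : (Fin 2 → Fin 4) → R) (a b : Fin 4) : R :=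
  - K.tr (fun c d => K.nab (K.nab h) ![c, d, a, b])
  - K.nab (K.nab (K.trT h)) ![a, b]
  + K.tr (fun c d => K.nab (K.nab h) ![d, a, b, c] + K.nab (K.nab h) ![d, b, a, c])
  - K.g a b * (K.tr (fun c c' => K.tr fun d d' => K.nab (K.nab h) ![c', d', c, d])
      - K.tr (fun c d => K.nab (K.nab (K.trT h)) ![c, d]))
  + 2 * lam * h ![a, b]

/-- The Teukolsky operator for conformal weight one, with the total connection form `c`. -/
def teukolsky (f c : Fin 4 → R) (χ : R) : R :=
  K.tr fun a b => K.nab (fun a : Fin 1 → Fin 4 => K.d (a 0) χ + c (a 0) * χ) ![a, b]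
    + c a * (K.d b χ + c b * χ)
    - (f a * (K.d b χ + c b * χ) + f b * (K.d a χ + c a * χ)
        - K.g a b * K.tr fun c' d' => f d' * (K.d c' χ + c c' * χ))

theorem trT_ofFrame {h : Fin 2 → Fin 2 → Fin 2 → Fin 2 → R} (hh : SpinFrame.Symm22 h) :
    K.trT (K.ofFrame fun α => h (α 0).1 (α 1).1 (α 0).2 (α 1).2) = 0 := by
  funext _
  simp only [trT, K.ofFrame2 (fun α β => h α.1 β.1 α.2 β.2)]
  simp only [Matrix.cons_val_zero, Matrix.cons_val_one, tr_low_low]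
  have h2 := hh.right
  simp only [etaTr, Pi.zero_apply]
  linear_combination h2 0 1 0 1 + h2 1 0 1 0

theorem nab_zero {n : ℕ} : K.nab (0 : (Fin n → Fin 4) → R) = 0 := by
  funext a
  simp [nab]

theorem low_low_symm {h : Fin 2 → Fin 2 → Fin 2 → Fin 2 → R} (hh : SpinFrame.Symm22 h)
    (a b : Fin 4) : K.ofFrame (fun α : Fin 2 → _ => h (α 0).1 (α 1).1 (α 0).2 (α 1).2) ![a, b] =
      K.ofFrame (fun α : Fin 2 → _ => h (α 0).1 (α 1).1 (α 0).2 (α 1).2) ![b, a] := by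
  simp only [K.ofFrame2 (fun α β => h α.1 β.1 α.2 β.2)]
  simp only [Matrix.cons_val_zero, Matrix.cons_val_one]
  rw [K.low_comm]
  congr 1; funext β
  congr 1; funext α
  rw [hh.left, hh.right]

theorem low_sub (a : Fin 4) (y z : Fin 2 × Fin 2 → R) :
    K.low a y - K.low a z = K.low a (fun α => y α - z α) := by
  simp [low, mul_sub, Finset.sum_sub_distrib]

/-- The trace of h vanishes, so its second derivatives drop out; the rest is contracted term by term
after the traced indices are moved next to each other. -/
theorem linEin_ofFrame {h : Fin 2 → Fin 2 → Fin 2 → Fin 2 → R} (hh : SpinFrame.Symm22 h) (l : R)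
    (a b : Fin 4) :
    K.linEin (-6 * l) (K.ofFrame fun α => h (α 0).1 (α 1).1 (α 0).2 (α 1).2) a b =
      K.low a fun α => K.low b fun β => K.frame.ein l h α.1 α.2 β.1 β.2 := by
  have hn : K.nab (K.nab (K.ofFrame fun α : Fin 2 → _ => h (α 0).1 (α 1).1 (α 0).2 (α 1).2)) =
      K.ofFrame fun α => K.frame.nn22 h (α 0).1 (α 0).2 (α 1).1 (α 1).2 (α 2).1 (α 3).1 (α 2).2
        (α 3).2 := by
    rw [nab_ofFrame, nabF2, nab_ofFrame, nabF3]
  have hn' : ∀ c d e f : Fin 4, K.nab (K.nab (K.ofFrame fun α : Fin 2 → _ =>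
      h (α 0).1 (α 1).1 (α 0).2 (α 1).2)) ![c, d, e, f] =
      K.low c fun γ => K.low d fun δ => K.low e fun α => K.low f fun β =>
        K.frame.nn22 h γ.1 γ.2 δ.1 δ.2 α.1 β.1 α.2 β.2 := by
    intro c d e f
    rw [hn, K.ofFrame4 (fun γ δ α β => K.frame.nn22 h γ.1 γ.2 δ.1 δ.2 α.1 β.1 α.2 β.2)]
    rfl
  have t1 : K.tr (fun c d => K.nab (K.nab (K.ofFrame fun α : Fin 2 → _ =>
      h (α 0).1 (α 1).1 (α 0).2 (α 1).2)) ![c, d, a, b]) =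
      K.low a fun α => K.low b fun β =>
        etaTr fun C C' D D' => K.frame.nn22 h C C' D D' α.1 β.1 α.2 β.2 := by
    simp only [hn', tr_low_low, etaTr_low]
  have t2 : ∀ a b, K.tr (fun c d => K.nab (K.nab (K.ofFrame fun α : Fin 2 → _ =>
      h (α 0).1 (α 1).1 (α 0).2 (α 1).2)) ![d, a, b, c]) =
      K.low a fun α => K.low b fun β =>
        etaTr fun C C' D D' => K.frame.nn22 h D D' α.1 α.2 β.1 C β.2 C' := by
    intro a b
    have e : ∀ (c d : Fin 4) (G : Fin 2 × Fin 2 → Fin 2 × Fin 2 → Fin 2 × Fin 2 → Fin 2 × Fin 2 → R),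
        K.low d (fun δ => K.low a fun α => K.low b fun β => K.low c fun γ => G δ α β γ) =
        K.low d (fun δ => K.low c fun γ => K.low a fun α => K.low b fun β => G δ α β γ) := by
      intro c d G
      congr 1; funext δ
      rw [K.low_comm c]
      congr 1; funext α
      rw [K.low_comm c]
    simp only [hn']
    rw [show (fun c d => _) = _ from funext fun c => funext fun d => e c d _, tr_low_low']
    simp only [etaTr_low]
  have t3 : K.tr (fun c c' => K.tr fun d d' => K.nab (K.nab (K.ofFrame fun α : Fin 2 → _ =>
      h (α 0).1 (α 1).1 (α 0).2 (α 1).2)) ![c', d', c, d]) =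
      etaTr (fun C C' E E' => etaTr (fun D D' G G' => K.frame.nn22 h E E' G G' C D C' D')) := by
    have e : ∀ (c d c' d' : Fin 4)
        (G : Fin 2 × Fin 2 → Fin 2 × Fin 2 → Fin 2 × Fin 2 → Fin 2 × Fin 2 → R),
        K.low c' (fun γ' => K.low d' fun δ' => K.low c fun γ => K.low d fun δ => G γ' δ' γ δ) =
        K.low d' (fun δ' => K.low d fun δ => K.low c' fun γ' => K.low c fun γ => G γ' δ' γ δ) := by
      intro c d c' d' G
      rw [K.low_comm c']
      congr 1; funext δ'
      rw [K.low_comm d]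
      congr 1; funext γ'
      rw [K.low_comm d]
    simp only [hn']
    rw [show (fun c c' => K.tr fun d d' => _) = _ from funext fun c => funext fun c' =>
      congrArg K.tr (funext fun d => funext fun d' => e c d c' d' _)]
    simp only [tr_low_low', etaTr_low]
  rw [linEin, trT_ofFrame K hh, nab_zero, nab_zero, t1, tr_add, t2, t2, t3]
  rw [K.ofFrame2 (fun α β => h α.1 β.1 α.2 β.2), g_eq_low]
  simp only [Matrix.cons_val_zero, Matrix.cons_val_one, Pi.zero_apply]
  have z : K.tr (fun _ _ => (0 : R)) = 0 := by simp [tr]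
  rw [z, sub_zero, sub_zero, K.low_comm b a]
  simp only [low_mul_low, low_neg, ← low_mul, ← low_add, low_sub]
  congr 1; funext α
  congr 1; funext β
  simp only [SpinFrame.ein, eta]
  ring

/-- Tracing the Lee form correction of 𝒞 on covectors gives -2 f·v + 4 f·v, since g has trace four.
This is the extra 2f in `teuk`. -/
theorem teukolsky_eq_teuk {w f : Fin 2 → Fin 2 → R} {n : R} (χ : R) :
    K.teukolsky (fun a => K.low a fun α => f α.1 α.2)
      (fun a => K.low a fun α => SpinFrame.weightForm n w f α.1 α.2) χ = K.frame.teuk n w f χ := by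
  have hv : ∀ a, K.d a χ + K.low a (fun α => SpinFrame.weightForm n w f α.1 α.2) * χ =
      K.low a fun α => K.frame.confGrad n w f χ α.1 α.2 := by
    intro a
    rw [← sum_S_D, low_mul_low]
    exact (K.low_add a _ _).symm
  have hn : (fun a : Fin 1 → Fin 4 => K.low (a 0) fun α => K.frame.confGrad n w f χ α.1 α.2) =
      K.ofFrame fun α => K.frame.confGrad n w f χ (α 0).1 (α 0).2 := by
    funext a
    rw [K.ofFrame1 fun α => K.frame.confGrad n w f χ α.1 α.2]
  simp only [teukolsky, hv]
  rw [hn, nab_ofFrame, K.nabF1 fun α => K.frame.confGrad n w f χ α.1 α.2]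
  simp only [K.ofFrame2 fun α β => K.frame.n11 (K.frame.confGrad n w f χ) α.1 α.2 β.1 β.2]
  simp only [Matrix.cons_val_zero, Matrix.cons_val_one]
  rw [SpinFrame.teuk]
  generalize SpinFrame.weightForm n w f = c, K.frame.confGrad n w f χ = v
  have e1 : ∀ (x y : Fin 2 → Fin 2 → R) a b, K.low a (fun α => x α.1 α.2) * K.low b (fun β => y β.1 β.2) =
      K.low a fun α => K.low b fun β => x α.1 α.2 * y β.1 β.2 := by
    intro x y a b
    rw [low_mul_low]; simp only [← low_mul]
  have e2 : K.tr (fun c d => K.low d (fun α => f α.1 α.2) * K.low c fun α => v α.1 α.2) =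
      etaTr (fun A A' B B' => f A A' * v B B') := by
    simp only [e1, tr_low_low']
    simp only [etaTr]; ring
  have e3 : ∀ a b, K.low b (fun α => f α.1 α.2) * K.low a (fun α => v α.1 α.2) =
      K.low a (fun α => K.low b fun β => f β.1 β.2 * v α.1 α.2) := by
    intro a b
    rw [e1, low_comm]
  rw [e2, show (fun a b => _) = (fun a b => K.low a fun α => K.low b fun β =>
      K.frame.n11 v α.1 α.2 β.1 β.2 + c α.1 α.2 * v β.1 β.2
      - (f α.1 α.2 * v β.1 β.2 + f β.1 β.2 * v α.1 α.2
        - eta α β * etaTr (fun A A' B B' => f A A' * v B B'))) from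
    funext fun a => funext fun b => by
      rw [e3 a b, e1, e1, g_eq_low]
      simp only [low_mul_low, low_sub, ← K.low_add], tr_low_low]
  simp [etaTr, eta, ee]
  ring

end SpinChart

/-! ### The Levi-Civita and spin connections of a null coframe. -/

/-- The metric in the frame, as a matrix. -/
def MetricChart.η (R : Type*) [CommRing R] : Matrix (Fin 2 × Fin 2) (Fin 2 × Fin 2) R :=
  Matrix.of SpinChart.eta

/-- A coordinate chart over a commutative algebra of functions, with an orthonormal (null) coframe
`S_a{}^{AA'}` and the inverse `gi` of the metric `g_{ab} = ε_{AB} ε_{A'B'} S_a{}^{AA'} S_b{}^{BB'}`. -/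
structure MetricChart (R : Type*) [CommRing R] [Algebra ℂ R] where
  d : Fin 4 → Derivation ℂ R R
  comm : ∀ a b f, d a (d b f) = d b (d a f)
  S : Matrix (Fin 4) (Fin 2 × Fin 2) R
  gi : Matrix (Fin 4) (Fin 4) R
  mul_gi : S * MetricChart.η R * S.transpose * gi = 1

namespace MetricChart

variable {R : Type*} [CommRing R] [Algebra ℂ R] (K : MetricChart R)

open scoped Kronecker
open SpinChart (eta)

theorem η_transpose : (η R).transpose = η R := by
  ext ⟨a, b⟩ ⟨c, d⟩
  fin_cases a <;> fin_cases b <;> fin_cases c <;> fin_cases d <;> simp [η, eta, ee]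

theorem η_mul_η : (η R) * η R = 1 := by
  ext ⟨a, b⟩ ⟨c, d⟩
  fin_cases a <;> fin_cases b <;> fin_cases c <;> fin_cases d <;>
    simp [η, eta, ee, Matrix.mul_apply, Fintype.sum_prod_type, Matrix.one_apply]

theorem η_map (D : Derivation ℂ R R) : (η R).map D = 0 := by
  ext ⟨a, b⟩ ⟨c, d⟩
  fin_cases a <;> fin_cases b <;> fin_cases c <;> fin_cases d <;> simp [η, eta, ee]

/-- The metric. -/
def g : Matrix (Fin 4) (Fin 4) R := K.S * η R * K.S.transpose

theorem g_mul_gi : K.g * K.gi = 1 := K.mul_gi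

theorem gi_mul_g : K.gi * K.g = 1 := mul_eq_one_comm.1 K.g_mul_gi

theorem g_transpose : K.g.transpose = K.g := by
  simp only [g, Matrix.transpose_mul, Matrix.transpose_transpose, η_transpose, Matrix.mul_assoc]

theorem gi_transpose : K.gi.transpose = K.gi := by
  have h : K.gi.transpose * K.g = 1 := by
    rw [← K.g_transpose, ← Matrix.transpose_mul, K.g_mul_gi, Matrix.transpose_one]
  calc K.gi.transpose = K.gi.transpose * (K.g * K.gi) := by rw [K.g_mul_gi, Matrix.mul_one]
    _ = K.gi := by rw [← Matrix.mul_assoc, h, Matrix.one_mul]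

/-- The inverse soldering form. -/
def E : Matrix (Fin 2 × Fin 2) (Fin 4) R := η R * K.S.transpose * K.gi

theorem SE : K.S * K.E = 1 := by
  rw [E, ← Matrix.mul_assoc, ← Matrix.mul_assoc]; exact K.mul_gi

/-- Both index types have four elements, so a one-sided inverse is two-sided. -/
theorem ES : K.E * K.S = 1 :=
  (Matrix.mul_eq_one_comm_of_equiv (finProdFinEquiv (m := 2) (n := 2)).symm).1 K.SE

/-- One half. -/
noncomputable def half : R := algebraMap ℂ R (1 / 2)

theorem two_mul_half : 2 * (half : R) = 1 := by
  rw [half, ← map_ofNat (algebraMap ℂ R), ← map_mul]; norm_num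

noncomputable section

/-- The Christoffel symbols `Γ a b c = Γ^c_{ab}`. -/
def Γ (a : Fin 4) : Matrix (Fin 4) (Fin 4) R := Matrix.of fun b c =>
  half * ∑ e, K.gi c e * (K.d a (K.g b e) + K.d b (K.g a e) - K.d e (K.g a b))

theorem g_symm (a b : Fin 4) : K.g a b = K.g b a := by
  conv_lhs => rw [← K.g_transpose]
  rfl

theorem Γ_symm (a b c : Fin 4) : K.Γ a b c = K.Γ b a c := by
  simp only [Γ, Matrix.of_apply, K.g_symm b a]
  congr 1
  exact Finset.sum_congr rfl fun e _ => by ring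

theorem Γ_mul_g (a b e : Fin 4) : (K.Γ a * K.g) b e =
    half * (K.d a (K.g b e) + K.d b (K.g a e) - K.d e (K.g a b)) := by
  have h : ∀ x : Fin 4 → R, ∑ c, (∑ k, K.gi c k * x k) * K.g c e = x e := by
    intro x
    simp only [Finset.sum_mul]
    rw [Finset.sum_comm]
    have : ∀ k, ∑ c, K.gi c k * x k * K.g c e = x k * (1 : Matrix (Fin 4) (Fin 4) R) k e := by
      intro k
      rw [← K.gi_mul_g, Matrix.mul_apply, Finset.mul_sum]
      refine Finset.sum_congr rfl fun c _ => ?_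
      have := congrFun (congrFun K.gi_transpose k) c
      rw [Matrix.transpose_apply] at this
      rw [this]; ring
    simp [this, Matrix.one_apply]
  simp only [Matrix.mul_apply, Γ, Matrix.of_apply, mul_assoc, ← Finset.mul_sum]
  rw [h]

/-- The Levi-Civita connection is metric. -/
theorem dg (a : Fin 4) : K.g.map (K.d a) = K.Γ a * K.g + K.g * (K.Γ a).transpose := by
  have h : K.g * (K.Γ a).transpose = (K.Γ a * K.g).transpose := by
    rw [Matrix.transpose_mul, K.g_transpose]
  rw [h]
  ext b e
  rw [Matrix.add_apply, Matrix.transpose_apply, Γ_mul_g, Γ_mul_g, K.g_symm e b, Matrix.map_apply]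
  linear_combination - K.d a (K.g b e) * two_mul_half (R := R)

/-- The connection on pairs of spinor indices. -/
def m (a : Fin 4) : Matrix (Fin 2 × Fin 2) (Fin 2 × Fin 2) R :=
  K.E * (K.S.map (K.d a) - K.Γ a * K.S)

theorem dS_eq (a : Fin 4) : K.S.map (K.d a) = K.Γ a * K.S + K.S * K.m a := by
  rw [m, ← Matrix.mul_assoc, K.SE, Matrix.one_mul]; abel

/-- Metricity of the Christoffel symbols, transported to the frame through g = S η Sᵀ with η
constant. -/
theorem m_antisymm (a : Fin 4) : K.m a * η R + (K.m a * η R).transpose = 0 := by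
  have h := K.dg a
  have hm : K.g.map (K.d a) = K.S.map (K.d a) * η R * K.S.transpose
      + K.S * η R * (K.S.map (K.d a)).transpose := by
    rw [g, SpinChart.map_mul, SpinChart.map_mul, η_map, Matrix.mul_zero, add_zero]
    rfl
  have key : K.S * (K.m a * η R + (K.m a * η R).transpose) * K.S.transpose = 0 := by
    rw [hm, dS_eq, g] at h
    simp only [Matrix.transpose_add, Matrix.transpose_mul, η_transpose, Matrix.add_mul,
      Matrix.mul_add, Matrix.mul_assoc] at h ⊢
    linear_combination (norm := abel) h
  have e : K.S.transpose * K.E.transpose = 1 := by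
    rw [← Matrix.transpose_mul, K.ES, Matrix.transpose_one]
  calc _ = K.E * (K.S * (K.m a * η R + (K.m a * η R).transpose) * K.S.transpose) * K.E.transpose := by
        simp only [Matrix.mul_assoc, e, Matrix.mul_one]
        rw [← Matrix.mul_assoc, K.ES, Matrix.one_mul]
    _ = 0 := by rw [key, Matrix.mul_zero, Matrix.zero_mul]

/-- The connection on lower unprimed spinors. -/
def u (a : Fin 4) : Matrix (Fin 2) (Fin 2) R := Matrix.of fun A C =>
  half * ∑ A', K.m a (A, A') (C, A')

/-- The connection on lower primed spinors. -/
def v (a : Fin 4) : Matrix (Fin 2) (Fin 2) R := Matrix.of fun A' C' =>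
  half * ∑ A, K.m a (A, A') (A, C')

/-- The splitting so(4,ℂ) = sl(2,ℂ) ⊕ sl(2,ℂ): an η-antisymmetric matrix on pairs of spinor indices
is recovered from its two halved partial traces. -/
theorem m_eq (a : Fin 4) : K.m a = K.u a ⊗ₖ 1 + 1 ⊗ₖ K.v a := by
  have h : ∀ α β, (K.m a * η R) α β + (K.m a * η R) β α = 0 := fun α β =>
    congrFun (congrFun (K.m_antisymm a) α) β
  have h2 := two_mul_half (R := R)
  simp only [Prod.forall, Fin.forall_fin_two, Matrix.mul_apply, η, eta, ee, Fintype.sum_prod_type,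
    Fin.sum_univ_two, Matrix.of_apply] at h
  simp at h
  have z : ∀ x : R, x + x = 0 → x = 0 := fun x hx => by linear_combination half * hx - x * h2
  have z' : ∀ x : R, -x + -x = 0 → x = 0 := fun x hx => by linear_combination -half * hx - x * h2
  have hz := h
  -- Diagonal entries of the antisymmetric matrix m η: the entries of m that flip both spinor
  -- indices vanish.
  obtain ⟨⟨⟨⟨a1, -⟩, -, -⟩, ⟨-, a2⟩, -, -⟩, ⟨⟨-, -⟩, a3, -⟩, ⟨-, -⟩, -, a4⟩ := hz
  replace a1 := z _ a1
  replace a2 := z' _ a2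
  replace a3 := z' _ a3
  replace a4 := z _ a4
  ext ⟨A, A'⟩ ⟨C, C'⟩
  simp only [Matrix.add_apply, Matrix.kroneckerMap_apply, u, v, Matrix.of_apply, Fin.sum_univ_two]
  fin_cases A <;> fin_cases A' <;> fin_cases C <;> fin_cases C' <;> simp [Matrix.one_apply] <;>
    grind

theorem trace_u (a : Fin 4) : K.u a 1 1 = - K.u a 0 0 := by
  have h : ∀ α β, (K.m a * η R) α β + (K.m a * η R) β α = 0 := fun α β =>
    congrFun (congrFun (K.m_antisymm a) α) β
  have h2 := two_mul_half (R := R)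
  simp only [Prod.forall, Fin.forall_fin_two, Matrix.mul_apply, η, eta, ee, Fintype.sum_prod_type,
    Fin.sum_univ_two, Matrix.of_apply] at h
  simp at h
  simp only [u, Matrix.of_apply, Fin.sum_univ_two]
  grind

theorem trace_v (a : Fin 4) : K.v a 1 1 = - K.v a 0 0 := by
  have h : ∀ α β, (K.m a * η R) α β + (K.m a * η R) β α = 0 := fun α β =>
    congrFun (congrFun (K.m_antisymm a) α) β
  have h2 := two_mul_half (R := R)
  simp only [Prod.forall, Fin.forall_fin_two, Matrix.mul_apply, η, eta, ee, Fintype.sum_prod_type,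
    Fin.sum_univ_two, Matrix.of_apply] at h
  simp at h
  simp only [v, Matrix.of_apply, Fin.sum_univ_two]
  grind

/-- The spin chart of a metric with a null coframe. -/
def spin : SpinChart R where
  d := K.d
  comm := K.comm
  Γ := K.Γ
  Γ_symm := K.Γ_symm
  S := K.S
  E := K.E
  SE := K.SE
  ES := K.ES
  u := K.u
  v := K.v
  trace_u := K.trace_u
  trace_v := K.trace_v
  dS a := by rw [← m_eq]; exact K.dS_eq a

theorem spin_g (a b : Fin 4) : K.spin.g a b = K.g a b := by
  simp only [SpinChart.g, g, η, Matrix.mul_apply, Matrix.of_apply, Matrix.transpose_apply,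
    Finset.sum_mul]
  rw [Finset.sum_comm]
  exact Finset.sum_congr rfl fun _ _ => Finset.sum_congr rfl fun _ _ => by
    change _ * K.S _ _ * K.S _ _ = _; ring

theorem spin_gi (a b : Fin 4) : K.spin.gi a b = K.gi a b := by
  have h : K.E.transpose * η R * K.E = K.gi := by
    rw [E]
    simp only [Matrix.transpose_mul, Matrix.transpose_transpose, η_transpose]
    calc _ = K.gi.transpose * (K.S * (η R * η R) * η R * K.S.transpose) * K.gi := by
          simp only [Matrix.mul_assoc]
      _ = K.gi.transpose * K.g * K.gi := by rw [η_mul_η, Matrix.mul_one]; rfl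
      _ = K.gi := by rw [gi_transpose, gi_mul_g, Matrix.one_mul]
  rw [← h]
  simp only [SpinChart.gi, η, Matrix.mul_apply, Matrix.of_apply, Matrix.transpose_apply,
    Finset.sum_mul]
  rw [Finset.sum_comm]
  exact Finset.sum_congr rfl fun _ _ => Finset.sum_congr rfl fun _ _ => by
    change _ * K.E _ _ * K.E _ _ = _; ring

end

end MetricChart

/-! ### The complex structure, its Nijenhuis tensor and its Lee form. -/

namespace SpinChart

variable {R : Type*} [CommRing R] [Algebra ℂ R] (K : SpinChart R)

/-- The eigenvalues of the complex structure on the coframe. -/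
def jEig (R : Type*) [CommRing R] [Algebra ℂ R] (α : Fin 2 × Fin 2) : R :=
  algebraMap ℂ R (![-Complex.I, Complex.I] α.1)

theorem jEig_map (D : Derivation ℂ R R) : (Matrix.diagonal (jEig R)).map D = 0 := by
  ext α β
  by_cases h : α = β
  · subst h; simp [jEig]
  · simp [Matrix.diagonal_apply_ne _ h]

/-- The complex structure `J^b_a` as a matrix in `a`, `b`. -/
def cplx : Matrix (Fin 4) (Fin 4) R := K.S * Matrix.diagonal (jEig R) * K.E

/-- `∇_a J^c_b` as a matrix in `b`, `c`. -/
def dcplx (a : Fin 4) : Matrix (Fin 4) (Fin 4) R :=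
  K.cplx.map (K.d a) - K.Γ a * K.cplx + K.cplx * K.Γ a

/-- J has constant eigenvalues on a coframe whose derivative is W, so ∇J is the commutator of W with
the eigenvalue matrix. -/
theorem dcplx_eq (a : Fin 4) : K.dcplx a =
    K.S * (K.W a * Matrix.diagonal (jEig R) - Matrix.diagonal (jEig R) * K.W a) * K.E := by
  have hS : K.S.map (K.d a) = K.Γ a * K.S + K.S * K.W a := K.dS a
  rw [dcplx, cplx, map_mul, map_mul, jEig_map, dE, hS]
  simp only [Matrix.mul_add, Matrix.add_mul, Matrix.mul_sub, Matrix.sub_mul, Matrix.mul_assoc,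
    Matrix.mul_neg, Matrix.mul_zero, add_zero]
  abel

theorem E_mul_cplx : K.E * K.cplx = Matrix.diagonal (jEig R) * K.E := by
  rw [cplx, ← Matrix.mul_assoc, ← Matrix.mul_assoc, K.ES, Matrix.one_mul]

theorem cplx_mul_S : K.cplx * K.S = K.S * Matrix.diagonal (jEig R) := by
  rw [cplx, Matrix.mul_assoc, K.ES, Matrix.mul_one]

theorem E_mul_dcplx_mul_S (a : Fin 4) (α β : Fin 2 × Fin 2) :
    (K.E * K.dcplx a * K.S) α β = K.W a α β * (jEig R β - jEig R α) := by
  rw [dcplx_eq, Matrix.mul_assoc, Matrix.mul_assoc, K.ES, Matrix.mul_one, ← Matrix.mul_assoc, K.ES,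
    Matrix.one_mul, Matrix.sub_apply, Matrix.mul_diagonal, Matrix.diagonal_mul]
  ring

/-- The Nijenhuis tensor `N^c_{ab}`, from its first half. -/
def nijHalf (a b c : Fin 4) : R :=
  ∑ e, (K.cplx a e * K.dcplx e b c - K.dcplx a b e * K.cplx e c)

/-- Contraction with J multiplies by eigenvalues, and ∇J contributes a connection coefficient times
an eigenvalue difference. -/
theorem nijHalf_frame (α β γ : Fin 2 × Fin 2) :
    ∑ a, ∑ b, K.E α a * K.E β b * ∑ c, K.nijHalf a b c * K.S c γ =
      (jEig R α - jEig R γ) * (jEig R γ - jEig R β) * K.ω' α β γ := by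
  have h1 : ∀ b c, ∑ a, K.E α a * K.nijHalf a b c =
      (jEig R α • (∑ e, K.E α e • K.dcplx e) - (∑ a, K.E α a • K.dcplx a) * K.cplx) b c := by
    intro b c
    have h : ∀ e, ∑ a, K.E α a * K.cplx a e = jEig R α * K.E α e := by
      intro e
      have := congrFun (congrFun K.E_mul_cplx α) e
      rwa [Matrix.mul_apply, Matrix.diagonal_mul] at this
    simp only [nijHalf, Finset.sum_sub_distrib, mul_sub, Matrix.sub_apply, Matrix.smul_apply,
      Matrix.sum_apply, Matrix.mul_apply, smul_eq_mul, Finset.mul_sum, Finset.sum_mul]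
    congr 1
    · rw [Finset.sum_comm]
      refine Finset.sum_congr rfl fun e _ => ?_
      rw [← mul_assoc, ← h, Finset.sum_mul]
      exact Finset.sum_congr rfl fun _ _ => by ring
    · exact Finset.sum_congr rfl fun _ _ => Finset.sum_congr rfl fun _ _ => by ring
  have h2 : ∑ a, ∑ b, K.E α a * K.E β b * ∑ c, K.nijHalf a b c * K.S c γ =
      (K.E * (jEig R α • (∑ e, K.E α e • K.dcplx e) - (∑ a, K.E α a • K.dcplx a) * K.cplx)
        * K.S) β γ := by
    generalize jEig R α • (∑ e, K.E α e • K.dcplx e) - (∑ a, K.E α a • K.dcplx a) * K.cplx = M at h1 ⊢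
    have h : (K.E * M * K.S) β γ = ∑ c, ∑ b, ∑ a, K.E β b * (K.E α a * K.nijHalf a b c) * K.S c γ := by
      simp only [Matrix.mul_apply, ← h1, Finset.sum_mul, Finset.mul_sum]
    rw [h]
    simp only [Finset.mul_sum]
    rw [Finset.sum_congr rfl fun a _ => Finset.sum_comm, Finset.sum_comm]
    refine Finset.sum_congr rfl fun c _ => ?_
    rw [Finset.sum_comm]
    exact Finset.sum_congr rfl fun _ _ => Finset.sum_congr rfl fun _ _ => by ring
  have h3 : (K.E * (∑ a, K.E α a • K.dcplx a) * K.S) β γ =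
      K.ω' α β γ * (jEig R γ - jEig R β) := by
    simp only [Matrix.mul_sum, Matrix.sum_mul, Matrix.mul_smul, Matrix.smul_mul, Matrix.sum_apply,
      Matrix.smul_apply, E_mul_dcplx_mul_S, ω', Finset.sum_mul, smul_eq_mul, mul_assoc]
  rw [h2, Matrix.mul_sub, Matrix.sub_mul, Matrix.mul_assoc K.E (_ * _), Matrix.mul_assoc _ K.cplx,
    cplx_mul_S, Matrix.mul_smul, Matrix.smul_mul, Matrix.sub_apply, Matrix.smul_apply, h3,
    ← Matrix.mul_assoc, ← Matrix.mul_assoc, Matrix.mul_diagonal, h3, smul_eq_mul]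
  ring

/-- Consequence of the vanishing of the Nijenhuis tensor in the frame. -/
theorem ω'_symm_of_nijenhuis (h : ∀ a b c, K.nijHalf a b c = K.nijHalf b a c)
    (α β γ : Fin 2 × Fin 2) :
    (jEig R α - jEig R γ) * (jEig R γ - jEig R β) * (K.ω' α β γ - K.ω' β α γ) = 0 := by
  have h1 := K.nijHalf_frame α β γ
  have h2 := K.nijHalf_frame β α γ
  rw [Finset.sum_comm] at h2
  have h3 : ∑ a, ∑ b, K.E α a * K.E β b * ∑ c, K.nijHalf a b c * K.S c γ =
      ∑ y, ∑ x, K.E β x * K.E α y * ∑ c, K.nijHalf x y c * K.S c γ :=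
    Finset.sum_congr rfl fun a _ => Finset.sum_congr rfl fun b _ => by
      rw [mul_comm (K.E α a), Finset.sum_congr rfl fun c _ => by rw [h a b c]]
  linear_combination h3 + h2 - h1

/-- Twice the Lee form. -/
def lee2 (a : Fin 4) : R := - ∑ b, ∑ c, K.cplx c b * K.dcplx b a c

theorem ω'_apply_entry (α β γ : Fin 2 × Fin 2) : K.ω' α β γ =
    (if β.2 = γ.2 then K.frame.U α.1 α.2 β.1 γ.1 else 0)
      + (if β.1 = γ.1 then K.frame.V α.1 α.2 β.2 γ.2 else 0) := by
  have := K.ω'_frame α β (Pi.single γ 1)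
  simp only [Pi.single_apply, mul_ite, mul_one, mul_zero, Finset.sum_ite_eq', Finset.mem_univ,
    if_true] at this
  rw [this]
  obtain ⟨b, b'⟩ := β
  obtain ⟨c, c'⟩ := γ
  simp only [Prod.mk.injEq]
  congr 1
  · by_cases h : b' = c' <;> simp [h]
  · by_cases h : b = c <;> simp [h]

/-- Only γ with eigenvalue opposite to that of β contributes, and there the eigenvalue factor is -2.
-/
theorem lee2_frame (β : Fin 2 × Fin 2) : ∑ a, K.E β a * K.lee2 a =
    - ∑ γ, K.ω' γ β γ * ((jEig R γ - jEig R β) * jEig R γ) := by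
  have h1 : ∀ b, ∑ a, K.E β a * ∑ c, K.cplx c b * K.dcplx b a c =
      ∑ γ, K.E γ b * K.W b β γ * ((jEig R γ - jEig R β) * jEig R γ) := by
    intro b
    have h : (K.E * K.dcplx b * K.cplx) β b =
        ∑ γ, (K.E * K.dcplx b * K.S) β γ * (jEig R γ * K.E γ b) := by
      rw [cplx, ← Matrix.mul_assoc, ← Matrix.mul_assoc, Matrix.mul_apply]
      exact Finset.sum_congr rfl fun γ _ => by rw [Matrix.mul_diagonal]; ring
    simp only [E_mul_dcplx_mul_S] at h
    rw [Matrix.mul_assoc, Matrix.mul_apply] at h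
    simp only [Matrix.mul_apply] at h
    rw [Finset.sum_congr rfl fun a _ => by
      rw [Finset.sum_congr rfl fun c _ => mul_comm (K.cplx c b) _], h]
    exact Finset.sum_congr rfl fun γ _ => by ring
  have h2 : ∑ a, K.E β a * K.lee2 a = - ∑ b, ∑ a, K.E β a * ∑ c, K.cplx c b * K.dcplx b a c := by
    rw [Finset.sum_comm, ← Finset.sum_neg_distrib]
    refine Finset.sum_congr rfl fun a _ => ?_
    rw [lee2, mul_neg, Finset.mul_sum]
  rw [h2]
  simp only [h1]
  rw [Finset.sum_comm]
  congr 1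
  refine Finset.sum_congr rfl fun γ _ => ?_
  simp only [ω', Matrix.sum_apply, Matrix.smul_apply, smul_eq_mul, Finset.sum_mul]

/-- A vanishing Nijenhuis tensor makes the principal spinors shear-free. -/
theorem hermitian_of_nijenhuis (h : ∀ a b c, K.nijHalf a b c = K.nijHalf b a c)
    (f : Fin 2 → Fin 2 → R) (hf : ∀ a, K.lee2 a = 2 * K.low a fun α => f α.1 α.2) :
    K.frame.Hermitian (fun A A' => K.frame.U A A' 0 0) f := by
  have hI : (algebraMap ℂ R Complex.I) * algebraMap ℂ R Complex.I = -1 := by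
    rw [← _root_.map_mul, Complex.I_mul_I, map_neg, _root_.map_one]
  have hn := K.ω'_symm_of_nijenhuis h
  have hl : ∀ B B', 2 * f B B' =
      - ∑ γ, K.ω' γ (B, B') γ * ((jEig R γ - jEig R (B, B')) * jEig R γ) := by
    intro B B'
    rw [← lee2_frame]
    simp only [hf]
    rw [Finset.sum_congr rfl fun a _ => mul_left_comm _ _ _, ← Finset.mul_sum, sum_E_low]
  have l0 : ∀ A', f 0 A' = K.frame.U 1 A' 0 1 := by
    intro A'
    have h0 := hl 0 A'
    simp only [ω'_apply_entry, Fintype.sum_prod_type, Fin.sum_univ_two, jEig] at h0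
    have : 2 * (f 0 A' - K.frame.U 1 A' 0 1) = 0 := by
      fin_cases A' <;> simp at h0 ⊢ <;> linear_combination h0 - 2 * K.frame.U 1 _ 0 1 * hI
    exact sub_eq_zero.1 (SpinFrame.ofNat_mul_cancel 2 this)
  have l1 : ∀ A', f 1 A' = K.frame.U 0 A' 1 0 := by
    intro A'
    have h0 := hl 1 A'
    simp only [ω'_apply_entry, Fintype.sum_prod_type, Fin.sum_univ_two, jEig] at h0
    have : 2 * (f 1 A' - K.frame.U 0 A' 1 0) = 0 := by
      fin_cases A' <;> simp at h0 ⊢ <;> linear_combination h0 - 2 * K.frame.U 0 _ 1 0 * hI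
    exact sub_eq_zero.1 (SpinFrame.ofNat_mul_cancel 2 this)
  have n0 : ∀ A', K.frame.U 0 A' 0 1 = 0 := by
    intro A'
    -- The eigenvalue factor is 4. With different primed indices, the coefficient with α and β
    -- exchanged is zero, so the unwanted coefficient is isolated.
    have h0 := hn (0, A') (0, 1 - A') (1, 1 - A')
    simp only [ω'_apply_entry, jEig] at h0
    have : 4 * K.frame.U 0 A' 0 1 = 0 := by
      fin_cases A' <;> simp at h0 ⊢ <;> linear_combination h0 + 4 * K.frame.U 0 _ 0 1 * hI
    exact SpinFrame.ofNat_mul_cancel 4 this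
  have n1 : ∀ A', K.frame.U 1 A' 1 0 = 0 := by
    intro A'
    have h0 := hn (1, A') (1, 1 - A') (0, 1 - A')
    simp only [ω'_apply_entry, jEig] at h0
    have : 4 * K.frame.U 1 A' 1 0 = 0 := by
      fin_cases A' <;> simp at h0 ⊢ <;> linear_combination h0 + 4 * K.frame.U 1 _ 1 0 * hI
    exact SpinFrame.ofNat_mul_cancel 4 this
  refine ⟨fun A A' => rfl, fun A A' => ?_, fun A A' => ?_⟩
  · fin_cases A <;> simp [ee, l0, n0]
  · fin_cases A <;> simp [ee, l1, n1]

end SpinChart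

/-! ### Riemann, Ricci and Weyl tensors in the frame. -/

namespace SpinChart

variable {R : Type*} [CommRing R] [Algebra ℂ R] (K : SpinChart R)

open scoped Kronecker

/-- Contraction of a coordinate index with the inverse soldering form. -/
def up (α : Fin 2 × Fin 2) (x : Fin 4 → R) : R := ∑ a, K.E α a * x a

theorem up_comm (α β : Fin 2 × Fin 2) (x : Fin 4 → Fin 4 → R) :
    K.up α (fun a => K.up β fun b => x a b) = K.up β fun b => K.up α fun a => x a b := by
  simp only [up, Finset.mul_sum]
  rw [Finset.sum_comm]
  exact Finset.sum_congr rfl fun _ _ => Finset.sum_congr rfl fun _ _ => by ring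

theorem up_add (α : Fin 2 × Fin 2) (x y : Fin 4 → R) :
    K.up α x + K.up α y = K.up α fun a => x a + y a := by
  simp [up, mul_add, Finset.sum_add_distrib]

theorem up_sub (α : Fin 2 × Fin 2) (x y : Fin 4 → R) :
    K.up α x - K.up α y = K.up α fun a => x a - y a := by
  simp [up, mul_sub, Finset.sum_sub_distrib]

theorem mul_up (α : Fin 2 × Fin 2) (c : R) (x : Fin 4 → R) :
    c * K.up α x = K.up α fun a => c * x a := by
  simp only [up, Finset.mul_sum]
  exact Finset.sum_congr rfl fun _ _ => by ring

theorem up_mul (α : Fin 2 × Fin 2) (c : R) (x : Fin 4 → R) :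
    K.up α x * c = K.up α fun a => x a * c := by
  simp only [up, Finset.sum_mul, mul_assoc]

theorem sum_up {ι : Type*} (s : Finset ι) (α : Fin 2 × Fin 2) (x : ι → Fin 4 → R) :
    ∑ i ∈ s, K.up α (x i) = K.up α fun a => ∑ i ∈ s, x i a := by
  simp only [up, Finset.mul_sum]
  rw [Finset.sum_comm]

theorem up_zero (α : Fin 2 × Fin 2) : K.up α (fun _ => 0) = 0 := by simp [up]

theorem up_low (α : Fin 2 × Fin 2) (y : Fin 2 × Fin 2 → R) : K.up α (fun a => K.low a y) = y α :=
  K.sum_E_low α y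

theorem up_up_g (α β : Fin 2 × Fin 2) : K.up α (fun a => K.up β fun b => K.g a b) = eta α β := by
  have h : ∀ a, K.up β (fun b => K.g a b) = K.low a fun α => eta α β := by
    intro a
    have : ∀ b, K.g a b = K.low b fun β => K.low a fun α => eta α β := fun b => by
      rw [g_eq_low, low_comm]
    simp only [this, up_low]
  simp only [h, up_low]

theorem up_sum_mul_g (δ : Fin 2 × Fin 2) (x : Fin 4 → R) :
    K.up δ (fun e => ∑ k, x k * K.g k e) = ∑ κ, (∑ k, x k * K.S k κ) * eta κ δ := by
  have h : ∀ e, ∑ k, x k * K.g k e = K.low e fun δ => ∑ κ, (∑ k, x k * K.S k κ) * eta κ δ := by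
    intro e
    simp only [g, low, Finset.mul_sum, Finset.sum_mul]
    rw [Finset.sum_congr rfl fun k _ => Finset.sum_comm, Finset.sum_comm]
    refine Finset.sum_congr rfl fun δ _ => ?_
    rw [Finset.sum_comm]
    exact Finset.sum_congr rfl fun _ _ => Finset.sum_congr rfl fun _ _ => by ring
  simp only [h, up_low]

/-- This is `riem_mul_S` multiplied by E, and it links the coordinate curvature conditions to the
curvature spinors. -/
theorem frame_rm (A A' B B' C C' D D' : Fin 2) : K.frame.rm A A' B B' C C' D D' =
    K.up (A, A') fun a => K.up (B, B') fun b => K.up (C, C') fun c =>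
      ∑ e, K.riem a b c e * K.S e (D, D') := by
  have h : ∀ a b, K.up (C, C') (fun c => ∑ e, K.riem a b c e * K.S e (D, D')) =
      - (K.curv K.u a b C D * dd C' D' + dd C D * K.curv K.v a b C' D') := by
    intro a b
    have := congrArg (fun M => K.E * M) (K.riem_mul_S a b)
    simp only [Matrix.mul_neg] at this
    rw [← Matrix.mul_assoc K.E K.S, K.ES, Matrix.one_mul] at this
    have := congrFun (congrFun this (C, C')) (D, D')
    simp only [Matrix.mul_apply] at this
    rw [up, this]
    simp only [Matrix.neg_apply, Matrix.add_apply, Matrix.kroneckerMap_apply]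
    congr 2
    · congr 1
      fin_cases C' <;> fin_cases D' <;> simp [dd]
    · congr 1
      fin_cases C <;> fin_cases D <;> simp [dd]
  simp only [h, SpinFrame.rm, frame_curvU, frame_curvV]
  simp only [up, Finset.mul_sum, Finset.sum_mul, ← Finset.sum_add_distrib, ← Finset.sum_neg_distrib]
  exact Finset.sum_congr rfl fun _ _ => Finset.sum_congr rfl fun _ _ => by ring

theorem riem_bianchi (a b c e : Fin 4) :
    K.riem a b c e + K.riem b c a e + K.riem c a b e = 0 := by
  simp only [riem, Matrix.sub_apply, Matrix.add_apply, Matrix.map_apply, Matrix.mul_apply,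
    K.Γ_symm c b, K.Γ_symm b a, K.Γ_symm c a]
  ring

theorem rm_bianchi (A A' B B' C C' D D' : Fin 2) :
    K.frame.rm A A' B B' C C' D D' + K.frame.rm B B' C C' A A' D D'
      + K.frame.rm C C' A A' B B' D D' = 0 := by
  simp only [frame_rm]
  have e1 : (K.up (B, B') fun a => K.up (C, C') fun b => K.up (A, A') fun c =>
      ∑ e, K.riem a b c e * K.S e (D, D')) = K.up (A, A') fun a => K.up (B, B') fun b =>
      K.up (C, C') fun c => ∑ e, K.riem b c a e * K.S e (D, D') := by
    rw [K.up_comm (A, A')]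
    congr 1; funext b
    rw [K.up_comm (A, A')]
  have e2 : (K.up (C, C') fun a => K.up (A, A') fun b => K.up (B, B') fun c =>
      ∑ e, K.riem a b c e * K.S e (D, D')) = K.up (A, A') fun a => K.up (B, B') fun b =>
      K.up (C, C') fun c => ∑ e, K.riem c a b e * K.S e (D, D') := by
    rw [K.up_comm (C, C')]
    congr 1; funext b
    rw [K.up_comm (C, C')]
  rw [e1, e2]
  simp only [up_add, ← Finset.sum_add_distrib, ← add_mul, riem_bianchi, zero_mul,
    Finset.sum_const_zero, up_zero]

/-- Since S E = 1, contracting a frame pair is the same as contracting a coordinate index. -/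
theorem rm_ricci {lam : R} (h : ∀ a c, ∑ b, K.riem a b c b = lam * K.g a c) (A A' C C' : Fin 2) :
    ∑ B, ∑ B', K.frame.rm A A' B B' C C' B B' = lam * (ee A C * ee A' C') := by
  have h1 : ∀ a c, ∑ B, ∑ B', K.up (B, B') (fun b => ∑ e, K.riem a b c e * K.S e (B, B')) =
      lam * K.g a c := by
    intro a c
    rw [← h, ← Fintype.sum_prod_type' (f := fun B B' => K.up (B, B')
      (fun b => ∑ e, K.riem a b c e * K.S e (B, B')))]
    simp only [up, Finset.mul_sum]
    rw [Finset.sum_comm]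
    refine Finset.sum_congr rfl fun b _ => ?_
    rw [Finset.sum_comm]
    have : ∀ e, ∑ β : Fin 2 × Fin 2, K.E β b * (K.riem a b c e * K.S e β) =
        K.riem a b c e * (1 : Matrix (Fin 4) (Fin 4) R) e b := by
      intro e
      rw [← K.SE, Matrix.mul_apply, Finset.mul_sum]
      exact Finset.sum_congr rfl fun _ _ => by ring
    simp [this, Matrix.one_apply]
  have h2 : ∀ B B', K.frame.rm A A' B B' C C' B B' = K.up (A, A') fun a => K.up (C, C') fun c =>
      K.up (B, B') fun b => ∑ e, K.riem a b c e * K.S e (B, B') := by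
    intro B B'
    rw [frame_rm]
    congr 1; funext a
    rw [up_comm]
  simp only [h2, sum_up, h1, ← mul_up, up_up_g]
  rfl

/-- Three times the Weyl tensor of an Einstein metric. -/
def weyl3 (lam : R) (a b c e : Fin 4) : R :=
  3 * ∑ k, K.riem a b c k * K.g k e - lam * (K.g a c * K.g b e - K.g a e * K.g b c)

/-- A multiple of the unprimed Weyl spinor of an Einstein metric. -/
def weylS (lam : R) (A B C D : Fin 2) : R := ∑ a, ∑ b, ∑ c, ∑ e, K.weyl3 lam a b c e *
  (∑ A', ∑ B', ee A' B' * K.E (A, A') a * K.E (B, B') b) *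
  (∑ C', ∑ D', ee C' D' * K.E (C, C') c * K.E (D, D') e)

theorem up_weyl3 (lam : R) (A A' B B' C C' D D' : Fin 2) :
    (K.up (A, A') fun a => K.up (B, B') fun b => K.up (C, C') fun c => K.up (D, D') fun e =>
      K.weyl3 lam a b c e) =
    3 * ∑ k, ∑ k', K.frame.rm A A' B B' C C' k k' * (ee k D * ee k' D')
      - lam * (ee A C * ee A' C' * (ee B D * ee B' D') - ee A D * ee A' D' * (ee B C * ee B' C')) := by
  have h1 : (K.up (A, A') fun a => K.up (B, B') fun b => K.up (C, C') fun c => K.up (D, D') fun e =>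
      K.g a c * K.g b e) = ee A C * ee A' C' * (ee B D * ee B' D') := by
    have e1 : eta (A, A') (C, C') = ee A C * (ee A' C' : R) := rfl
    have e2 : eta (B, B') (D, D') = ee B D * (ee B' D' : R) := rfl
    rw [← e1, ← e2, ← K.up_up_g, ← K.up_up_g (B, B')]
    simp only [up_mul]
    congr 1; funext a
    rw [K.up_comm (B, B')]
    congr 1; funext c
    rw [mul_up]
    simp only [mul_up]
  have h2 : (K.up (A, A') fun a => K.up (B, B') fun b => K.up (C, C') fun c => K.up (D, D') fun e =>
      K.g a e * K.g b c) = ee A D * ee A' D' * (ee B C * ee B' C') := by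
    have e1 : eta (A, A') (D, D') = ee A D * (ee A' D' : R) := rfl
    have e2 : eta (B, B') (C, C') = ee B C * (ee B' C' : R) := rfl
    rw [← e1, ← e2, ← K.up_up_g, ← K.up_up_g (B, B')]
    simp only [up_mul]
    congr 1; funext a
    simp only [mul_up]
    rw [K.up_comm (D, D')]
    congr 1; funext b
    rw [K.up_comm (D, D')]
  have hm : ∀ (r : R) (T : Fin 4 → Fin 4 → Fin 4 → Fin 4 → R),
      (K.up (A, A') fun a => K.up (B, B') fun b => K.up (C, C') fun c => K.up (D, D') fun e =>
        r * T a b c e) = r * K.up (A, A') fun a => K.up (B, B') fun b => K.up (C, C') fun c =>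
          K.up (D, D') fun e => T a b c e := by
    intro r T
    simp only [mul_up]
  simp only [weyl3, ← up_sub]
  rw [hm, hm]
  simp only [← up_sub, h1, h2, up_sum_mul_g, frame_rm]
  congr 2
  simp only [up_mul, sum_up, Fintype.sum_prod_type]
  rfl

theorem weylS_eq (lam : R) (A B C D : Fin 2) : K.weylS lam A B C D =
    ∑ a, ∑ b, ∑ c, ∑ d, ee a b * ee c d *
      (3 * ∑ k, ∑ k', K.frame.rm A a B b C c k k' * (ee k D * ee k' d)
        - lam * (ee A C * ee a c * (ee B D * ee b d) - ee A D * ee a d * (ee B C * ee b c))) := by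
  simp only [← up_weyl3, weylS]
  generalize K.weyl3 lam = T
  have h : ∀ a b c d : Fin 2, ee a b * ee c d *
      (K.up (A, a) fun i => K.up (B, b) fun j => K.up (C, c) fun k => K.up (D, d) fun e =>
        T i j k e) = ∑ i, ∑ j, ∑ k, ∑ e, ee a b * ee c d *
        (K.E (A, a) i * (K.E (B, b) j * (K.E (C, c) k * (K.E (D, d) e * T i j k e)))) := by
    intro a b c d
    simp only [up, Finset.mul_sum]
  simp only [h]
  simp only [Fin.sum_univ_two (f := fun a => ∑ b, _)]
  simp only [Fin.sum_univ_two, ← Finset.sum_add_distrib]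
  refine Finset.sum_congr rfl fun _ _ => Finset.sum_congr rfl fun _ _ =>
    Finset.sum_congr rfl fun _ _ => Finset.sum_congr rfl fun _ _ => ?_
  ring

/-- Self-dual Einstein metrics, in the frame. -/
theorem selfDualEinstein {l lam : R} (hl : 6 * l = - lam) (hc : ∀ a, K.d a l = 0)
    (hr : ∀ a c, ∑ b, K.riem a b c b = lam * K.g a c)
    (hw : ∀ A B C D, K.weylS lam A B C D = 0) :
    K.frame.SelfDualEinstein l (K.frame.primedWeyl l) := by
  refine SpinFrame.selfDualEinstein_of_ricci hl (fun A A' => ?_) K.rm_bianchi (K.rm_ricci hr)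
    (fun A B C D => (K.weylS_eq lam A B C D).symm.trans (hw A B C D))
  change K.D (A, A') l = 0
  rw [D_apply]
  simp [hc]

end SpinChart

/-! ### From the Teukolsky equation to the linearised Einstein equations. -/

namespace SpinChart

variable {R : Type*} [CommRing R] [Algebra ℂ R] (K : SpinChart R)

theorem sum_cplx_mul_low (a : Fin 4) (y : Fin 2 × Fin 2 → R) :
    ∑ b, K.cplx a b * K.low b y = K.low a fun α => jEig R α * y α := by
  have h : ∀ α, ∑ b, K.cplx a b * K.S b α = K.S a α * jEig R α := by
    intro α
    have := congrFun (congrFun K.cplx_mul_S a) α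
    rwa [Matrix.mul_apply, Matrix.mul_diagonal] at this
  simp only [low, Finset.mul_sum]
  rw [Finset.sum_comm]
  refine Finset.sum_congr rfl fun α _ => ?_
  rw [← mul_assoc, ← h, Finset.sum_mul]
  exact Finset.sum_congr rfl fun _ _ => by ring

/-- The connection form for conformal weight `1` and GHP weight `2 n`. -/
def confForm (n : R) (f : Fin 4 → R) (a : Fin 4) : R :=
  f a + n * (2 * K.u a 0 0 - algebraMap ℂ R Complex.I * ∑ b, K.cplx a b * f b)

/-- J is -i for A = 0 and i for A = 1, so -iJf has components -f and f: the signs in `twoP`. -/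
theorem confForm_low (n : R) (f : Fin 2 → Fin 2 → R) (a : Fin 4) :
    K.confForm n (fun a => K.low a fun α => f α.1 α.2) a = K.low a fun α =>
      SpinFrame.weightForm n (fun A A' => K.frame.U A A' 0 0) f α.1 α.2 := by
  have hu : K.u a 0 0 = K.low a fun α => K.frame.U α.1 α.2 0 0 :=
    (K.low_sum_E a fun b => K.u b 0 0).symm
  have hI : (algebraMap ℂ R Complex.I) * algebraMap ℂ R Complex.I = -1 := by
    rw [← _root_.map_mul, Complex.I_mul_I, map_neg, _root_.map_one]
  rw [confForm, sum_cplx_mul_low, hu, ← low_mul, ← low_mul, low_sub, ← low_mul, ← low_add]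
  congr 1; funext ⟨A, A'⟩
  simp only [SpinFrame.weightForm, SpinFrame.twoP, jEig]
  fin_cases A <;> simp
  · linear_combination n * f 0 A' * hI
  · linear_combination - n * f 1 A' * hI

/-- Solutions of the Teukolsky equation give solutions of the linearised Einstein equations. -/
theorem linEin_metricPert {lam : R} (hlam : ∀ a, K.d a lam = 0)
    (hr : ∀ a c, ∑ b, K.riem a b c b = lam * K.g a c) (hw : ∀ A B C D, K.weylS lam A B C D = 0)
    (hJ : ∀ a b c, K.nijHalf a b c = K.nijHalf b a c) {f : Fin 4 → R}
    (hf : ∀ a, K.lee2 a = 2 * f a) {n : R} {s : ℕ → R} (hn : ∀ a, K.d a n = 0)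
    (hs : ∀ a k, K.d a (s k) = 0) (hns : ∀ k ≤ 4, n * s k = (2 - k) * s k) {Φ : R}
    (hΦ : K.teukolsky f (K.confForm n f) Φ = 0) :
    let h := K.metricPert (K.metricPot f (K.ofFrame fun α =>
      weylPot (fun A B C D => s (A + B + C + D) * Φ) (α 0) (α 1) (α 2) (α 3)))
    (∀ a b, h ![a, b] = h ![b, a]) ∧ K.trT h = 0 ∧ ∀ a b, K.linEin lam h a b = 0 := by
  intro h
  obtain ⟨l, hl, hdl⟩ : ∃ l : R, -6 * l = lam ∧ ∀ a, K.d a l = 0 := by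
    refine ⟨algebraMap ℂ R (-1 / 6) * lam, ?_, fun a => ?_⟩
    · have : (-6 : R) = algebraMap ℂ R (-6) := by rw [map_neg, map_ofNat]
      rw [this, ← mul_assoc, ← _root_.map_mul]; norm_num
    · rw [Derivation.leibniz, hlam, Derivation.map_algebraMap]; simp
  have hD : ∀ x, (∀ a, K.d a x = 0) → ∀ A A', K.frame.D A A' x = 0 := by
    intro x hx A A'
    change K.D (A, A') x = 0
    rw [D_apply]; simp [hx]
  -- The Lee form is replaced by its frame components.
  obtain ⟨φ, rfl⟩ : ∃ φ : Fin 2 → Fin 2 → R, f = fun a => K.low a fun α => φ α.1 α.2 :=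
    ⟨fun A A' => K.up (A, A') f, funext fun a => (K.low_sum_E a f).symm⟩
  have hH := K.hermitian_of_nijenhuis hJ φ hf
  have hE := K.selfDualEinstein (l := l) (by linear_combination - hl) hdl hr hw
  have hS : K.frame.WeightedSpinor n s := ⟨hD n hn, fun A A' k => hD _ (hs · k) A A', hns⟩
  have ht : K.frame.teuk n (fun A A' => K.frame.U A A' 0 0) φ Φ = 0 := by
    rw [← teukolsky_eq_teuk, ← hΦ]
    congr 1
    funext a
    exact (K.confForm_low n φ a).symm
  set X := SpinFrame.potential s (K.frame.confGrad n (fun A A' => K.frame.U A A' 0 0) φ Φ)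
  have hX : SpinFrame.Symm13 X := SpinFrame.symm13_potential _ _
  have hh : h = K.ofFrame fun α => K.frame.hertz X (α 0).1 (α 1).1 (α 0).2 (α 1).2 := by
    simp only [h]
    rw [metricPot_weylPot hH hS, metricPert_pot]
  have hsym : SpinFrame.Symm22 (K.frame.hertz X) := hX.hertz
  rw [hh]
  refine ⟨K.low_low_symm hsym, K.trT_ofFrame hsym, fun a b => ?_⟩
  have he : ∀ α β : Fin 2 × Fin 2, K.frame.ein l (K.frame.hertz X) α.1 α.2 β.1 β.2 = 0 :=
    fun α β => SpinFrame.ofNat_mul_cancel 6 (hE.ein_hertz hX (fun D A B C => by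
      rw [hH.twist_potential hE hS, ht, mul_zero]) _ _ _ _)
  rw [← hl, linEin_ofFrame K hsym]
  simp [he, low]

end SpinChart

/-! ### The algebra of smooth functions on a coordinate domain. -/

namespace QK

noncomputable section

open scoped Classical in
/-- The extension by zero of a function on a subset of coordinate space. -/
def zeroExt {U : Set E4} (r : U → ℂ) (y : E4) : ℂ := if h : y ∈ U then r ⟨y, h⟩ else 0

theorem zeroExt_apply {U : Set E4} (r : U → ℂ) {y : E4} (hy : y ∈ U) : zeroExt r y = r ⟨y, hy⟩ := by
  simp [zeroExt, hy]

theorem contDiffOn_zeroExt {U : Set E4} {r : U → ℂ} {F : E4 → ℂ} (hF : ContDiffOn ℝ ∞ F U)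
    (h : ∀ y (hy : y ∈ U), F y = r ⟨y, hy⟩) : ContDiffOn ℝ ∞ (zeroExt r) U :=
  hF.congr fun y hy => by rw [zeroExt_apply r hy, h y hy]

/-- The algebra of smooth complex functions on a subset of coordinate space. -/
def Smooth (U : Set E4) : Subalgebra ℂ (U → ℂ) where
  carrier := {r | ContDiffOn ℝ ∞ (zeroExt r) U}
  mul_mem' {a b} ha hb := contDiffOn_zeroExt (ha.mul hb) fun y hy => by
    simp [zeroExt_apply _ hy]
  add_mem' {a b} ha hb := contDiffOn_zeroExt (ha.add hb) fun y hy => by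
    simp [zeroExt_apply _ hy]
  algebraMap_mem' c := contDiffOn_zeroExt (F := fun _ => c) contDiffOn_const fun y hy => rfl

/-- The function `F` restricts to `r` on `U`. -/
def Rep {U : Set E4} (F : E4 → ℂ) (r : Smooth U) : Prop := ∀ y (hy : y ∈ U), F y = r.1 ⟨y, hy⟩

/-- The real function `F` restricts to `r` on `U`. -/
def RepR {U : Set E4} (F : E4 → ℝ) (r : Smooth U) : Prop := Rep (fun y => (F y : ℂ)) r

/-- The element given by a smooth function. -/
def Smooth.mk {U : Set E4} (F : E4 → ℂ) (hF : ContDiffOn ℝ ∞ F U) : Smooth U :=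
  ⟨fun y => F y, contDiffOn_zeroExt hF fun _ _ => rfl⟩

theorem rep_mk {U : Set E4} (F : E4 → ℂ) (hF : ContDiffOn ℝ ∞ F U) : Rep F (Smooth.mk F hF) :=
  fun _ _ => rfl

theorem Rep.contDiffOn {U : Set E4} {F : E4 → ℂ} {r : Smooth U} (h : Rep F r) :
    ContDiffOn ℝ ∞ F U :=
  r.2.congr fun y hy => by rw [h y hy, zeroExt_apply _ hy]

/-- Transfers pointwise identities on U to the algebra, where values outside U are invisible. -/
theorem Rep.ext {U : Set E4} {F : E4 → ℂ} {r r' : Smooth U} (h : Rep F r) (h' : Rep F r') :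
    r = r' := by
  apply Subtype.ext; funext ⟨y, hy⟩
  rw [← h y hy, h' y hy]

section pd

variable {V : Type*} [NormedAddCommGroup V] [NormedSpace ℝ V]

/-- A derivative depends only on the germ. This makes extension by zero harmless on open sets. -/
theorem pd_congr {F G : E4 → V} {U : Set E4} (hU : IsOpen U) (h : ∀ y ∈ U, F y = G y) (a : Fin 4)
    {y : E4} (hy : y ∈ U) : pd a F y = pd a G y := by
  have : F =ᶠ[nhds y] G := Filter.eventuallyEq_of_mem (hU.mem_nhds hy) h
  rw [pd, pd, this.fderiv_eq]

theorem contDiffOn_pd {F : E4 → V} {U : Set E4} (hU : IsOpen U) (h : ContDiffOn ℝ ∞ F U)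
    (a : Fin 4) : ContDiffOn ℝ ∞ (pd a F) U :=
  (h.fderiv_of_isOpen hU le_rfl).clm_apply contDiffOn_const

theorem pd_comm {F : E4 → V} {U : Set E4} (hU : IsOpen U) (h : ContDiffOn ℝ ∞ F U) (a b : Fin 4)
    {y : E4} (hy : y ∈ U) : pd a (pd b F) y = pd b (pd a F) y := by
  have hc : ContDiffAt ℝ ∞ F y := h.contDiffAt (hU.mem_nhds hy)
  have hs : IsSymmSndFDerivAt ℝ F y := hc.isSymmSndFDerivAt (by simp only [minSmoothness_of_isRCLikeNormedField]; exact WithTop.coe_le_coe.2 (le_top : (2 : ℕ∞) ≤ ⊤))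
  have hd : DifferentiableAt ℝ (fderiv ℝ F) y :=
    ((h.fderiv_of_isOpen hU (m := ∞) le_rfl).contDiffAt (hU.mem_nhds hy)).differentiableAt (by simp)
  have e : ∀ a b, pd a (pd b F) y =
      fderiv ℝ (fderiv ℝ F) y (EuclideanSpace.single a 1) (EuclideanSpace.single b 1) := by
    intro a b
    rw [pd, show pd b F = fun y => fderiv ℝ F y (EuclideanSpace.single b 1) from rfl,
      fderiv_clm_apply hd (differentiableAt_const _)]
    simp
  rw [e, e]
  exact hs _ _

end pd

variable {U : Set E4}

theorem differentiableAt_zeroExt (hU : IsOpen U) (r : Smooth U) {y : E4} (hy : y ∈ U) :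
    DifferentiableAt ℝ (zeroExt r.1) y :=
  (r.2.contDiffAt (hU.mem_nhds hy)).differentiableAt (by simp)

/-- The coordinate derivations. -/
def Smooth.d (hU : IsOpen U) (a : Fin 4) : Derivation ℂ (Smooth U) (Smooth U) where
  toFun r := Smooth.mk (pd a (zeroExt r.1)) (contDiffOn_pd hU r.2 a)
  map_add' r s := by
    apply Subtype.ext; funext ⟨y, hy⟩
    change pd a (zeroExt (r.1 + s.1)) y = pd a (zeroExt r.1) y + pd a (zeroExt s.1) y
    rw [pd_congr hU (G := fun y => zeroExt r.1 y + zeroExt s.1 y) (fun y hy => by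
      simp [zeroExt_apply _ hy]) a hy, pd, fderiv_fun_add (differentiableAt_zeroExt hU r hy)
      (differentiableAt_zeroExt hU s hy)]
    rfl
  map_smul' c r := by
    apply Subtype.ext; funext ⟨y, hy⟩
    change pd a (zeroExt (c • r.1)) y = c * pd a (zeroExt r.1) y
    rw [pd_congr hU (G := fun y => c * zeroExt r.1 y) (fun y hy => by
      simp [zeroExt_apply _ hy]) a hy, pd, fderiv_const_mul (differentiableAt_zeroExt hU r hy)]
    rfl
  map_one_eq_zero' := by
    apply Subtype.ext; funext ⟨y, hy⟩
    change pd a (zeroExt (1 : U → ℂ)) y = 0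
    rw [pd_congr hU (G := fun y => 1) (fun y hy => by
      simp [zeroExt_apply _ hy]) a hy, pd]
    simp
  leibniz' r s := by
    apply Subtype.ext; funext ⟨y, hy⟩
    change pd a (zeroExt (r.1 * s.1)) y = r.1 ⟨y, hy⟩ * pd a (zeroExt s.1) y
      + s.1 ⟨y, hy⟩ * pd a (zeroExt r.1) y
    rw [pd_congr hU (G := fun y => zeroExt r.1 y * zeroExt s.1 y) (fun y hy => by
      simp [zeroExt_apply _ hy]) a hy, pd, fderiv_fun_mul (differentiableAt_zeroExt hU r hy)
      (differentiableAt_zeroExt hU s hy), zeroExt_apply _ hy, zeroExt_apply _ hy]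
    rfl

theorem Rep.pd (hU : IsOpen U) {F : E4 → ℂ} {r : Smooth U} (h : Rep F r) (a : Fin 4) :
    Rep (QK.pd a F) (Smooth.d hU a r) := fun y hy =>
  pd_congr hU (fun y hy => by rw [h y hy, zeroExt_apply _ hy]) a hy

theorem rep_zeroExt (r : Smooth U) : Rep (zeroExt r.1) r := fun y hy => zeroExt_apply _ hy

theorem Smooth.d_comm (hU : IsOpen U) (a b : Fin 4) (r : Smooth U) :
    Smooth.d hU a (Smooth.d hU b r) = Smooth.d hU b (Smooth.d hU a r) := by
  apply Subtype.ext; funext ⟨y, hy⟩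
  rw [← (((rep_zeroExt r).pd hU b).pd hU a) y hy, ← (((rep_zeroExt r).pd hU a).pd hU b) y hy]
  exact pd_comm hU r.2 a b hy

/-- The derivative of a real function is compared with that of its complexification;
differentiability is recovered by taking real parts. -/
theorem RepR.pd (hU : IsOpen U) {F : E4 → ℝ} {r : Smooth U} (h : RepR F r) (a : Fin 4) :
    RepR (QK.pd a F) (Smooth.d hU a r) := fun y hy => by
  rw [← Rep.pd hU h a y hy]
  have hd : DifferentiableAt ℝ (fun y => (F y : ℂ)) y :=
    (h.contDiffOn.contDiffAt (hU.mem_nhds hy)).differentiableAt (by simp)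
  have hF : HasFDerivAt F (Complex.reCLM.comp (fderiv ℝ (fun y => (F y : ℂ)) y)) y :=
    Complex.reCLM.hasFDerivAt.comp y hd.hasFDerivAt
  have hF' := (Complex.ofRealCLM.hasFDerivAt.comp y hF.differentiableAt.hasFDerivAt)
  change ((fderiv ℝ F y (EuclideanSpace.single a 1) : ℝ) : ℂ) =
    fderiv ℝ (fun y => (F y : ℂ)) y (EuclideanSpace.single a 1)
  rw [show fderiv ℝ (fun y => (F y : ℂ)) y = _ from hF'.fderiv]
  rfl

theorem Rep.add {F G : E4 → ℂ} {r s : Smooth U} (hF : Rep F r) (hG : Rep G s) :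
    Rep (fun y => F y + G y) (r + s) := fun y hy => by
  simp [hF y hy, hG y hy]

theorem Rep.sub {F G : E4 → ℂ} {r s : Smooth U} (hF : Rep F r) (hG : Rep G s) :
    Rep (fun y => F y - G y) (r - s) := fun y hy => by
  simp [hF y hy, hG y hy]

theorem Rep.neg {F : E4 → ℂ} {r : Smooth U} (hF : Rep F r) : Rep (fun y => - F y) (- r) :=
  fun y hy => by simp [hF y hy]

theorem Rep.mul {F G : E4 → ℂ} {r s : Smooth U} (hF : Rep F r) (hG : Rep G s) :
    Rep (fun y => F y * G y) (r * s) := fun y hy => by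
  simp [hF y hy, hG y hy]

theorem Rep.sum {ι : Type*} {s : Finset ι} {F : ι → E4 → ℂ} {r : ι → Smooth U}
    (h : ∀ i, Rep (F i) (r i)) : Rep (fun y => ∑ i ∈ s, F i y) (∑ i ∈ s, r i) := fun y hy => by
  simp [fun i => h i y hy]

theorem rep_const (c : ℂ) : Rep (fun _ => c) (algebraMap ℂ (Smooth U) c) := fun _ _ => rfl

theorem RepR.add {F G : E4 → ℝ} {r s : Smooth U} (hF : RepR F r) (hG : RepR G s) :
    RepR (fun y => F y + G y) (r + s) := fun y hy => by
  simp [Complex.ofReal_add, hF y hy, hG y hy]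

theorem RepR.sub {F G : E4 → ℝ} {r s : Smooth U} (hF : RepR F r) (hG : RepR G s) :
    RepR (fun y => F y - G y) (r - s) := fun y hy => by
  simp [Complex.ofReal_sub, hF y hy, hG y hy]

theorem RepR.mul {F G : E4 → ℝ} {r s : Smooth U} (hF : RepR F r) (hG : RepR G s) :
    RepR (fun y => F y * G y) (r * s) := fun y hy => by
  simp [Complex.ofReal_mul, hF y hy, hG y hy]

theorem RepR.sum {ι : Type*} {s : Finset ι} {F : ι → E4 → ℝ} {r : ι → Smooth U}
    (h : ∀ i, RepR (F i) (r i)) : RepR (fun y => ∑ i ∈ s, F i y) (∑ i ∈ s, r i) := fun y hy => by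
  simp [Complex.ofReal_sum, fun i => h i y hy]

theorem repR_const (c : ℝ) : RepR (fun _ => c) (algebraMap ℂ (Smooth U) c) := fun _ _ => rfl

end

end QK

/-! ### Coordinate domains with a Hermitian structure and a smooth principal frame. -/

namespace QK

theorem RepR.rep {U : Set E4} {F : E4 → ℝ} {r : Smooth U} (h : RepR F r) :
    Rep (fun y => (F y : ℂ)) r := h

noncomputable section

/-- A Hermitian structure on a coordinate domain `U`, with a smooth principal spin frame. -/
structure HermitianChart (U : Set E4) (g J : MatField) (σ : Solder) : Prop where
  isOpen : IsOpen U
  metric : ∀ y ∈ U, ∀ a b, (g y a b : ℂ) =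
    ∑ A, ∑ B, ∑ A', ∑ B', eps A B * eps A' B' * σ y a A A' * σ y b B B'
  det : ∀ y ∈ U, (g y).det ≠ 0
  smooth : ∀ a A A', ContDiffOn ℝ ∞ (fun y => σ y a A A') U
  complex : ∀ y ∈ U, ∀ a A A', ∑ c, (J y c a : ℂ) * σ y c A A' =
    ![-Complex.I, Complex.I] A * σ y a A A'

namespace HermitianChart

variable {U : Set E4} {g J : MatField} {σ : Solder} (H : HermitianChart U g J σ)

include H

/-- The metric inherits smoothness from the soldering form, as the real part of a polynomial in it.
-/
theorem contDiffOn_g (a b : Fin 4) : ContDiffOn ℝ ∞ (fun y => g y a b) U := by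
  have hc : ContDiffOn ℝ ∞ (fun y => ∑ A, ∑ B, ∑ A', ∑ B',
      eps A B * eps A' B' * σ y a A A' * σ y b B B') U :=
    ContDiffOn.sum fun A _ => ContDiffOn.sum fun B _ => ContDiffOn.sum fun A' _ =>
      ContDiffOn.sum fun B' _ =>
        (contDiffOn_const.mul (H.smooth a A A')).mul (H.smooth b B B')
  have h : ContDiffOn ℝ ∞ (fun y => (∑ A, ∑ B, ∑ A', ∑ B',
      eps A B * eps A' B' * σ y a A A' * σ y b B B').re) U :=
    Complex.reCLM.contDiff.comp_contDiffOn hc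
  exact h.congr fun y hy => by rw [← H.metric y hy, Complex.ofReal_re]

omit H in
theorem contDiffOn_det {M : E4 → Matrix (Fin 4) (Fin 4) ℝ}
    (h : ∀ a b, ContDiffOn ℝ ∞ (fun y => M y a b) U) : ContDiffOn ℝ ∞ (fun y => (M y).det) U := by
  simp only [Matrix.det_apply]
  refine ContDiffOn.sum fun p _ => ContDiffOn.const_smul _ (contDiffOn_prod fun i _ => h _ _)

theorem contDiffOn_gInv (a b : Fin 4) : ContDiffOn ℝ ∞ (fun y => gInv g y a b) U := by
  -- Cramer's rule shows that the inverse metric is smooth.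
  have h : ContDiffOn ℝ ∞ (fun y => ((g y).det)⁻¹ * ((g y).updateRow b (Pi.single a 1)).det) U := by
    refine ContDiffOn.mul ((contDiffOn_det H.contDiffOn_g).inv H.det) (contDiffOn_det fun c d => ?_)
    by_cases hc : c = b
    · simp only [hc, Matrix.updateRow_self]; exact contDiffOn_const
    · simp only [Matrix.updateRow_ne hc]; exact H.contDiffOn_g c d
  refine h.congr fun y hy => ?_
  rw [gInv, Matrix.inv_def, Matrix.smul_apply, Matrix.adjugate_apply, Ring.inverse_eq_inv',
    smul_eq_mul]

theorem g_mul_gInv {y : E4} (hy : y ∈ U) (a b : Fin 4) :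
    ∑ c, g y a c * gInv g y c b = (1 : Matrix (Fin 4) (Fin 4) ℝ) a b := by
  rw [← Matrix.mul_nonsing_inv (g y) (isUnit_iff_ne_zero.2 (H.det y hy)), Matrix.mul_apply]
  rfl

omit H in
theorem rep_ee (A B : Fin 2) : Rep (fun _ => eps A B) (ee A B : Smooth U) := by
  intro y hy
  fin_cases A <;> fin_cases B <;> simp [ee, eps]

/-- The soldering form as a matrix of smooth functions. -/
def S : Matrix (Fin 4) (Fin 2 × Fin 2) (Smooth U) := Matrix.of fun a α =>
  Smooth.mk (fun y => σ y a α.1 α.2) (H.smooth a α.1 α.2)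

theorem rep_S (a : Fin 4) (A A' : Fin 2) : Rep (fun y => σ y a A A') (H.S a (A, A')) :=
  fun _ _ => rfl

/-- The inverse metric as a matrix of smooth functions. -/
def gi : Matrix (Fin 4) (Fin 4) (Smooth U) := Matrix.of fun a b =>
  Smooth.mk (fun y => (gInv g y a b : ℂ))
    (Complex.ofRealCLM.contDiff.comp_contDiffOn (H.contDiffOn_gInv a b))

theorem repR_gi (a b : Fin 4) : RepR (fun y => gInv g y a b) (H.gi a b) :=
  fun _ _ => rfl

theorem repR_g' (a b : Fin 4) : RepR (fun y => g y a b)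
    ((H.S * MetricChart.η (Smooth U) * H.S.transpose) a b) := by
  have h : (H.S * MetricChart.η (Smooth U) * H.S.transpose) a b = ∑ A, ∑ B, ∑ A', ∑ B',
      ee A B * ee A' B' * H.S a (A, A') * H.S b (B, B') := by
    simp only [MetricChart.η, Matrix.mul_apply, Matrix.of_apply, Matrix.transpose_apply,
      SpinChart.eta, Fintype.sum_prod_type, Fin.sum_univ_two]
    ring
  intro y hy
  rw [h, ← (Rep.sum fun A => Rep.sum fun B => Rep.sum fun A' => Rep.sum fun B' =>
    (((rep_ee A B).mul (rep_ee A' B')).mul (H.rep_S a A A')).mul (H.rep_S b B B')) y hy]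
  exact H.metric y hy a b

/-- The chart of smooth functions. -/
def chart : MetricChart (Smooth U) where
  d := Smooth.d H.isOpen
  comm a b r := Smooth.d_comm H.isOpen a b r
  S := H.S
  gi := H.gi
  mul_gi := by
    ext1 a b
    refine Rep.ext (F := fun y => ((∑ c, g y a c * gInv g y c b : ℝ) : ℂ)) ?_ ?_
    · rw [Matrix.mul_apply]
      exact RepR.sum fun c => (H.repR_g' a c).mul (H.repR_gi c b)
    · intro y hy
      beta_reduce
      rw [H.g_mul_gInv hy]
      by_cases h : a = b <;> simp [Matrix.one_apply, h]

theorem repR_g (a b : Fin 4) : RepR (fun y => g y a b) (H.chart.g a b) := H.repR_g' a b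

theorem rep_d {F : E4 → ℂ} {r : Smooth U} (h : Rep F r) (a : Fin 4) :
    Rep (pd a F) (H.chart.d a r) := h.pd H.isOpen a

theorem repR_d {F : E4 → ℝ} {r : Smooth U} (h : RepR F r) (a : Fin 4) :
    RepR (pd a F) (H.chart.d a r) := h.pd H.isOpen a

theorem repR_christoffel (c a b : Fin 4) : RepR (christoffel g c a b) (H.chart.Γ a b c) := by
  have h2 : RepR (fun _ => (1 / 2 : ℝ)) (MetricChart.half : Smooth U) := by
    have : ((1 / 2 : ℝ) : ℂ) = 1 / 2 := by norm_num
    intro y hy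
    change ((1 / 2 : ℝ) : ℂ) = 1 / 2
    exact this
  exact h2.mul (RepR.sum fun d => (H.repR_gi c d).mul
    (((H.repR_d (H.repR_g b d) a).add (H.repR_d (H.repR_g a d) b)).sub (H.repR_d (H.repR_g a b) d)))

theorem repR_riemann (a b c d : Fin 4) : RepR (riemann g a b c d) (H.chart.spin.riem a b c d) := by
  have h : H.chart.spin.riem a b c d = H.chart.d a (H.chart.Γ b c d) - H.chart.d b (H.chart.Γ a c d)
      + ∑ e, (H.chart.Γ a e d * H.chart.Γ b c e - H.chart.Γ b e d * H.chart.Γ a c e) := by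
    simp only [SpinChart.riem, Matrix.sub_apply, Matrix.add_apply, Matrix.map_apply,
      Matrix.mul_apply, Finset.sum_sub_distrib]
    rw [Finset.sum_congr rfl fun e _ => mul_comm (H.chart.Γ a e d) _,
      Finset.sum_congr rfl fun e _ => mul_comm (H.chart.Γ b e d) _]
    exact add_sub_assoc _ _ _
  rw [h]
  exact ((H.repR_d (H.repR_christoffel d b c) a).sub (H.repR_d (H.repR_christoffel d a c) b)).add
    (RepR.sum fun e => ((H.repR_christoffel d a e).mul (H.repR_christoffel e b c)).sub
      ((H.repR_christoffel d b e).mul (H.repR_christoffel e a c)))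

theorem rep_solderInv (b : Fin 4) (B B' : Fin 2) :
    Rep (solderInv g σ b B B') (H.chart.E (B, B') b) := by
  have h : H.chart.E (B, B') b = ∑ c, ∑ A, ∑ A', H.chart.gi b c * ee A B * ee A' B' *
      H.S c (A, A') := by
    rw [MetricChart.E, Matrix.mul_apply]
    refine Finset.sum_congr rfl fun c _ => ?_
    have hg : H.chart.gi c b = H.chart.gi b c := by
      conv_lhs => rw [← H.chart.gi_transpose]
      rfl
    have hS : ∀ α, H.chart.S c α = H.S c α := fun _ => rfl
    simp only [MetricChart.η, Matrix.mul_apply, Matrix.of_apply, Matrix.transpose_apply,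
      SpinChart.eta, Fintype.sum_prod_type, Fin.sum_univ_two, hg, hS]
    fin_cases B <;> fin_cases B' <;> simp [ee] <;> ring
  rw [h]
  exact Rep.sum fun c => Rep.sum fun A => Rep.sum fun A' =>
    (((H.repR_gi b c).rep.mul (rep_ee A B)).mul (rep_ee A' B')).mul (H.rep_S c A A')

/-- `spinConn` acts on upper indices and `u` on lower ones, hence the negative transpose. -/
theorem rep_spinConn (a : Fin 4) (B C : Fin 2) :
    Rep (spinConn g σ a B C) (- H.chart.u a C B) := by
  have h : - H.chart.u a C B = algebraMap ℂ (Smooth U) (-(1 / 2)) * ∑ b, ∑ B', H.chart.E (C, B') b *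
      (H.chart.d a (H.S b (B, B')) - ∑ c, H.chart.Γ a b c * H.S c (B, B')) := by
    simp only [MetricChart.u, MetricChart.m, Matrix.of_apply, Matrix.mul_apply, Matrix.sub_apply,
      Matrix.map_apply]
    rw [Finset.sum_comm, map_neg]
    exact (neg_mul (MetricChart.half : Smooth U) _).symm
  rw [h]
  have h2 : Rep (fun _ => (-(1 / 2) : ℂ)) (algebraMap ℂ (Smooth U) (-(1 / 2))) := rep_const _
  exact h2.mul (Rep.sum fun b => Rep.sum fun B' => (H.rep_solderInv b C B').mul
    ((H.rep_d (H.rep_S b B B') a).sub (Rep.sum fun c => (H.repR_christoffel c a b).rep.mul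
      (H.rep_S c B B'))))

/-- Since ι_0 = -1 and o has constant components, the two signs cancel and ω is the diagonal
coefficient of `u`. -/
theorem rep_ghpForm (a : Fin 4) : Rep (ghpForm g σ a) (H.chart.u a 0 0) := by
  intro y hy
  have h := H.rep_spinConn a 0 0 y hy
  simp only [ghpForm, nablaSpinor, lower, iotaUp, oUp, eps, pd, Fin.sum_univ_two]
  simp [h]

/-- The eigenvalue equation for J on the coframe, contracted with the inverse soldering form,
recovers J. -/
theorem repR_J (a c : Fin 4) : RepR (fun y => J y c a) (H.chart.spin.cplx a c) := by
  intro y hy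
  have h : H.chart.spin.cplx a c = ∑ α : Fin 2 × Fin 2, (SpinChart.jEig (Smooth U) α *
      H.S a α) * H.chart.E α c := by
    rw [SpinChart.cplx, Matrix.mul_apply]
    refine Finset.sum_congr rfl fun α _ => ?_
    rw [Matrix.mul_diagonal, mul_comm (SpinChart.jEig _ _)]
    rfl
  have h1 : ∀ b, Rep (fun y => if b = c then (1 : ℂ) else 0)
      (∑ α : Fin 2 × Fin 2, H.S b α * H.chart.E α c) := by
    intro b y hy
    have := congrFun (congrFun H.chart.SE b) c
    rw [Matrix.mul_apply] at this
    have e : ∑ α : Fin 2 × Fin 2, H.S b α * H.chart.E α c = (1 : Matrix _ _ (Smooth U)) b c := this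
    rw [e]
    by_cases hb : b = c <;> simp [Matrix.one_apply, hb]
  have h2 : ∀ α : Fin 2 × Fin 2, Rep (fun y => ∑ b, (J y b a : ℂ) * σ y b α.1 α.2)
      (SpinChart.jEig (Smooth U) α * H.S a α) := by
    intro α y hy
    beta_reduce
    rw [H.complex y hy]
    rfl
  have h3 := (Rep.sum (s := Finset.univ) fun α : Fin 2 × Fin 2 =>
    (h2 α).mul (H.rep_solderInv c α.1 α.2)) y hy
  rw [h, ← h3]
  have h4 : ∀ b, ∑ α : Fin 2 × Fin 2, σ y b α.1 α.2 * solderInv g σ c α.1 α.2 y =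
      if b = c then 1 else 0 := fun b => by
    refine Eq.trans ?_ (h1 b y hy).symm
    exact (Rep.sum (s := Finset.univ) fun α : Fin 2 × Fin 2 =>
      (H.rep_S b α.1 α.2).mul (H.rep_solderInv c α.1 α.2)) y hy
  simp only [Finset.sum_mul]
  rw [Finset.sum_comm]
  simp only [mul_assoc, ← Finset.mul_sum, h4]
  simp

theorem repR_nablaJ (b c a : Fin 4) : RepR (nablaJ g J b c a) (H.chart.spin.dcplx b a c) := by
  have h : H.chart.spin.dcplx b a c = H.chart.d b (H.chart.spin.cplx a c) +
      ∑ e, (H.chart.Γ b e c * H.chart.spin.cplx a e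
        - H.chart.Γ b a e * H.chart.spin.cplx e c) := by
    simp only [SpinChart.dcplx, Matrix.sub_apply, Matrix.add_apply, Matrix.map_apply,
      Matrix.mul_apply, Finset.sum_sub_distrib]
    rw [Finset.sum_congr rfl fun e _ => mul_comm (H.chart.Γ b e c) _]
    change H.chart.d b _ - ∑ e, H.chart.Γ b a e * _ + ∑ e, _ * H.chart.Γ b e c = _
    ring
  rw [h]
  exact (H.repR_d (H.repR_J a c) b).add (RepR.sum fun e =>
    ((H.repR_christoffel c b e).mul (H.repR_J a e)).sub
      ((H.repR_christoffel e b a).mul (H.repR_J e c)))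

/-- The Lee form. -/
def lee (a : Fin 4) : Smooth U := MetricChart.half * H.chart.spin.lee2 a

theorem two_mul_lee (a : Fin 4) : H.chart.spin.lee2 a = 2 * H.lee a := by
  rw [lee, ← mul_assoc, MetricChart.two_mul_half, one_mul]

theorem repR_leeForm (a : Fin 4) : RepR (leeForm g J a) (H.lee a) := by
  have h : H.lee a = algebraMap ℂ (Smooth U) ((-(1 / 2) : ℝ) : ℂ) *
      ∑ b, ∑ c, H.chart.spin.cplx c b * H.chart.spin.dcplx b a c := by
    have e : ((-(1 / 2) : ℝ) : ℂ) = -(1 / 2) := by norm_num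
    rw [lee, SpinChart.lee2, e, map_neg, MetricChart.half]
    ring
  rw [h]
  exact (repR_const (-(1 / 2))).mul (RepR.sum fun b => RepR.sum fun c =>
    (H.repR_J c b).mul (H.repR_nablaJ b c a))

theorem rep_formP (a : Fin 4) : Rep (formP g J σ a) (H.chart.u a 0 0 -
    algebraMap ℂ (Smooth U) (1 / 2 * Complex.I) * ∑ b, H.chart.spin.cplx a b * H.lee b) :=
  (H.rep_ghpForm a).sub ((rep_const (1 / 2 * Complex.I)).mul (Rep.sum fun b =>
    (H.repR_J a b).rep.mul (H.repR_leeForm b).rep))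

end HermitianChart

end

end QK

/-- The Nijenhuis tensor in terms of partial derivatives. -/
theorem SpinChart.nijHalf_sub {R : Type*} [CommRing R] [Algebra ℂ R] (K : SpinChart R)
    (a b c : Fin 4) : K.nijHalf a b c - K.nijHalf b a c =
      ∑ e, (K.cplx a e * K.d e (K.cplx b c) - K.cplx b e * K.d e (K.cplx a c)
        - K.cplx e c * (K.d a (K.cplx b e) - K.d b (K.cplx a e))) := by
  have h : ∀ a b, K.nijHalf a b c = ∑ e, (K.cplx a e * K.d e (K.cplx b c)
      - K.cplx e c * K.d a (K.cplx b e))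
      - ∑ e, ∑ k, K.cplx a e * K.Γ e b k * K.cplx k c
      + ∑ e, ∑ k, K.cplx a e * K.cplx b k * K.Γ e k c
      + ∑ e, ∑ k, K.Γ a b k * K.cplx k e * K.cplx e c
      - ∑ e, ∑ k, K.cplx b e * K.Γ e a k * K.cplx k c := by
    intro a b
    have h1 : ∑ e, ∑ k, K.cplx b e * K.Γ e a k * K.cplx k c =
        ∑ e, ∑ k, K.cplx b k * K.Γ a k e * K.cplx e c := by
      rw [Finset.sum_comm]
      exact Finset.sum_congr rfl fun e _ => Finset.sum_congr rfl fun k _ => by rw [K.Γ_symm]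
    rw [h1]
    simp only [← Finset.sum_sub_distrib, ← Finset.sum_add_distrib]
    refine Finset.sum_congr rfl fun e _ => ?_
    simp only [SpinChart.dcplx, Matrix.sub_apply, Matrix.add_apply, Matrix.map_apply,
      Matrix.mul_apply]
    simp only [mul_assoc, ← Finset.mul_sum]
    have e1 : ∀ x y : Fin 4 → R, ∑ k, x k * (y k * K.cplx e c) = (∑ k, x k * y k) * K.cplx e c := by
      intro x y
      rw [Finset.sum_mul]; exact Finset.sum_congr rfl fun _ _ => by ring
    rw [e1, e1]
    ring
  have h2 : ∑ e, ∑ k, K.cplx a e * K.cplx b k * K.Γ e k c =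
      ∑ e, ∑ k, K.cplx b e * K.cplx a k * K.Γ e k c := by
    rw [Finset.sum_comm]
    exact Finset.sum_congr rfl fun e _ => Finset.sum_congr rfl fun k _ => by rw [K.Γ_symm]; ring
  have h3 : ∑ e, ∑ k, K.Γ a b k * K.cplx k e * K.cplx e c =
      ∑ e, ∑ k, K.Γ b a k * K.cplx k e * K.cplx e c :=
    Finset.sum_congr rfl fun e _ => Finset.sum_congr rfl fun k _ => by rw [K.Γ_symm]
  rw [h a b, h b a, h2, h3]
  simp only [mul_sub, Finset.sum_sub_distrib]
  ring

/-! ### Tensors and differential operators on a coordinate domain. -/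

namespace QK

/-- The tensor `T` restricts to `t` on `U`. -/
def RepT {U : Set E4} {n : ℕ} (T : Tens n) (t : (Fin n → Fin 4) → Smooth U) : Prop :=
  ∀ a, Rep (T a) (t a)

theorem rep_ofNat {U : Set E4} (k : ℕ) [k.AtLeastTwo] :
    Rep (fun _ => (OfNat.ofNat k : ℂ)) (OfNat.ofNat k : Smooth U) := fun y hy => by
  rw [← map_ofNat (algebraMap ℂ (Smooth U))]
  rfl

namespace HermitianChart

variable {U : Set E4} {g J : MatField} {σ : Solder} (H : HermitianChart U g J σ)

theorem nijHalf_symm (hJ : ∀ y ∈ U, ∀ a b c, nijenhuis J c a b y = 0) (a b c : Fin 4) :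
    H.chart.spin.nijHalf a b c = H.chart.spin.nijHalf b a c := by
  rw [← sub_eq_zero, SpinChart.nijHalf_sub]
  refine Rep.ext (F := fun y => (nijenhuis J c a b y : ℂ)) ?_ fun y hy => by
    beta_reduce; rw [hJ y hy]; simp
  exact RepR.sum fun d => (((H.repR_J a d).mul (H.repR_d (H.repR_J b c) d)).sub
    ((H.repR_J b d).mul (H.repR_d (H.repR_J a c) d))).sub ((H.repR_J d c).mul
      ((H.repR_d (H.repR_J b d) a).sub (H.repR_d (H.repR_J a d) b)))

theorem riem_ricci {lam : ℝ} (hR : ∀ y ∈ U, ∀ a b, ricci g a b y = lam * g y a b) (a c : Fin 4) :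
    ∑ b, H.chart.spin.riem a b c b =
      algebraMap ℂ (Smooth U) lam * H.chart.spin.g a c := by
  rw [MetricChart.spin_g]
  refine Rep.ext (F := fun y => (ricci g a c y : ℂ)) (RepR.sum fun b => H.repR_riemann a b c b) ?_
  intro y hy
  beta_reduce
  rw [hR y hy]
  exact ((repR_const lam).mul (H.repR_g a c)) y hy

include H in
theorem g_symm {y : E4} (hy : y ∈ U) (a b : Fin 4) : g y a b = g y b a := by
  have h := H.repR_g a b y hy
  rw [MetricChart.g_symm, ← H.repR_g b a y hy] at h
  have h' : (g y a b : ℂ) = g y b a := h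
  exact_mod_cast h'

include H in
-- The scalar curvature is 4λ, so the Ricci and scalar terms combine to coefficient -1 + 2/3 = -1/3,
-- cleared by the factor 3.
theorem weyl_eq {lam : ℝ} (hR : ∀ y ∈ U, ∀ a b, ricci g a b y = lam * g y a b) {y : E4}
    (hy : y ∈ U) (a b c d : Fin 4) : 3 * weyl g a b c d y = 3 * ∑ e, riemann g a b c e y * g y e d
      - lam * (g y a c * g y b d - g y a d * g y b c) := by
  have hs : scalarCurv g y = 4 * lam := by
    have h : ∀ b, ∑ a, g y b a * gInv g y a b = 1 := fun b => by
      rw [H.g_mul_gInv hy]; simp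
    calc scalarCurv g y = ∑ a, ∑ b, lam * (g y b a * gInv g y a b) := by
          refine Finset.sum_congr rfl fun a _ => Finset.sum_congr rfl fun b _ => ?_
          rw [hR y hy, H.g_symm hy a b]; ring
      _ = 4 * lam := by
          rw [Finset.sum_comm]
          simp only [← Finset.mul_sum, h]
          simp; ring
  rw [weyl, hs, hR y hy, hR y hy, hR y hy, hR y hy]
  ring

theorem weylS_eq_zero {lam : ℝ} (hR : ∀ y ∈ U, ∀ a b, ricci g a b y = lam * g y a b)
    (hW : ∀ y ∈ U, ∀ A B C D, weylSpinor g σ A B C D y = 0) (A B C D : Fin 2) :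
    H.chart.spin.weylS (algebraMap ℂ (Smooth U) lam) A B C D = 0 := by
  have e3 : RepR (fun _ => 3) (3 : Smooth U) := fun y hy => by
    have := rep_ofNat (U := U) 3 y hy
    simpa using this
  have h3 : ∀ a b c d, RepR (fun y => 3 * ∑ e, riemann g a b c e y * g y e d
      - lam * (g y a c * g y b d - g y a d * g y b c))
      (H.chart.spin.weyl3 (algebraMap ℂ (Smooth U) lam) a b c d) := by
    intro a b c d
    rw [SpinChart.weyl3]
    simp only [MetricChart.spin_g]
    exact (e3.mul (RepR.sum fun e => (H.repR_riemann a b c e).mul (H.repR_g e d))).sub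
      ((repR_const lam).mul (((H.repR_g a c).mul (H.repR_g b d)).sub
        ((H.repR_g a d).mul (H.repR_g b c))))
  have hb : ∀ A B a b, Rep (fun y => ∑ A', ∑ B', eps A' B' * solderInv g σ a A A' y *
      solderInv g σ b B B' y) (∑ A', ∑ B', ee A' B' * H.chart.spin.E (A, A') a *
        H.chart.spin.E (B, B') b) := fun A B a b =>
    Rep.sum fun A' => Rep.sum fun B' => ((rep_ee A' B').mul (H.rep_solderInv a A A')).mul
      (H.rep_solderInv b B B')
  -- The factor 12 is 3 from `weyl3` times 4 from the normalisation of the Weyl spinor.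
  refine Rep.ext (F := fun y => 12 * weylSpinor g σ A B C D y) ?_ fun y hy => by
    simp [hW y hy]
  intro y hy
  rw [SpinChart.weylS, ← (Rep.sum fun a => Rep.sum fun b => Rep.sum fun c => Rep.sum fun d =>
    ((h3 a b c d).rep.mul (hb A B a b)).mul (hb C D c d)) y hy]
  have hw : ∀ a b c d, ((3 * ∑ e, riemann g a b c e y * g y e d
      - lam * (g y a c * g y b d - g y a d * g y b c) : ℝ) : ℂ) = 3 * (weyl g a b c d y : ℂ) := by
    intro a b c d
    rw [← H.weyl_eq hR hy, Complex.ofReal_mul]; norm_num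
  simp only [weylSpinor, hw, mul_assoc, ← Finset.mul_sum]
  ring

theorem repT_nabla {n : ℕ} {T : Tens n} {t : (Fin n → Fin 4) → Smooth U} (h : RepT T t) :
    RepT (nabla g T) (H.chart.spin.nab t) := fun a =>
  (H.rep_d (h (Fin.tail a)) (a 0)).sub (Rep.sum fun r => Rep.sum fun d =>
    (H.repR_christoffel d (a 0) (Fin.tail a r)).rep.mul (h (Function.update (Fin.tail a) r d)))

theorem rep_gi (a b : Fin 4) : Rep (fun y => (gInv g y a b : ℂ)) (H.chart.spin.gi a b) := by
  rw [MetricChart.spin_gi]; exact H.repR_gi a b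

theorem rep_g (a b : Fin 4) : Rep (fun y => (g y a b : ℂ)) (H.chart.spin.g a b) := by
  rw [MetricChart.spin_g]; exact H.repR_g a b

theorem rep_tr {z : Fin 4 → Fin 4 → E4 → ℂ} {t : Fin 4 → Fin 4 → Smooth U}
    (h : ∀ a b, Rep (z a b) (t a b)) :
    Rep (fun y => ∑ a, ∑ b, (gInv g y a b : ℂ) * z a b y) (H.chart.spin.tr t) :=
  Rep.sum fun a => Rep.sum fun b => (H.rep_gi a b).mul (h a b)

theorem repT_trace {h : Tens 2} {t : (Fin 2 → Fin 4) → Smooth U} (ht : RepT h t) :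
    RepT (trace g h) (H.chart.spin.trT t) := fun _ => H.rep_tr fun a b => ht ![a, b]

theorem repT_metricPotential {i : Fin 5} {Φ : E4 → ℂ} {t : (Fin 4 → Fin 4) → Smooth U}
    (ht : RepT (tensorWPhi σ i Φ) t) :
    RepT (metricPotential g J σ i Φ) (H.chart.spin.metricPot H.lee t) := fun a =>
  H.rep_tr (z := fun c e y => nabla g (tensorWPhi σ i Φ) ![e, c, a 0, a 1, a 2] y
    + 4 * (leeForm g J e y : ℂ) * tensorWPhi σ i Φ ![c, a 0, a 1, a 2] y)
    fun c e => (H.repT_nabla ht ![e, c, a 0, a 1, a 2]).add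
    (((rep_ofNat 4).mul (H.repR_leeForm e)).mul (ht ![c, a 0, a 1, a 2]))

theorem repT_metricPert {i : Fin 5} {Φ : E4 → ℂ} {t : (Fin 4 → Fin 4) → Smooth U}
    (ht : RepT (tensorWPhi σ i Φ) t) :
    RepT (metricPert g J σ i Φ) (H.chart.spin.metricPert (H.chart.spin.metricPot H.lee t)) := by
  intro a
  have h := H.repT_nabla (H.repT_metricPotential ht)
  have h2 := (H.rep_tr fun d e => h ![e, a 0, a 1, d]).neg
  intro y hy
  rw [SpinChart.metricPert, ← h2 y hy]
  rfl

theorem rep_linEinstein {h : Tens 2} {t : (Fin 2 → Fin 4) → Smooth U} (ht : RepT h t) (lam : ℝ)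
    (a b : Fin 4) : Rep (fun y => 2 * linEinstein g lam h a b y)
      (H.chart.spin.linEin (algebraMap ℂ (Smooth U) lam) t a b) := by
  have hn := H.repT_nabla (H.repT_nabla ht)
  have hs := H.repT_nabla (H.repT_nabla (H.repT_trace ht))
  have key := (((((H.rep_tr fun c d => hn ![c, d, a, b]).neg.sub (hs ![a, b])).add
    (H.rep_tr fun c d => (hn ![d, a, b, c]).add (hn ![d, b, a, c]))).sub
    ((H.rep_g a b).mul ((H.rep_tr fun c c' => H.rep_tr fun d d' => hn ![c', d', c, d]).sub
      (H.rep_tr fun c d => hs ![c, d])))).add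
    (((rep_ofNat 2).mul (rep_const (lam : ℂ))).mul (ht ![a, b])))
  intro y hy
  refine Eq.trans ?_ (key y hy)
  have h4 : ∑ c, ∑ d, ∑ c', ∑ d', (gInv g y c c' : ℂ) * (gInv g y d d' : ℂ) *
      nabla g (nabla g h) ![c', d', c, d] y = ∑ c, ∑ c', (gInv g y c c' : ℂ) *
        ∑ d, ∑ d', (gInv g y d d' : ℂ) * nabla g (nabla g h) ![c', d', c, d] y := by
    simp only [Finset.mul_sum, mul_assoc]
    exact Finset.sum_congr rfl fun c _ => Finset.sum_comm
  beta_reduce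
  rw [linEinstein, h4]
  ring

/-- The Teukolsky operator on a coordinate domain. -/
theorem rep_teukolskyOp {p : ℤ} {n : ℂ} (hp : (p : ℂ) = 2 * n) {χ : E4 → ℂ} {Φ : Smooth U}
    (hΦ : Rep χ Φ) : Rep (teukolskyOp g J σ 1 p χ) (H.chart.spin.teukolsky H.lee
      (H.chart.spin.confForm (algebraMap ℂ (Smooth U) n) H.lee) Φ) := by
  have hc : ∀ a, Rep (fun y => ((1 : ℝ) : ℂ) * (leeForm g J a y : ℂ) + (p : ℂ) * formP g J σ a y)
      (H.chart.spin.confForm (algebraMap ℂ (Smooth U) n) H.lee a) := by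
    intro a
    have key := ((rep_const ((1 : ℝ) : ℂ)).mul (H.repR_leeForm a).rep).add
      ((rep_const (p : ℂ)).mul (H.rep_formP a))
    convert key using 1
    have e1 : algebraMap ℂ (Smooth U) ((1 : ℝ) : ℂ) = 1 := by simp
    have e2 : algebraMap ℂ (Smooth U) (1 / 2 * Complex.I) =
        MetricChart.half * algebraMap ℂ (Smooth U) Complex.I := by rw [MetricChart.half, map_mul]
    rw [hp, e1, e2, map_mul, map_ofNat, SpinChart.confForm]
    have e3 : H.chart.spin.u a 0 0 = H.chart.u a 0 0 := rfl
    rw [e3]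
    -- The factor 1/2 in P cancels against p = 2n.
    linear_combination algebraMap ℂ (Smooth U) n * algebraMap ℂ (Smooth U) Complex.I *
      (∑ b, H.chart.spin.cplx a b * H.lee b) * MetricChart.two_mul_half (R := Smooth U)
  have hv : RepT (confD g J σ 1 p χ) (fun a : Fin 1 → Fin 4 => H.chart.spin.d (a 0) Φ +
      H.chart.spin.confForm (algebraMap ℂ (Smooth U) n) H.lee (a 0) * Φ) := fun a =>
    (H.rep_d hΦ (a 0)).add ((hc (a 0)).mul hΦ)
  have hv' : ∀ b, Rep (confD g J σ 1 p χ ![b]) (H.chart.spin.d b Φ +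
      H.chart.spin.confForm (algebraMap ℂ (Smooth U) n) H.lee b * Φ) := by
    intro b
    have h := hv ![b]
    simp only [Matrix.cons_val_zero] at h
    exact h
  have h1 := H.rep_tr fun c d => (H.repR_leeForm d).rep.mul (hv' c)
  have h2 := H.repT_nabla hv
  have h4 := fun a b => ((h2 ![a, b]).add ((hc a).mul (hv' b))).sub
    ((((H.repR_leeForm a).rep.mul (hv' b)).add ((H.repR_leeForm b).rep.mul (hv' a))).sub
      ((H.rep_g a b).mul h1))
  have h3 := H.rep_tr h4
  intro y hy
  rw [SpinChart.teukolsky, ← h3 y hy]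
  simp only [teukolskyOp, confDCovector, mul_assoc]

end HermitianChart

end QK

/-! ### Components of the symmetric spinors S^i. -/

namespace QK

/-- The spinor indices with `k` ones followed by zeros. -/
def sortedIndex (k : ℕ) (j : Fin 4) : Fin 2 := if (j : ℕ) < k then 1 else 0

/-- The component of `S^i_{ABCD}` with `k` indices equal to one. -/
noncomputable def dyadVal (i : Fin 5) (k : ℕ) : ℂ := dyadS i (sortedIndex k)

theorem dyadS_comp_perm (i : Fin 5) (K : Fin 4 → Fin 2) (ρ : Equiv.Perm (Fin 4)) :
    dyadS i (K ∘ ρ) = dyadS i K := by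
  simp only [dyadS, Function.comp_apply]
  congr 1
  exact Equiv.sum_comp (Equiv.mulLeft ρ) fun π : Equiv.Perm (Fin 4) => ∏ k : Fin 4,
    if (k : ℕ) < 4 - (i : ℕ) then lower oUp (K (π k)) else lower iotaUp (K (π k))

theorem exists_perm_sortedIndex : ∀ A B C D : Fin 2, ∃ ρ : Equiv.Perm (Fin 4),
    ∀ j, ![A, B, C, D] j = sortedIndex (A + B + C + D) (ρ j) := by
  decide

/-- By total symmetry a component depends only on the number of ones, as the algebraic part
requires. -/
theorem dyadS_eq_dyadVal (i : Fin 5) (A B C D : Fin 2) :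
    dyadS i ![A, B, C, D] = dyadVal i (A + B + C + D) := by
  obtain ⟨ρ, h⟩ := exists_perm_sortedIndex A B C D
  have e : ![A, B, C, D] = sortedIndex (A + B + C + D) ∘ ρ := funext h
  rw [dyadVal, e, dyadS_comp_perm]

/-- In the dyad, o_A is supported at A = 1 and ι_A at A = 0. A nonzero product therefore has exactly
as many ones as factors o, namely 4 - i. -/
theorem dyadVal_eq_zero {i : Fin 5} {k : ℕ} (hk : k ≤ 4) (h : k + i ≠ 4) : dyadVal i k = 0 := by
  rw [dyadVal, dyadS]
  refine mul_eq_zero_of_right _ (Finset.sum_eq_zero fun π _ => ?_)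
  by_contra hne
  apply h
  have hf : ∀ j : Fin 4, ((sortedIndex k (π j) : Fin 2) : ℕ) = if (j : ℕ) < 4 - (i : ℕ) then 1 else 0 := by
    intro j
    have hj := Finset.prod_ne_zero_iff.1 hne j (Finset.mem_univ j)
    generalize sortedIndex k (π j) = B at hj
    by_cases hlt : (j : ℕ) < 4 - (i : ℕ)
    · simp only [hlt, if_true] at hj ⊢
      fin_cases B
      · simp [lower, oUp, eps] at hj
      · rfl
    · simp only [hlt, if_false] at hj ⊢
      fin_cases B
      · rfl
      · simp [lower, iotaUp, eps] at hj
  -- The sum of the index values counts the ones and is unchanged by the permutation.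
  have h1 := Equiv.sum_comp π fun j => ((sortedIndex k j : Fin 2) : ℕ)
  rw [Finset.sum_congr rfl fun j _ => hf j] at h1
  simp only [Fin.sum_univ_four, sortedIndex] at h1
  clear hf hne h
  fin_cases i <;> interval_cases k <;> simp_all

/-- On the single nonzero component k = 4 - i, both factors equal i - 2. -/
theorem dyadVal_weight (i : Fin 5) {k : ℕ} (hk : k ≤ 4) :
    ((i : ℕ) - 2 : ℂ) * dyadVal i k = (2 - k) * dyadVal i k := by
  by_cases h : k + i = 4
  · have : (k : ℂ) + (i : ℕ) = 4 := by exact_mod_cast h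
    linear_combination dyadVal i k * this
  · rw [dyadVal_eq_zero hk h]; ring

namespace HermitianChart

variable {U : Set E4} {g J : MatField} {σ : Solder} (H : HermitianChart U g J σ)

theorem rep_low (a : Fin 4) {F : Fin 2 → Fin 2 → E4 → ℂ} {r : Fin 2 × Fin 2 → Smooth U}
    (h : ∀ A A', Rep (F A A') (r (A, A'))) :
    Rep (fun y => ∑ A, ∑ A', σ y a A A' * F A A' y) (H.chart.spin.low a r) := by
  rw [SpinChart.low, Fintype.sum_prod_type]
  exact Rep.sum fun A => Rep.sum fun A' => (H.rep_S a A A').mul (h A A')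

/-- Since S is symmetric, symmetrising over ab affects only the primed ε-spinors; the factor 1/2 is
moved into the components of S. -/
theorem repT_tensorWPhi (i : Fin 5) {Φ : E4 → ℂ} {r : Smooth U} (hΦ : Rep Φ r) :
    RepT (tensorWPhi σ i Φ) (H.chart.spin.ofFrame fun α => SpinChart.weylPot
      (fun A B C D => algebraMap ℂ (Smooth U) (1 / 2 * dyadVal i (A + B + C + D)) * r)
        (α 0) (α 1) (α 2) (α 3)) := by
  intro a
  set φ : Fin 2 → Fin 2 → Fin 2 → Fin 2 → Smooth U := fun A B C D =>
    algebraMap ℂ (Smooth U) (1 / 2 * dyadVal i (A + B + C + D)) * r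
  rw [H.chart.spin.ofFrame4 fun α β γ δ => SpinChart.weylPot φ α β γ δ]
  have h : ∀ A A' B B' C C' D D' : Fin 2, Rep (fun y => 1 / 2 * dyadVal i (A + B + C + D) * Φ y *
      (eps A' B' * eps C' D' + eps A' C' * eps B' D'))
      (SpinChart.weylPot φ (A, A') (B, B') (C, C') (D, D')) :=
    fun A A' B B' C C' D D' => ((rep_const _).mul hΦ).mul
      (((rep_ee A' B').mul (rep_ee C' D')).add ((rep_ee A' C').mul (rep_ee B' D')))
  have key := H.rep_low (a 0) (r := fun α => H.chart.spin.low (a 1) fun β =>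
      H.chart.spin.low (a 2) fun γ => H.chart.spin.low (a 3) fun δ => SpinChart.weylPot φ α β γ δ)
    fun A A' => H.rep_low (a 1) (r := fun β => H.chart.spin.low (a 2) fun γ =>
      H.chart.spin.low (a 3) fun δ => SpinChart.weylPot φ (A, A') β γ δ)
    fun B B' => H.rep_low (a 2) (r := fun γ => H.chart.spin.low (a 3) fun δ =>
      SpinChart.weylPot φ (A, A') (B, B') γ δ)
    fun C C' => H.rep_low (a 3) (r := fun δ => SpinChart.weylPot φ (A, A') (B, B') (C, C') δ)
    fun D D' => h A A' B B' C C' D D'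
  intro y hy
  refine Eq.trans ?_ (key y hy)
  simp only [tensorWPhi, tensorW, dyadS_eq_dyadVal]
  simp only [Fin.sum_univ_two, Fin.val_zero, Fin.val_one, Nat.reduceAdd]
  simp [eps]
  ring

end HermitianChart

end QK

/-! ### The theorem on a coordinate domain. -/

namespace QK

namespace HermitianChart

variable {U : Set E4} {g J : MatField} {σ : Solder}

/-- Metric perturbations from Teukolsky solutions, on a coordinate domain. -/
theorem metricPert_solves (H : HermitianChart U g J σ)
    (hJ : ∀ y ∈ U, ∀ a b c, nijenhuis J c a b y = 0) {lam : ℝ}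
    (hR : ∀ y ∈ U, ∀ a b, ricci g a b y = lam * g y a b)
    (hW : ∀ y ∈ U, ∀ A B C D, weylSpinor g σ A B C D y = 0) (i : Fin 5) {χ : E4 → ℂ}
    (hχ : ContDiffOn ℝ ∞ χ U)
    (hT : ∀ y ∈ U, teukolskyOp g J σ 1 (2 * ((i : ℕ) : ℤ) - 4) χ y = 0)
    {y : E4} (hy : y ∈ U) (a b : Fin 4) :
    metricPert g J σ i χ ![a, b] y = metricPert g J σ i χ ![b, a] y ∧
    trace g (metricPert g J σ i χ) ![] y = 0 ∧
    linEinstein g lam (metricPert g J σ i χ) a b y = 0 := by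
  have hΦ := rep_mk χ hχ
  set Φ := Smooth.mk χ hχ
  have hT' : H.chart.spin.teukolsky H.lee (H.chart.spin.confForm
      (algebraMap ℂ (Smooth U) ((i : ℕ) - 2)) H.lee) Φ = 0 := by
    refine Rep.ext (H.rep_teukolskyOp (p := 2 * ((i : ℕ) : ℤ) - 4) ?_ hΦ) fun y hy => ?_
    · push_cast; ring
    · rw [hT y hy]; rfl
  obtain ⟨h1, h2, h3⟩ := H.chart.spin.linEin_metricPert (lam := algebraMap ℂ (Smooth U) lam)
    (fun a => Derivation.map_algebraMap _ _) (H.riem_ricci hR) (H.weylS_eq_zero hR hW)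
    (H.nijHalf_symm hJ) H.two_mul_lee (n := algebraMap ℂ (Smooth U) ((i : ℕ) - 2))
    (s := fun k => algebraMap ℂ (Smooth U) (1 / 2 * dyadVal i k))
    (fun a => Derivation.map_algebraMap _ _) (fun a k => Derivation.map_algebraMap _ _)
    (fun k hk => by
      have h2k : (2 - k : Smooth U) = algebraMap ℂ (Smooth U) (2 - k) := by
        rw [map_sub, map_ofNat, map_natCast]
      rw [h2k, ← map_mul, ← map_mul]
      congr 1
      linear_combination 1 / 2 * dyadVal_weight i hk) hT'
  have hh := H.repT_metricPert (J := J) (H.repT_tensorWPhi i hΦ)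
  generalize H.chart.spin.metricPert _ = t at hh h1 h2 h3
  refine ⟨?_, ?_, ?_⟩
  · have e1 := hh ![a, b] y hy
    have e2 := hh ![b, a] y hy
    rw [h1] at e1
    rw [e1, e2]
  · rw [H.repT_trace hh ![] y hy, h2]; rfl
  · have h := H.rep_linEinstein hh lam a b y hy
    rw [h3] at h
    exact (mul_eq_zero.1 h).resolve_left two_ne_zero

end HermitianChart

end QK

/-! ### Charts and frames on the manifold. -/

namespace QK

section

variable {M : Type*} [TopologicalSpace M] [ChartedSpace E4 M] [IsManifold (𝓡 4) ∞ M]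
  {e : OpenPartialHomeomorph M E4}

theorem mdifferentiable_of_mem_maximalAtlas (he : e ∈ IsManifold.maximalAtlas (𝓡 4) ∞ M) :
    e.MDifferentiable (𝓡 4) (𝓡 4) :=
  ⟨(contMDiffOn_of_mem_maximalAtlas he).mdifferentiableOn (by simp),
    (contMDiffOn_symm_of_mem_maximalAtlas he).mdifferentiableOn (by simp)⟩

/-- The differential of the chart, on the tangent space at the point with coordinates `y`. -/
noncomputable def chartDeriv (e : OpenPartialHomeomorph M E4) (y : E4) :
    TangentSpace (𝓡 4) (e.symm y) →L[ℝ] E4 := mfderiv (𝓡 4) (𝓡 4) e (e.symm y)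

theorem chartDeriv_coordVec (he : e ∈ IsManifold.maximalAtlas (𝓡 4) ∞ M) {y : E4}
    (hy : y ∈ e.target) (a : Fin 4) : chartDeriv e y (coordVec e a y) = EuclideanSpace.single a 1 :=
  congrArg (fun L : E4 →L[ℝ] E4 => L (EuclideanSpace.single a 1))
    ((mdifferentiable_of_mem_maximalAtlas he).comp_symm_deriv hy)

theorem chartDeriv_injective (he : e ∈ IsManifold.maximalAtlas (𝓡 4) ∞ M) {y : E4}
    (hy : y ∈ e.target) : Function.Injective (chartDeriv e y) :=
  (mdifferentiable_of_mem_maximalAtlas he).mfderiv_injective (e.map_target hy)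

theorem chartDeriv_sum (he : e ∈ IsManifold.maximalAtlas (𝓡 4) ∞ M) {y : E4}
    (hy : y ∈ e.target) (v : Fin 4 → ℝ) (b : Fin 4) :
    chartDeriv e y (∑ a, v a • coordVec e a y) b = v b := by
  simp only [map_sum, map_smul, chartDeriv_coordVec he hy]
  simp [Pi.single_apply]

theorem sum_coordVec (he : e ∈ IsManifold.maximalAtlas (𝓡 4) ∞ M) {y : E4}
    (hy : y ∈ e.target) (v : TangentSpace (𝓡 4) (e.symm y)) :
    ∑ a, chartDeriv e y v a • coordVec e a y = v := by
  apply chartDeriv_injective he hy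
  ext b
  exact chartDeriv_sum he hy _ b

/-- A kernel vector of the matrix would be a tangent vector of length zero, excluded by positivity
and the independence of the coordinate vectors. -/
theorem det_metricC_ne_zero (g : Metric M) (he : e ∈ IsManifold.maximalAtlas (𝓡 4) ∞ M) {y : E4}
    (hy : y ∈ e.target) : (metricC g e y).det ≠ 0 := by
  intro h
  obtain ⟨v, hv, h0⟩ := Matrix.exists_mulVec_eq_zero_iff.2 h
  apply hv
  have hz : ∑ a, v a • coordVec e a y = 0 := by
    by_contra hne
    have hpos := g.pos (e.symm y) _ hne
    have hsum : g.inner (e.symm y) (∑ a, v a • coordVec e a y) (∑ a, v a • coordVec e a y) =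
        ∑ a, v a * (metricC g e y).mulVec v a := by
      simp only [map_sum, map_smul, _root_.sum_apply, _root_.smul_apply,
        smul_eq_mul, Matrix.mulVec, dotProduct, metricC, Matrix.of_apply, Finset.mul_sum]
      rw [Finset.sum_comm]
      exact Finset.sum_congr rfl fun _ _ => Finset.sum_congr rfl fun _ _ => by ring
    rw [hsum, h0] at hpos
    simp at hpos
  funext b
  rw [← chartDeriv_sum he hy v b, hz, map_zero]
  rfl

variable {g : Metric M} {𝒥 : ComplexStructure g}

theorem IsLocalFrame.hermitianChart {s : ∀ x, PrincipalFrame g 𝒥 x} {U : Set E4}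
    (hs : IsLocalFrame s e U) :
    HermitianChart U (metricC g e) (endoC 𝒥.J e) (solderC s e) where
  isOpen := hs.isOpen
  metric y _ a b := (s (e.symm y)).metric _ _
  det y hy := det_metricC_ne_zero g hs.chart (hs.subset hy)
  smooth := hs.smooth
  complex y hy a A A' := by
    -- J ∂_a is expanded in the coordinate basis, turning the invariant eigenvalue condition into
    -- one on components.
    have h1 := congrArg (fun v => (s (e.symm y)).s v A A')
      (sum_coordVec hs.chart (hs.subset hy) (𝒥.J (e.symm y) (coordVec e a y)))
    have h2 := (s (e.symm y)).complex (coordVec e a y) A A'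
    simp only [map_sum, map_smul, Matrix.sum_apply, Matrix.smul_apply] at h1
    rw [h2] at h1
    refine Eq.trans (Finset.sum_congr rfl fun c _ => ?_) (h1.trans ?_)
    · exact (Complex.real_smul (x := chartDeriv e y (𝒥.J (e.symm y) (coordVec e a y)) c)).symm
    · simp only [Fin.sum_univ_two, lower, oUp, iotaUp, eps, solderC]
      fin_cases A <;> simp

end

end QK

/-- The assertion is local: all hypotheses are evaluated in the chart over `U`, where the frame
field provides a `HermitianChart`. -/
theorem mainTheorem7 {M : Type*} [TopologicalSpace M] [ChartedSpace QK.E4 M]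
    [IsManifold (𝓡 4) ∞ M] (g : QK.Metric M) (𝒥 : QK.ComplexStructure g) (lam : ℝ)
    (hQK : QK.IsQuaternionicKahler g 𝒥 lam) (i : Fin 5)
    (Φ : QK.WeightedScalar g 𝒥 (2 * ((i : ℕ) : ℤ) - 4)) (hΦ : QK.SolvesTeukolsky 1 Φ)
    (s : ∀ x, QK.PrincipalFrame g 𝒥 x) (e : OpenPartialHomeomorph M QK.E4) (U : Set QK.E4)
    (hs : QK.IsLocalFrame s e U) (y : QK.E4) (hy : y ∈ U) (a b : Fin 4) :
    QK.metricPert (QK.metricC g e) (QK.endoC 𝒥.J e) (QK.solderC s e) i (Φ.rep s e) ![a, b] y =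
      QK.metricPert (QK.metricC g e) (QK.endoC 𝒥.J e) (QK.solderC s e) i (Φ.rep s e) ![b, a] y ∧
    QK.trace (QK.metricC g e) (QK.metricPert (QK.metricC g e) (QK.endoC 𝒥.J e)
      (QK.solderC s e) i (Φ.rep s e)) ![] y = 0 ∧
    QK.linEinstein (QK.metricC g e) lam (QK.metricPert (QK.metricC g e) (QK.endoC 𝒥.J e)
      (QK.solderC s e) i (Φ.rep s e)) a b y = 0 :=
  hs.hermitianChart.metricPert_solves
    (fun y hy a b c => 𝒥.integrable e hs.chart y (hs.subset hy) a b c)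
    (fun y hy a b => hQK.einstein e hs.chart y (hs.subset hy) a b)
    (fun y hy A B C D => hQK.selfDual e hs.chart y (hs.subset hy) s A B C D) i
    (Φ.smooth s e U hs) (fun y hy => hΦ s e U hs y hy) hy a b
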